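/- Let $V\in\mathcal S(\mathbb R^3)$ be real valued and let $H=-\Delta+V$ be the self-adjoint operator on $L^2(\mathbb R^3,\mathbb C)$ with domain $H^2(\mathbb R^3)$. Let $e<0$ be a simple eigenvalue of $H$ and let $\phi$ be a real-valued eigenfunction for $e$ with $\|\phi\|_{L^2}=1$. For $r\in\mathbb N_0$ and $\mathbb K\in\{\mathbb R,\mathbb C\}$ let $\Sigma_r(\mathbb R^3,\mathbb K)$ be the completion of $C_c^\infty(\mathbb R^3,\mathbb K)$ for the norm $\|u\|_{\Sigma_r}^2=\sum_{|\alpha|\le r}(\|x^\alpha u\|_{L^2}^2+\|\partial_x^\alpha u\|_{L^2}^2)$. For $z\in\mathbb C$, call $(Q,E)\in\mathcal S(\mathbb R^3,\mathbb C)\times\mathbb R$ a bound state with parameter $z$ if $$-\Delta Q+VQ+|Q|^2Q=EQ,\qquad Q=z\phi+q,\qquad \int_{\mathbb R^3}q\,\overline{\phi}\,dx=0 .$$ Then there exist $a_0>0$ and, for every $z\in B=\{z\in\mathbb C:|z|<a_0\}$, a bound state $(Q_z,E_z)$ with parameter $z$, $Q_z=z\phi+q_z$, $q_z\in\mathcal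 S(\mathbb R^3,\mathbb C)$, such that for every $r\in\mathbb N_0$: (1) $z\mapsto(q_z,E_z)$ is $C^\infty$ (in the real sense) from $B$ to $\Sigma_r(\mathbb R^3,\mathbb C)\times\mathbb R$; moreover $q_z=z\,\hat q(|z|^2)$ for $z\in B$ and $\hat q(t^2)=t^2\tilde q(t^2)$ for $|t|<a_0$, where $\hat q,\tilde q$ take values in $\mathcal S(\mathbb R^3,\mathbb R)$, do not depend on $r$, and $\tilde q\in C^\infty((-a_0^2,a_0^2),\Sigma_r(\mathbb R^3,\mathbb R))$; and $E_z=\mathcal E(|z|^2)$ with $\mathcal E\in C^\infty((-a_0^2,a_0^2),\mathbb R)$; (2) there is $C>0$, depending on $r$ but not on $z$, such that $\|q_z\|_{\Sigma_r}\le C|z|^3$ and $|E_z-e|\le C|z|^2$ for all $z\in B$. The family is unique in the following two senses. (3) Every family of bound states $(Q'_z,E'_z)_{z\in B}$, with parameters $z\in B$, that has properties (1) and (2) for every $r$ (with its own functions and constants) equals $(Q_z,E_z)_{z\in B}$. (4) There is $\delta>0$ such that for each $z\in B$ one has $\|q_z\|_{\Sigma_2}\le\delta|z|$, and every bound state $(Q',E')$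 with parameter $z$ for which $q'=Q'-z\phi$ is a Schwartz function with $\|q'\|_{\Sigma_2}\le\delta|z|$ satisfies $Q'=Q_z$, and also $E'=E_z$ if $z\ne0$. -/

import Mathlib

open MeasureTheory
open scoped SchwartzMap LineDeriv Laplacian ContDiff ENNReal

noncomputable section

namespace NLSBoundState

/-- Physical space `ℝ³` with its Euclidean structure. -/
abbrev R3 : Type := EuclideanSpace ℝ (Fin 3)

/-- The Hilbert space `L²(ℝ³, ℂ)`. -/
abbrev L2 : Type := Lp ℂ 2 (volume : Measure R3)

/-! ### The Schrödinger operator `H = -Δ + V` and its eigenspaces -/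

/-- `H u = -Δ u + V u` for `u ∈ L²(ℝ³, ℂ)`, computed in the sense of tempered distributions. -/
def schrodinger (V : 𝓢(R3, ℝ)) (u : L2) : 𝓢'(R3, ℂ) :=
  -(Δ (u : 𝓢'(R3, ℂ))) +
    TemperedDistribution.smulLeftCLM ℂ (fun x => ((V x : ℝ) : ℂ)) (u : 𝓢'(R3, ℂ))

/-- The potential is a smooth function of temperate growth, so `schrodinger` pairs with a Schwartz
function `ψ` as `⟨u, -Δψ + V ψ⟩`. -/
theorem schrodinger_apply (V : 𝓢(R3, ℝ)) (u : L2) (ψ : 𝓢(R3, ℂ)) :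
    schrodinger V u ψ = ∫ x, (-(Δ ψ) x + ((V x : ℝ) : ℂ) * ψ x) * u x := by
  have hV : (fun x => ((V x : ℝ) : ℂ)).HasTemperateGrowth :=
    Complex.ofRealCLM.hasTemperateGrowth.comp V.hasTemperateGrowth
  have h1 : schrodinger V u ψ = (u : 𝓢'(R3, ℂ))
      (-(Δ ψ) + SchwartzMap.smulLeftCLM ℂ (fun x => ((V x : ℝ) : ℂ)) ψ) := by
    rw [map_add, map_neg, ← TemperedDistribution.laplacian_apply_apply,
      ← TemperedDistribution.smulLeftCLM_apply_apply]
    rfl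
  rw [h1, Lp.toTemperedDistribution_apply]
  refine integral_congr_ae (Filter.Eventually.of_forall fun x => ?_)
  simp [SchwartzMap.smulLeftCLM_apply_apply hV]

/-- The eigenspace `{u ∈ H²(ℝ³, ℂ) : H u = e u}` of the self-adjoint operator `H = -Δ + V` with
domain the Sobolev space `H²`, as a complex subspace of `L²`. -/
def eigenspace (V : 𝓢(R3, ℝ)) (e : ℝ) : Submodule ℂ L2 where
  carrier := {u | TemperedDistribution.MemSobolev 2 2 (u : 𝓢'(R3, ℂ)) ∧
    schrodinger V u = (e : ℂ) • (u : 𝓢'(R3, ℂ))}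
  zero_mem' := by
    have h0 : ((0 : L2) : 𝓢'(R3, ℂ)) = 0 := map_zero (Lp.toTemperedDistributionCLM ℂ volume 2)
    refine ⟨?_, ?_⟩
    · rw [h0]; exact TemperedDistribution.memSobolev_fun_zero R3 ℂ 2 2
    · have hL : Δ (0 : 𝓢'(R3, ℂ)) = 0 := by
        rw [← TemperedDistribution.laplacianCLM_apply, map_zero]
      simp only [schrodinger, h0, hL, map_zero, smul_zero, neg_zero, add_zero]
  add_mem' := by
    rintro u v ⟨hu1, hu2⟩ ⟨hv1, hv2⟩
    have ha : ((u + v : L2) : 𝓢'(R3, ℂ)) = (u : 𝓢'(R3, ℂ)) + (v : 𝓢'(R3, ℂ)) :=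
      map_add (Lp.toTemperedDistributionCLM ℂ volume 2) u v
    refine ⟨?_, ?_⟩
    · rw [ha]; exact hu1.add hv1
    · simp only [schrodinger] at hu2 hv2 ⊢
      rw [ha, smul_add, ← hu2, ← hv2]
      simp only [← TemperedDistribution.laplacianCLM_apply, map_add]
      abel
  smul_mem' := by
    rintro c u ⟨hu1, hu2⟩
    have ha : ((c • u : L2) : 𝓢'(R3, ℂ)) = c • (u : 𝓢'(R3, ℂ)) :=
      map_smul (Lp.toTemperedDistributionCLM ℂ volume 2) c u
    refine ⟨?_, ?_⟩
    · rw [ha]; exact hu1.smul c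
    · simp only [schrodinger] at hu2 ⊢
      rw [ha, smul_comm (e : ℂ) c, ← hu2]
      simp only [← TemperedDistribution.laplacianCLM_apply, map_smul, smul_add, smul_neg]

/-! ### The weighted Sobolev spaces `Σ_r(ℝ³, 𝕜)` -/

section SigmaSpace

variable (𝕜 : Type) [RCLike 𝕜]

/-- Multi-indices `α ∈ ℕ³` with `|α| ≤ r`. -/
abbrev MultiIndex (r : ℕ) : Type := {α : Fin 3 → Fin (r + 1) // ∑ i, (α i : ℕ) ≤ r}

/-- Multiplication by `x^α = x₁^α₁ x₂^α₂ x₃^α₃` on Schwartz functions. -/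
def mulMonomial (α : Fin 3 → ℕ) : 𝓢(R3, 𝕜) →L[𝕜] 𝓢(R3, 𝕜) :=
  SchwartzMap.smulLeftCLM 𝕜 (fun x : R3 => ((∏ i, x i ^ α i : ℝ) : 𝕜))

theorem hasTemperateGrowth_monomial (α : Fin 3 → ℕ) :
    (fun x : R3 => ((∏ i, x i ^ α i : ℝ) : 𝕜)).HasTemperateGrowth := by
  have h : ∀ i : Fin 3, (fun x : R3 => x i).HasTemperateGrowth := fun i =>
    (EuclideanSpace.proj i : R3 →L[ℝ] ℝ).hasTemperateGrowth
  have h2 : (fun x : R3 => (∏ i, x i ^ α i : ℝ)).HasTemperateGrowth := by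
    have hp : ∀ (i : Fin 3) (n : ℕ), (fun x : R3 => x i ^ n).HasTemperateGrowth := by
      intro i n
      induction n with
      | zero => simp only [pow_zero]; exact Function.HasTemperateGrowth.const (1 : ℝ)
      | succ n ih => simp only [pow_succ]; exact ih.mul (h i)
    simp only [Fin.prod_univ_three]
    exact ((hp 0 _).mul (hp 1 _)).mul (hp 2 _)
  exact (RCLike.ofRealCLM (K := 𝕜)).hasTemperateGrowth.comp h2

theorem mulMonomial_apply (α : Fin 3 → ℕ) (u : 𝓢(R3, 𝕜)) (x : R3) :
    mulMonomial 𝕜 α u x = ((∏ i, x i ^ α i : ℝ) : 𝕜) * u x := by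
  rw [mulMonomial, SchwartzMap.smulLeftCLM_apply_apply (hasTemperateGrowth_monomial 𝕜 α),
    smul_eq_mul]

/-- The partial derivative `∂_i` on Schwartz functions. -/
def partialDeriv (i : Fin 3) : 𝓢(R3, 𝕜) →L[𝕜] 𝓢(R3, 𝕜) :=
  LineDeriv.lineDerivOpCLM 𝕜 𝓢(R3, 𝕜) (EuclideanSpace.single i (1 : ℝ))

/-- The derivative `∂^α = ∂₁^α₁ ∂₂^α₂ ∂₃^α₃` on Schwartz functions. -/
def multiDeriv (α : Fin 3 → ℕ) : 𝓢(R3, 𝕜) →L[𝕜] 𝓢(R3, 𝕜) :=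
  partialDeriv 𝕜 0 ^ α 0 * partialDeriv 𝕜 1 ^ α 1 * partialDeriv 𝕜 2 ^ α 2

/-- The finite Hilbert sum of copies of `L²(ℝ³, 𝕜)`, two for every multi-index `|α| ≤ r`. -/
abbrev SigmaAmbient (r : ℕ) : Type :=
  PiLp 2 (fun _ : MultiIndex r ⊕ MultiIndex r => Lp 𝕜 2 (volume : Measure R3))

/-- The map `u ↦ ((x^α u)_{|α| ≤ r}, (∂^α u)_{|α| ≤ r})`. The norm of the image of `u` is the
`Σ_r`-norm of `u`. -/
def sigmaEmbed (r : ℕ) : 𝓢(R3, 𝕜) →ₗ[𝕜] SigmaAmbient 𝕜 r :=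
  (WithLp.linearEquiv 2 𝕜
      (MultiIndex r ⊕ MultiIndex r → Lp 𝕜 2 (volume : Measure R3))).symm.toLinearMap ∘ₗ
    LinearMap.pi (fun i => (SchwartzMap.toLpCLM 𝕜 𝕜 2 (volume : Measure R3)).toLinearMap ∘ₗ
      (Sum.elim (fun α : MultiIndex r => mulMonomial 𝕜 (fun k => (α.1 k : ℕ)))
        (fun α : MultiIndex r => multiDeriv 𝕜 (fun k => (α.1 k : ℕ))) i).toLinearMap)

/-- The Banach space `Σ_r(ℝ³, 𝕜)`: the completion of the smooth, rapidly decaying functions for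
the norm `‖u‖² = ∑_{|α| ≤ r} (‖x^α u‖² + ‖∂^α u‖²)` (all norms on the right in `L²`), realized as
the closure of their isometric image in a complete space. Since compactly supported smooth
functions are dense in the Schwartz space, this is also the completion of those. -/
def SigmaSpace (r : ℕ) : Submodule 𝕜 (SigmaAmbient 𝕜 r) :=
  (LinearMap.range (sigmaEmbed 𝕜 r)).topologicalClosure

/-- A Schwartz function as an element of `Σ_r(ℝ³, 𝕜)`. -/
def toSigma (r : ℕ) (u : 𝓢(R3, 𝕜)) : SigmaSpace 𝕜 r :=
  ⟨sigmaEmbed 𝕜 r u, Submodule.le_topologicalClosure _ (LinearMap.mem_range_self _ u)⟩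

/-- The norm of `Σ_r` on Schwartz functions is the expected one. -/
theorem norm_toSigma_sq (r : ℕ) (u : 𝓢(R3, 𝕜)) :
    ‖toSigma 𝕜 r u‖ ^ 2 = ∑ α : MultiIndex r,
      (‖(mulMonomial 𝕜 (fun k => (α.1 k : ℕ)) u).toLp 2 (volume : Measure R3)‖ ^ 2 +
        ‖(multiDeriv 𝕜 (fun k => (α.1 k : ℕ)) u).toLp 2 (volume : Measure R3)‖ ^ 2) := by
  have h : ‖toSigma 𝕜 r u‖ = ‖sigmaEmbed 𝕜 r u‖ := rfl
  rw [h, PiLp.norm_sq_eq_of_L2, Fintype.sum_sum_type, Finset.sum_add_distrib]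
  rfl

end SigmaSpace

/-! ### Nonlinear bound states -/

/-- `(Q, E)` is a bound state with parameter `z` and remainder `q`:
`-ΔQ + V Q + |Q|² Q = E Q`, `Q = z φ + q`, and `q` is orthogonal to `φ` in `L²(ℝ³, ℂ)`. -/
structure IsBoundState (V : 𝓢(R3, ℝ)) (φ : L2) (z : ℂ) (Q q : 𝓢(R3, ℂ)) (E : ℝ) : Prop where
  equation : ∀ x : R3,
    -((Δ Q) x) + ((V x : ℝ) : ℂ) * Q x + ((‖Q x‖ ^ 2 : ℝ) : ℂ) * Q x = (E : ℂ) * Q x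
  decomposition : Q.toLp 2 (volume : Measure R3) = z • φ + q.toLp 2 (volume : Measure R3)
  orthogonal : ∫ x : R3, q x * (starRingEnd ℂ) (φ x) = 0

/-- A family of Schwartz bound states over the disc `|z| < a` bifurcating from the eigenvalue `e`
with eigenfunction `φ`, together with its smoothness, gauge structure and size bounds. -/
structure IsBoundStateFamily (V : 𝓢(R3, ℝ)) (e : ℝ) (φ : L2) (a : ℝ)
    (Q q : ℂ → 𝓢(R3, ℂ)) (E : ℂ → ℝ) : Prop where
  boundState : ∀ z ∈ Metric.ball (0 : ℂ) a, IsBoundState V φ z (Q z) (q z) (E z)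
  /-- `z ↦ (q_z, E_z)` is `C^∞` (in the real sense) into `Σ_r × ℝ` for every `r`. -/
  smooth : ∀ r : ℕ,
    ContDiffOn ℝ ∞ (fun z : ℂ => (toSigma ℂ r (q z), E z)) (Metric.ball (0 : ℂ) a)
  /-- `q_z = z q̂(|z|²)` with `q̂(t²) = t² q̃(t²)` and `q̃` smooth with real-valued values. -/
  profile : ∃ qhat qtilde : ℝ → 𝓢(R3, ℝ),
    (∀ z ∈ Metric.ball (0 : ℂ) a, ∀ x : R3, q z x = z * ((qhat (‖z‖ ^ 2) x : ℝ) : ℂ)) ∧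
    (∀ t : ℝ, |t| < a → qhat (t ^ 2) = t ^ 2 • qtilde (t ^ 2)) ∧
    ∀ r : ℕ, ContDiffOn ℝ ∞ (fun t : ℝ => toSigma ℝ r (qtilde t)) (Set.Ioo (-a ^ 2) (a ^ 2))
  /-- `E_z` is a smooth function of `|z|²`. -/
  energyProfile : ∃ Efun : ℝ → ℝ,
    (∀ z ∈ Metric.ball (0 : ℂ) a, E z = Efun (‖z‖ ^ 2)) ∧
    ContDiffOn ℝ ∞ Efun (Set.Ioo (-a ^ 2) (a ^ 2))
  bounds : ∀ r : ℕ, ∃ C : ℝ, 0 < C ∧ ∀ z ∈ Metric.ball (0 : ℂ) a,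
    ‖toSigma ℂ r (q z)‖ ≤ C * ‖z‖ ^ 3 ∧ |E z - e| ≤ C * ‖z‖ ^ 2

end NLSBoundState

end

/-!
Bound states of `-ΔQ + VQ + |Q|²Q = EQ` bifurcating from a simple negative eigenvalue `e` of
`H = -Δ + V`.

**Reduction to real functions.** A real profile `Q(s) = φ + p(s)` with `⟨φ, p(s)⟩ = 0` and
`(H - e) Q + s Q³ = s λ(s) Q` gives the bound state `z Q(|z|²)` with energy `e + |z|² λ(|z|²)` for
every complex `z`, so the analysis of the branch takes place in the real Schwartz space.

**Linear theory.** With `c = -e > 0`, the resolvent `(c - Δ)⁻¹` is a Fourier multiplier (`res`). The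
norm `N k` measures the application of at most `k` coordinate multiplications and derivatives, and
`X k` is the completion for it. The resolvent is bounded on all `X k`, and it gains one order after
multiplication by a Schwartz function or, for `k ≥ 4`, on products of two elements of `X k`.
Thus `φ = -(c - Δ)⁻¹ V φ` is a Schwartz function (`exists_schwartz_eigenfunction`). The operator
`V (c - Δ)⁻¹` has a square integrable kernel with values in the dual of `L²`, hence is compact, and
simplicity of `e` makes `H - e + ⟨φ, ·⟩ φ` injective; by the Fredholm alternative it has an inverse
`G` which is bounded for all the norms (`exists_green`).

**The branch.** The equation for the profile becomes `Q = φ - s G(Q³ - ⟨φ, Q³⟩ Q)`, which the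
implicit function theorem solves in `X 4` near `s = 0` (`IsBorderedGreen.exists_branch`). The
interval of existence does not shrink in stronger norms: the solution also satisfies
`Q = -(1 - μ (c - Δ)⁻¹)⁻¹ (c - Δ)⁻¹ (V Q + s Q³)` with `μ = s λ(s) < c`, and the right-hand side
gains one order, smoothly in `s` (`exists_smooth_schwartz_branch`). An element of all the `X k` is a
Schwartz function (`exists_schwartz_of_compatible`), and `X r` maps continuously to `Σ_r`.

**Uniqueness.** Dividing a bound state by `z` gives an equation with the small factor `|z|²` in front
of the nonlinearity. As `Σ_2` controls the supremum norm, the bound on the inverse `G` in `L²` makes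
it a contraction on the set `‖q‖_{Σ_2} ≤ |z|` (`IsBorderedGreen.exists_unique_boundState`). A family
with the bounds `‖q_z‖ ≤ C|z|³` stays in this set over the whole disc by continuity along rays, since
solutions in the set satisfy the stronger bound `|z| / 2` (`IsBoundStateFamily.norm_le`).
-/

noncomputable section

namespace NLSBoundState

/-! ### Coordinate multiplications, derivatives and products on real Schwartz functions -/

/-- Multiplication by the coordinate `x_j`. -/
def mulCoord (j : Fin 3) : 𝓢(R3, ℝ) →L[ℝ] 𝓢(R3, ℝ) :=
  SchwartzMap.smulLeftCLM ℝ (fun x : R3 => x j)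

theorem hasTemperateGrowth_coord (j : Fin 3) : (fun x : R3 => x j).HasTemperateGrowth :=
  (EuclideanSpace.proj j : R3 →L[ℝ] ℝ).hasTemperateGrowth

@[simp]
theorem mulCoord_apply (j : Fin 3) (f : 𝓢(R3, ℝ)) (x : R3) : mulCoord j f x = x j * f x := by
  rw [mulCoord, SchwartzMap.smulLeftCLM_apply_apply (hasTemperateGrowth_coord j), smul_eq_mul]

theorem partialDeriv_apply (𝕜 : Type) [RCLike 𝕜] (j : Fin 3) (f : 𝓢(R3, 𝕜)) (x : R3) :
    partialDeriv 𝕜 j f x = fderiv ℝ f x (EuclideanSpace.single j 1) := rfl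

/-- The pointwise product of two Schwartz functions, as a bilinear map. -/
def mulS : 𝓢(R3, ℝ) →ₗ[ℝ] 𝓢(R3, ℝ) →ₗ[ℝ] 𝓢(R3, ℝ) :=
  LinearMap.mk₂ ℝ (fun f g => SchwartzMap.pairing (ContinuousLinearMap.mul ℝ ℝ) f g)
    (by intros; simp) (by intros; simp) (by intros; simp) (by intros; simp)

@[simp]
theorem mulS_apply (f g : 𝓢(R3, ℝ)) (x : R3) : mulS f g x = f x * g x := rfl

theorem mulS_comm (f g : 𝓢(R3, ℝ)) : mulS f g = mulS g f := by
  ext x; simp [mul_comm]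

theorem partialDeriv_mulS (j : Fin 3) (f g : 𝓢(R3, ℝ)) :
    partialDeriv ℝ j (mulS f g) = mulS (partialDeriv ℝ j f) g + mulS f (partialDeriv ℝ j g) := by
  ext x
  have h : HasFDerivAt (mulS f g) (f x • fderiv ℝ g x + g x • fderiv ℝ f x) x :=
    (f.hasFDerivAt x).mul (g.hasFDerivAt x)
  simp only [partialDeriv_apply, mulS_apply, add_apply, h.fderiv]
  simp
  ring

theorem partialDeriv_mulCoord (i j : Fin 3) (f : 𝓢(R3, ℝ)) :
    partialDeriv ℝ i (mulCoord j f) =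
      (if i = j then f else 0) + mulCoord j (partialDeriv ℝ i f) := by
  ext x
  have h0 : HasFDerivAt (fun x : R3 => x j) (EuclideanSpace.proj j : R3 →L[ℝ] ℝ) x :=
    (EuclideanSpace.proj j : R3 →L[ℝ] ℝ).hasFDerivAt
  have h : HasFDerivAt (mulCoord j f)
      (x j • fderiv ℝ f x + f x • (EuclideanSpace.proj j : R3 →L[ℝ] ℝ)) x := by
    have := h0.mul (f.hasFDerivAt x)
    refine this.congr_of_eventuallyEq (Filter.Eventually.of_forall fun y => ?_)
    simp
  simp only [partialDeriv_apply, add_apply, h.fderiv, mulCoord_apply]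
  by_cases hij : i = j
  · subst hij; simp [add_comm]
  · simp [hij, Ne.symm hij]

theorem partialDeriv_comm (i j : Fin 3) (f : 𝓢(R3, ℝ)) :
    partialDeriv ℝ i (partialDeriv ℝ j f) = partialDeriv ℝ j (partialDeriv ℝ i f) := by
  ext x
  have hd : DifferentiableAt ℝ (fderiv ℝ f) x :=
    ((f.smooth 2).fderiv_right (m := 1) (by norm_num)).differentiable (by norm_num) x
  have key : ∀ k l : Fin 3, partialDeriv ℝ k (partialDeriv ℝ l f) x =
      fderiv ℝ (fderiv ℝ f) x (EuclideanSpace.single k 1) (EuclideanSpace.single l 1) := by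
    intro k l
    rw [partialDeriv_apply]
    have : (partialDeriv ℝ l f : R3 → ℝ) = fun y => fderiv ℝ f y (EuclideanSpace.single l 1) := rfl
    rw [this, fderiv_clm_apply hd (differentiableAt_const _)]
    simp
  rw [key, key]
  exact ((f.smooth 2).contDiffAt.isSymmSndFDerivAt (by simp)).eq _ _

theorem laplacian_eq_sum_partialDeriv (𝕜 : Type) [RCLike 𝕜] (f : 𝓢(R3, 𝕜)) :
    Δ f = ∑ i : Fin 3, partialDeriv 𝕜 i (partialDeriv 𝕜 i f) := by
  rw [SchwartzMap.laplacian_eq_sum (EuclideanSpace.basisFun (Fin 3) ℝ)]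
  simp [partialDeriv]

theorem mulCoord_comm (i j : Fin 3) (f : 𝓢(R3, ℝ)) :
    mulCoord i (mulCoord j f) = mulCoord j (mulCoord i f) := by
  ext x; simp; ring

theorem mulS_mulCoord (j : Fin 3) (f g : 𝓢(R3, ℝ)) :
    mulS (mulCoord j f) g = mulCoord j (mulS f g) := by
  ext x; simp; ring

theorem mulS_mulCoord_right (j : Fin 3) (f g : 𝓢(R3, ℝ)) :
    mulS f (mulCoord j g) = mulCoord j (mulS f g) := by
  ext x; simp; ring

/-- The Laplacian of a real Schwartz function as a linear map. -/
def lapl : 𝓢(R3, ℝ) →ₗ[ℝ] 𝓢(R3, ℝ) :=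
  ∑ i : Fin 3, ((partialDeriv ℝ i).toLinearMap ∘ₗ (partialDeriv ℝ i).toLinearMap)

theorem lapl_eq_sum (f : 𝓢(R3, ℝ)) :
    lapl f = ∑ i : Fin 3, partialDeriv ℝ i (partialDeriv ℝ i f) := by
  simp [lapl]

theorem lapl_eq (f : 𝓢(R3, ℝ)) : lapl f = Δ f := by
  rw [laplacian_eq_sum_partialDeriv, lapl_eq_sum]

theorem lapl_partialDeriv (j : Fin 3) (f : 𝓢(R3, ℝ)) :
    lapl (partialDeriv ℝ j f) = partialDeriv ℝ j (lapl f) := by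
  simp only [lapl_eq_sum, map_sum]
  refine Finset.sum_congr rfl fun i _ => ?_
  rw [partialDeriv_comm i j f, partialDeriv_comm i j]

theorem lapl_mulCoord (j : Fin 3) (f : 𝓢(R3, ℝ)) :
    lapl (mulCoord j f) = mulCoord j (lapl f) + (2 : ℝ) • partialDeriv ℝ j f := by
  simp only [lapl_eq_sum, map_sum, partialDeriv_mulCoord, map_add]
  rw [Finset.sum_add_distrib, add_comm, Finset.sum_add_distrib, two_smul, ← add_assoc, add_comm]
  have h1 : ∀ g : Fin 3 → 𝓢(R3, ℝ), ∑ x : Fin 3, (if x = j then g x else 0) = g j := by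
    intro g; simp
  have h2 : ∀ x : Fin 3, partialDeriv ℝ x (if x = j then f else 0) =
      if x = j then partialDeriv ℝ x f else 0 := by
    intro x; split_ifs <;> simp
  simp only [h2, h1]
  abel

/-! ### The real `L²` pairing -/

/-- The real Hilbert space `L²(ℝ³, ℝ)`. -/
abbrev L2R : Type := Lp ℝ 2 (volume : Measure R3)

/-- A real Schwartz function as an element of `L²(ℝ³, ℝ)`. -/
def toL2 : 𝓢(R3, ℝ) →ₗ[ℝ] L2R := (SchwartzMap.toLpCLM ℝ ℝ 2 (volume : Measure R3)).toLinearMap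

theorem toL2_eq (f : 𝓢(R3, ℝ)) : toL2 f = f.toLp 2 (volume : Measure R3) := rfl

theorem coeFn_toL2 (f : 𝓢(R3, ℝ)) : toL2 f =ᵐ[volume] f := f.coeFn_toLp 2 volume

theorem toL2_injective : Function.Injective toL2 := fun _ _ h =>
  SchwartzMap.injective_toLp 2 volume h

theorem denseRange_toL2 : DenseRange toL2 :=
  SchwartzMap.denseRange_toLpCLM (F := ℝ) (E := R3) (μ := volume) (p := 2) ENNReal.ofNat_ne_top

theorem inner_toL2 (f g : 𝓢(R3, ℝ)) : inner ℝ (toL2 f) (toL2 g) = ∫ x, f x * g x := by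
  rw [L2.inner_def]
  refine integral_congr_ae ?_
  filter_upwards [coeFn_toL2 f, coeFn_toL2 g] with x hf hg
  simp [hf, hg, mul_comm]

theorem norm_toL2_sq (f : 𝓢(R3, ℝ)) : ‖toL2 f‖ ^ 2 = ∫ x, f x * f x := by
  rw [← inner_toL2, real_inner_self_eq_norm_sq]

theorem integrable_mul (f g : 𝓢(R3, ℝ)) : Integrable (fun x => f x * g x) :=
  (mulS f g).integrable

theorem inner_partialDeriv (j : Fin 3) (f g : 𝓢(R3, ℝ)) :
    inner ℝ (toL2 f) (toL2 (partialDeriv ℝ j g)) =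
      -inner ℝ (toL2 (partialDeriv ℝ j f)) (toL2 g) := by
  rw [inner_toL2, inner_toL2]
  exact SchwartzMap.integral_mul_lineDerivOp_right_eq_neg_left f g _

theorem inner_mulS (f g h : 𝓢(R3, ℝ)) :
    inner ℝ (toL2 f) (toL2 (mulS g h)) = inner ℝ (toL2 (mulS g f)) (toL2 h) := by
  rw [inner_toL2, inner_toL2]
  congr 1; ext x; simp; ring

theorem inner_lapl (f g : 𝓢(R3, ℝ)) :
    inner ℝ (toL2 f) (toL2 (lapl g)) = inner ℝ (toL2 (lapl f)) (toL2 g) := by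
  simp only [lapl_eq_sum, map_sum, inner_sum, sum_inner]
  refine Finset.sum_congr rfl fun i _ => ?_
  rw [inner_partialDeriv, inner_partialDeriv, neg_eq_iff_eq_neg]

/-- The `L²` norm of a product is controlled by the supremum of one factor. -/
theorem norm_toL2_mulS_le {f g : 𝓢(R3, ℝ)} {C : ℝ} (hC : ∀ x, |f x| ≤ C) :
    ‖toL2 (mulS f g)‖ ≤ C * ‖toL2 g‖ := by
  refine Lp.norm_le_mul_norm_of_ae_le_mul ?_
  filter_upwards [coeFn_toL2 (mulS f g), coeFn_toL2 g] with x h1 h2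
  rw [h1, h2, mulS_apply, norm_mul]
  exact mul_le_mul_of_nonneg_right (hC x) (norm_nonneg _)

/-! ### The scale of norms counting derivatives and weights -/

/-- The three coordinate multiplications and the three partial derivatives. -/
abbrev Gen : Type := Fin 3 ⊕ Fin 3

/-- The action of a generator; `none` acts as the identity. -/
def op : Option Gen → 𝓢(R3, ℝ) →ₗ[ℝ] 𝓢(R3, ℝ)
  | none => LinearMap.id
  | some (Sum.inl j) => (mulCoord j).toLinearMap
  | some (Sum.inr j) => (partialDeriv ℝ j).toLinearMap

/-- The action of a word of length `k`, first letter first. -/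
def wordOp : (k : ℕ) → (Fin k → Option Gen) → 𝓢(R3, ℝ) →ₗ[ℝ] 𝓢(R3, ℝ)
  | 0, _ => LinearMap.id
  | k + 1, w => wordOp k (Fin.tail w) ∘ₗ op (w 0)

/-- The family of all `w f ∈ L²` over words `w` of length `k`. -/
def emb (k : ℕ) : 𝓢(R3, ℝ) →ₗ[ℝ] ((Fin k → Option Gen) → L2R) :=
  LinearMap.pi fun w => toL2 ∘ₗ wordOp k w

/-- The norm `N k f` is the largest `L²` norm of a function obtained from `f` by at most `k`
coordinate multiplications and partial derivatives. -/
def N (k : ℕ) (f : 𝓢(R3, ℝ)) : ℝ := ‖emb k f‖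

theorem N_nonneg (k : ℕ) (f : 𝓢(R3, ℝ)) : 0 ≤ N k f := norm_nonneg _

theorem N_add_le (k : ℕ) (f g : 𝓢(R3, ℝ)) : N k (f + g) ≤ N k f + N k g := by
  rw [N, map_add]; exact norm_add_le _ _

theorem N_sub_le (k : ℕ) (f g : 𝓢(R3, ℝ)) : N k (f - g) ≤ N k f + N k g := by
  rw [N, map_sub]; exact norm_sub_le _ _

theorem N_smul (k : ℕ) (c : ℝ) (f : 𝓢(R3, ℝ)) : N k (c • f) = |c| * N k f := by
  rw [N, map_smul, norm_smul]; rfl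

theorem N_zero_right (k : ℕ) : N k 0 = 0 := by rw [N, map_zero, norm_zero]

theorem N_zero (f : 𝓢(R3, ℝ)) : N 0 f = ‖toL2 f‖ := by
  have : emb 0 f = fun _ => toL2 f := rfl
  rw [N, this, pi_norm_const]

theorem N_succ_le_iff {k : ℕ} {f : 𝓢(R3, ℝ)} {C : ℝ} :
    N (k + 1) f ≤ C ↔ ∀ g, N k (op g f) ≤ C := by
  have h0 : ∀ {k : ℕ} {f : 𝓢(R3, ℝ)}, N k f ≤ C ↔ ∀ w, ‖toL2 (wordOp k w f)‖ ≤ C :=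
    pi_norm_le_iff_of_nonempty _
  simp only [h0]
  rw [Fin.forall_fin_succ_pi]
  rfl

theorem N_op_le (k : ℕ) (g : Option Gen) (f : 𝓢(R3, ℝ)) : N k (op g f) ≤ N (k + 1) f :=
  N_succ_le_iff.1 le_rfl g

theorem N_le_succ (k : ℕ) (f : 𝓢(R3, ℝ)) : N k f ≤ N (k + 1) f := N_op_le k none f

theorem N_mono {k l : ℕ} (h : k ≤ l) (f : 𝓢(R3, ℝ)) : N k f ≤ N l f :=
  monotone_nat_of_le_succ (f := fun k => N k f) (fun k => N_le_succ k f) h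

theorem N_mulCoord_le (k : ℕ) (j : Fin 3) (f : 𝓢(R3, ℝ)) : N k (mulCoord j f) ≤ N (k + 1) f :=
  N_op_le k (some (Sum.inl j)) f

theorem N_partialDeriv_le (k : ℕ) (j : Fin 3) (f : 𝓢(R3, ℝ)) :
    N k (partialDeriv ℝ j f) ≤ N (k + 1) f :=
  N_op_le k (some (Sum.inr j)) f

theorem N_succ_le {k : ℕ} {f : 𝓢(R3, ℝ)} {C : ℝ} (h0 : N k f ≤ C)
    (h1 : ∀ j, N k (mulCoord j f) ≤ C) (h2 : ∀ j, N k (partialDeriv ℝ j f) ≤ C) :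
    N (k + 1) f ≤ C :=
  N_succ_le_iff.2 fun g => match g with
    | none => h0
    | some (Sum.inl j) => h1 j
    | some (Sum.inr j) => h2 j

theorem toL2_le_N (k : ℕ) (f : 𝓢(R3, ℝ)) : ‖toL2 f‖ ≤ N k f :=
  (N_zero f).symm.le.trans (N_mono (Nat.zero_le k) f)

/-! ### Passing between real and complex Schwartz functions -/

/-- A real Schwartz function seen as a complex one. -/
def ofRealS : 𝓢(R3, ℝ) →L[ℝ] 𝓢(R3, ℂ) := SchwartzMap.postcompCLM Complex.ofRealCLM

/-- The real part of a complex Schwartz function. -/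
def reS : 𝓢(R3, ℂ) →L[ℝ] 𝓢(R3, ℝ) := SchwartzMap.postcompCLM Complex.reCLM

/-- The imaginary part of a complex Schwartz function. -/
def imS : 𝓢(R3, ℂ) →L[ℝ] 𝓢(R3, ℝ) := SchwartzMap.postcompCLM Complex.imCLM

@[simp] theorem ofRealS_apply (f : 𝓢(R3, ℝ)) (x : R3) : ofRealS f x = (f x : ℂ) := rfl
@[simp] theorem reS_apply (f : 𝓢(R3, ℂ)) (x : R3) : reS f x = (f x).re := rfl
@[simp] theorem imS_apply (f : 𝓢(R3, ℂ)) (x : R3) : imS f x = (f x).im := rfl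

theorem reS_ofRealS (f : 𝓢(R3, ℝ)) : reS (ofRealS f) = f := by ext x; simp

theorem postcomp_partialDeriv {𝕜 𝕜' : Type} [RCLike 𝕜] [RCLike 𝕜'] (L : 𝕜 →L[ℝ] 𝕜') (j : Fin 3)
    (f : 𝓢(R3, 𝕜)) :
    partialDeriv 𝕜' j (SchwartzMap.postcompCLM L f) =
      SchwartzMap.postcompCLM L (partialDeriv 𝕜 j f) := by
  ext x
  have h : HasFDerivAt (SchwartzMap.postcompCLM L f) (L ∘L fderiv ℝ f x) x :=
    L.hasFDerivAt.comp x (f.hasFDerivAt x)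
  rw [partialDeriv_apply, h.fderiv]
  rfl

theorem postcomp_laplacian {𝕜 𝕜' : Type} [RCLike 𝕜] [RCLike 𝕜'] (L : 𝕜 →L[ℝ] 𝕜')
    (f : 𝓢(R3, 𝕜)) :
    Δ (SchwartzMap.postcompCLM L f) = SchwartzMap.postcompCLM L (Δ f) := by
  simp only [laplacian_eq_sum_partialDeriv, map_sum, postcomp_partialDeriv]

theorem laplacian_ofRealS (f : 𝓢(R3, ℝ)) : Δ (ofRealS f) = ofRealS (lapl f) := by
  rw [lapl_eq]; exact postcomp_laplacian _ f

theorem lapl_reS (f : 𝓢(R3, ℂ)) : lapl (reS f) = reS (Δ f) := by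
  rw [lapl_eq]; exact postcomp_laplacian _ f

theorem lapl_imS (f : 𝓢(R3, ℂ)) : lapl (imS f) = imS (Δ f) := by
  rw [lapl_eq]; exact postcomp_laplacian _ f

/-! ### The free resolvent -/

open FourierTransform

/-- The symbol `1 / (c + 4π²|ξ|²)` of `(c - Δ)⁻¹`. -/
def symb (c : ℝ) (ξ : R3) : ℝ := (c + (2 * Real.pi) ^ 2 * ‖ξ‖ ^ 2)⁻¹

theorem symb_pos {c : ℝ} (hc : 0 < c) (ξ : R3) : 0 < symb c ξ := by
  unfold symb; positivity

theorem hasTemperateGrowth_symb {c : ℝ} (hc : 0 < c) : (symb c).HasTemperateGrowth := by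
  have h1 : (fun x : R3 => (1 + ‖x‖ ^ 2) ^ (-1 : ℝ)).HasTemperateGrowth :=
    Function.hasTemperateGrowth_one_add_norm_sq_rpow R3 (-1)
  have h2 : (fun x : R3 => (2 * Real.pi / √c) • x).HasTemperateGrowth :=
    ((2 * Real.pi / √c) • ContinuousLinearMap.id ℝ R3).hasTemperateGrowth
  have h3 := (Function.HasTemperateGrowth.const (E := R3) c⁻¹).mul (h1.comp h2)
  refine (congrArg Function.HasTemperateGrowth (funext fun ξ => ?_)).mp h3
  have hs : √c ^ 2 = c := Real.sq_sqrt hc.le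
  simp only [Pi.mul_apply, symb, Function.comp_apply, norm_smul, Real.norm_eq_abs, mul_pow,
    sq_abs, div_pow, hs, Real.rpow_neg_one]
  rw [← mul_inv]
  congr 1
  field_simp

theorem fourier_laplacian (f : 𝓢(R3, ℂ)) (ξ : R3) :
    𝓕 (Δ f) ξ = -((2 * Real.pi) ^ 2 * ‖ξ‖ ^ 2 : ℝ) * 𝓕 f ξ := by
  rw [SchwartzMap.laplacian_eq_fourierMultiplierCLM, SchwartzMap.fourierMultiplierCLM_apply,
    FourierTransform.fourier_smul, FourierTransform.fourier_fourierInv_eq]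
  have h : (fun x : R3 => ‖x‖ ^ 2).HasTemperateGrowth :=
    Function.hasTemperateGrowth_norm_sq R3
  simp [SchwartzMap.smulLeftCLM_apply_apply h]
  ring

theorem fourier_sub_laplacian (c : ℝ) (f : 𝓢(R3, ℂ)) (ξ : R3) :
    𝓕 ((c : ℂ) • f - Δ f) ξ = ((c + (2 * Real.pi) ^ 2 * ‖ξ‖ ^ 2 : ℝ) : ℂ) * 𝓕 f ξ := by
  have h : 𝓕 ((c : ℂ) • f - Δ f) = (c : ℂ) • 𝓕 f - 𝓕 (Δ f) := by
    simp only [← FourierTransform.fourierCLM_apply (R := ℂ), map_sub, map_smul]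
  rw [h, sub_apply, fourier_laplacian]
  simp
  ring

theorem fourier_eq_symb_mul {c : ℝ} (hc : 0 < c) (f : 𝓢(R3, ℂ)) (ξ : R3) :
    𝓕 f ξ = (symb c ξ : ℂ) * 𝓕 ((c : ℂ) • f - Δ f) ξ := by
  rw [fourier_sub_laplacian, ← mul_assoc, ← Complex.ofReal_mul]
  have : (c + (2 * Real.pi) ^ 2 * ‖ξ‖ ^ 2) ≠ 0 := by positivity
  rw [symb, inv_mul_cancel₀ this]
  simp

/-- The resolvent `(c - Δ)⁻¹` on complex Schwartz functions. -/
def resC (c : ℝ) : 𝓢(R3, ℂ) →L[ℝ] 𝓢(R3, ℂ) := SchwartzMap.fourierMultiplierCLM ℂ (symb c)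

theorem sub_laplacian_resC {c : ℝ} (hc : 0 < c) (f : 𝓢(R3, ℂ)) :
    (c : ℂ) • resC c f - Δ (resC c f) = f := by
  have h : 𝓕 ((c : ℂ) • resC c f - Δ (resC c f)) = 𝓕 f := by
    ext ξ
    rw [fourier_sub_laplacian, resC, SchwartzMap.fourierMultiplierCLM_apply,
      FourierTransform.fourier_fourierInv_eq,
      SchwartzMap.smulLeftCLM_apply_apply (hasTemperateGrowth_symb hc)]
    have : (c + (2 * Real.pi) ^ 2 * ‖ξ‖ ^ 2) ≠ 0 := by positivity
    rw [Complex.real_smul, ← mul_assoc, ← Complex.ofReal_mul, symb, mul_inv_cancel₀ this]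
    simp
  have := congrArg (fun g => 𝓕⁻ g) h
  simpa [FourierTransform.fourierInv_fourier_eq] using this

/-- The resolvent `(c - Δ)⁻¹` on real Schwartz functions. -/
def res (c : ℝ) : 𝓢(R3, ℝ) →ₗ[ℝ] 𝓢(R3, ℝ) := (reS ∘L resC c ∘L ofRealS).toLinearMap

/-- The Helmholtz operator `c - Δ`. -/
def helm (c : ℝ) : 𝓢(R3, ℝ) →ₗ[ℝ] 𝓢(R3, ℝ) := c • LinearMap.id - lapl

theorem helm_apply (c : ℝ) (f : 𝓢(R3, ℝ)) : helm c f = c • f - lapl f := rfl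

theorem helm_res {c : ℝ} (hc : 0 < c) (f : 𝓢(R3, ℝ)) : helm c (res c f) = f := by
  have h := congrArg reS (sub_laplacian_resC hc (ofRealS f))
  rw [reS_ofRealS, map_sub, ← lapl_reS] at h
  rw [helm_apply]
  refine Eq.trans ?_ h
  have h1 : res c f = reS (resC c (ofRealS f)) := rfl
  rw [h1]
  congr 1
  ext x
  simp

theorem inner_helm_self (c : ℝ) (f : 𝓢(R3, ℝ)) :
    inner ℝ (toL2 f) (toL2 (helm c f)) =
      c * ‖toL2 f‖ ^ 2 + ∑ j : Fin 3, ‖toL2 (partialDeriv ℝ j f)‖ ^ 2 := by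
  rw [helm_apply, map_sub, map_smul, inner_sub_right, inner_smul_right, real_inner_self_eq_norm_sq,
    lapl_eq_sum, map_sum, inner_sum]
  simp only [inner_partialDeriv _ f, real_inner_self_eq_norm_sq, Finset.sum_neg_distrib]
  ring

theorem inner_helm (c : ℝ) (f g : 𝓢(R3, ℝ)) :
    inner ℝ (toL2 f) (toL2 (helm c g)) = inner ℝ (toL2 (helm c f)) (toL2 g) := by
  simp only [helm_apply, map_sub, map_smul, inner_sub_right, inner_sub_left, inner_smul_right,
    inner_smul_left, inner_lapl]
  simp

/-- The energy estimate for `c - Δ`. -/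
theorem norm_le_helm {c : ℝ} (hc : 0 < c) (f : 𝓢(R3, ℝ)) :
    ‖toL2 f‖ ≤ c⁻¹ * ‖toL2 (helm c f)‖ := by
  have h1 := inner_helm_self c f
  have h2 := real_inner_le_norm (toL2 f) (toL2 (helm c f))
  have h3 : 0 ≤ ∑ j : Fin 3, ‖toL2 (partialDeriv ℝ j f)‖ ^ 2 :=
    Finset.sum_nonneg fun _ _ => sq_nonneg _
  rcases (norm_nonneg (toL2 f)).eq_or_lt with h0 | h0
  · rw [← h0]; positivity
  · rw [le_inv_mul_iff₀ hc]
    nlinarith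

theorem norm_partialDeriv_le_helm {c : ℝ} (hc : 0 < c) (j : Fin 3) (f : 𝓢(R3, ℝ)) :
    ‖toL2 (partialDeriv ℝ j f)‖ ≤ √c⁻¹ * ‖toL2 (helm c f)‖ := by
  have h1 := inner_helm_self c f
  have h2 := real_inner_le_norm (toL2 f) (toL2 (helm c f))
  have h3 : ‖toL2 (partialDeriv ℝ j f)‖ ^ 2 ≤ ∑ j : Fin 3, ‖toL2 (partialDeriv ℝ j f)‖ ^ 2 :=
    Finset.single_le_sum (f := fun j => ‖toL2 (partialDeriv ℝ j f)‖ ^ 2)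
      (fun _ _ => sq_nonneg _) (Finset.mem_univ j)
  have h4 := norm_le_helm hc f
  have h5 : 0 ≤ c * ‖toL2 f‖ ^ 2 := by positivity
  refine abs_le_of_sq_le_sq' ?_ (by positivity) |>.2
  rw [mul_pow, Real.sq_sqrt (by positivity)]
  calc _ ≤ ‖toL2 f‖ * ‖toL2 (helm c f)‖ := by linarith
    _ ≤ c⁻¹ * ‖toL2 (helm c f)‖ * ‖toL2 (helm c f)‖ := by gcongr
    _ = _ := by ring

theorem helm_injective {c : ℝ} (hc : 0 < c) : Function.Injective (helm c) := by
  rw [← LinearMap.ker_eq_bot, LinearMap.ker_eq_bot']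
  intro f hf
  have h := norm_le_helm hc f
  rw [hf, map_zero, norm_zero, mul_zero, norm_le_zero_iff] at h
  exact toL2_injective (by rw [h, map_zero])

theorem res_helm {c : ℝ} (hc : 0 < c) (f : 𝓢(R3, ℝ)) : res c (helm c f) = f :=
  helm_injective hc (helm_res hc _)

theorem inner_res {c : ℝ} (hc : 0 < c) (f g : 𝓢(R3, ℝ)) :
    inner ℝ (toL2 f) (toL2 (res c g)) = inner ℝ (toL2 (res c f)) (toL2 g) := by
  conv_lhs => rw [← helm_res hc f]
  rw [← inner_helm, helm_res hc]

theorem res_partialDeriv {c : ℝ} (hc : 0 < c) (j : Fin 3) (f : 𝓢(R3, ℝ)) :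
    res c (partialDeriv ℝ j f) = partialDeriv ℝ j (res c f) := by
  apply helm_injective hc
  rw [helm_res hc]
  conv_lhs => rw [← helm_res hc f]
  simp only [helm_apply, map_sub, map_smul, lapl_partialDeriv]

theorem helm_mulCoord (c : ℝ) (j : Fin 3) (f : 𝓢(R3, ℝ)) :
    helm c (mulCoord j f) = mulCoord j (helm c f) - (2 : ℝ) • partialDeriv ℝ j f := by
  simp only [helm_apply, map_sub, map_smul, lapl_mulCoord]
  abel

/-- The commutator of a coordinate with the resolvent. -/
theorem mulCoord_res {c : ℝ} (hc : 0 < c) (j : Fin 3) (f : 𝓢(R3, ℝ)) :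
    mulCoord j (res c f) =
      res c (mulCoord j f) - (2 : ℝ) • res c (partialDeriv ℝ j (res c f)) := by
  apply helm_injective hc
  rw [map_sub, map_smul, helm_res hc, helm_res hc, helm_mulCoord, helm_res hc]

/-! ### Sobolev-type bounds -/

theorem symb_le {c : ℝ} (hc : 0 < c) (ξ : R3) :
    symb c ξ ≤ (c⁻¹ + 1) * (1 + ‖ξ‖ ^ 2)⁻¹ := by
  rw [symb, ← div_eq_mul_inv, inv_le_comm₀ (by positivity) (by positivity), inv_div,
    div_le_iff₀ (by positivity)]
  have h1 : (1 : ℝ) ≤ (2 * Real.pi) ^ 2 := by nlinarith [Real.pi_gt_three]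
  have h2 : ‖ξ‖ ^ 2 ≤ (2 * Real.pi) ^ 2 * ‖ξ‖ ^ 2 := le_mul_of_one_le_left (sq_nonneg _) h1
  have h3 : c * c⁻¹ = 1 := mul_inv_cancel₀ hc.ne'
  have h4 : 0 ≤ (2 * Real.pi) ^ 2 * ‖ξ‖ ^ 2 * c⁻¹ := by positivity
  nlinarith

/-- In dimension three `(1 + |ξ|²)^(1/8) / (c + 4π²|ξ|²)` is square integrable. -/
theorem memLp_weighted_symb {c : ℝ} (hc : 0 < c) :
    MemLp (fun ξ : R3 => (1 + ‖ξ‖ ^ 2) ^ (1 / 8 : ℝ) * symb c ξ) 2 volume := by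
  have hcont : Continuous (fun ξ : R3 => (1 + ‖ξ‖ ^ 2) ^ (1 / 8 : ℝ) * symb c ξ) := by
    unfold symb
    refine Continuous.mul (Continuous.rpow_const (by fun_prop) fun x => Or.inr (by norm_num)) ?_
    exact Continuous.inv₀ (by fun_prop) fun x => by positivity
  rw [memLp_two_iff_integrable_sq hcont.aestronglyMeasurable]
  have hint : Integrable (fun ξ : R3 => (c⁻¹ + 1) ^ 2 * (1 + ‖ξ‖ ^ 2) ^ (-(7 / 2 : ℝ) / 2)) :=
    (integrable_rpow_neg_one_add_norm_sq (by simp; norm_num)).const_mul _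
  refine hint.mono' (hcont.pow 2).aestronglyMeasurable (Filter.Eventually.of_forall fun ξ => ?_)
  have hpos : 0 < 1 + ‖ξ‖ ^ 2 := by positivity
  have h1 : ∀ B : ℝ, 0 < B → (B ^ (-(7 / 2 : ℝ) / 2) : ℝ) = (B ^ (1 / 8 : ℝ) * B⁻¹) ^ 2 := by
    intro B hB
    rw [← Real.rpow_neg_one B, ← Real.rpow_add hB, ← Real.rpow_natCast, ← Real.rpow_mul hB.le]
    norm_num
  have h2 := symb_le hc ξ
  have h3 := symb_pos hc ξ
  rw [Real.norm_eq_abs, abs_of_nonneg (by positivity), h1 _ hpos, ← mul_pow]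
  refine pow_le_pow_left₀ (by positivity) ?_ 2
  calc _ ≤ (1 + ‖ξ‖ ^ 2) ^ (1 / 8 : ℝ) * ((c⁻¹ + 1) * (1 + ‖ξ‖ ^ 2)⁻¹) := by gcongr
    _ = _ := by ring

theorem norm_toL2_sq' (f : 𝓢(R3, ℝ)) : ‖toL2 f‖ ^ 2 = ∫ x, ‖ofRealS f x‖ ^ 2 := by
  rw [norm_toL2_sq]
  congr 1; ext x; simp [sq]

/-- The weighted `L¹` norm of the Fourier transform, controlled by `(c - Δ) u` in `L²`. -/
theorem exists_weighted_fourier_bound {c : ℝ} (hc : 0 < c) :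
    ∃ C : ℝ, 0 ≤ C ∧ ∀ u : 𝓢(R3, ℝ),
      Integrable (fun ξ : R3 => (1 + ‖ξ‖ ^ 2) ^ (1 / 8 : ℝ) * ‖𝓕 (ofRealS u) ξ‖) ∧
      ∫ ξ : R3, (1 + ‖ξ‖ ^ 2) ^ (1 / 8 : ℝ) * ‖𝓕 (ofRealS u) ξ‖ ≤ C * ‖toL2 (helm c u)‖ := by
  refine ⟨(∫ ξ : R3, ‖(1 + ‖ξ‖ ^ 2) ^ (1 / 8 : ℝ) * symb c ξ‖ ^ (2 : ℝ)) ^ (1 / 2 : ℝ),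
    by positivity, fun u => ?_⟩
  set h : 𝓢(R3, ℂ) := 𝓕 (ofRealS (helm c u)) with hh
  have hu : (c : ℂ) • ofRealS u - Δ (ofRealS u) = ofRealS (helm c u) := by
    rw [laplacian_ofRealS, helm_apply, map_sub, map_smul]
    congr 1
  have hE : ∀ ξ : R3, (1 + ‖ξ‖ ^ 2) ^ (1 / 8 : ℝ) * ‖𝓕 (ofRealS u) ξ‖ =
      ((1 + ‖ξ‖ ^ 2) ^ (1 / 8 : ℝ) * symb c ξ) * ‖h ξ‖ := by
    intro ξ
    rw [fourier_eq_symb_mul hc (ofRealS u) ξ, hu, norm_mul, Complex.norm_real, Real.norm_eq_abs,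
      abs_of_pos (symb_pos hc ξ)]
    ring
  simp only [hE]
  have m1 := memLp_weighted_symb hc
  have m2 : MemLp (fun ξ => ‖h ξ‖) 2 volume := (h.memLp 2 volume).norm
  refine ⟨MemLp.integrable_mul m1 m2, ?_⟩
  have key := integral_mul_norm_le_Lp_mul_Lq (μ := (volume : Measure R3))
    (f := fun ξ : R3 => (1 + ‖ξ‖ ^ 2) ^ (1 / 8 : ℝ) * symb c ξ) (g := fun ξ => ‖h ξ‖)
    (p := 2) (q := 2) Real.HolderConjugate.two_two (by simpa using m1) (by simpa using m2)
  have h2 : (∫ ξ, ‖‖h ξ‖‖ ^ (2 : ℝ)) ^ (1 / 2 : ℝ) = ‖toL2 (helm c u)‖ := by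
    simp only [norm_norm, Real.rpow_two]
    rw [hh, SchwartzMap.integral_norm_sq_fourier, ← norm_toL2_sq', ← Real.sqrt_eq_rpow,
      Real.sqrt_sq (norm_nonneg _)]
  rw [h2] at key
  refine le_trans (le_of_eq ?_) key
  congr 1; ext ξ
  rw [Real.norm_eq_abs, abs_of_nonneg (by have := symb_pos hc ξ; positivity), norm_norm]

theorem apply_eq_integral_fourier (g : 𝓢(R3, ℂ)) (x : R3) :
    g x = ∫ ξ, Real.fourierChar (inner ℝ ξ x) • 𝓕 g ξ := by
  conv_lhs => rw [← FourierTransform.fourierInv_fourier_eq (F := 𝓢(R3, ℂ)) g]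
  rw [SchwartzMap.fourierInv_coe, Real.fourierInv_eq]

theorem one_le_weight (ξ : R3) : (1 : ℝ) ≤ (1 + ‖ξ‖ ^ 2) ^ (1 / 8 : ℝ) :=
  Real.one_le_rpow (by nlinarith [sq_nonneg ‖ξ‖]) (by norm_num)

theorem exists_sup_bound {c : ℝ} (hc : 0 < c) :
    ∃ C : ℝ, 0 ≤ C ∧ ∀ (u : 𝓢(R3, ℝ)) (x : R3), |u x| ≤ C * ‖toL2 (helm c u)‖ := by
  obtain ⟨C, hC, h⟩ := exists_weighted_fourier_bound hc
  refine ⟨C, hC, fun u x => le_trans ?_ (h u).2⟩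
  have : |u x| = ‖ofRealS u x‖ := by simp
  rw [this, apply_eq_integral_fourier]
  refine (norm_integral_le_integral_norm _).trans ?_
  refine integral_mono_of_nonneg (Filter.Eventually.of_forall fun _ => norm_nonneg _) (h u).1
    (Filter.Eventually.of_forall fun ξ => ?_)
  simp only [Circle.norm_smul]
  exact le_mul_of_one_le_left (norm_nonneg _) (one_le_weight ξ)

theorem norm_fourierChar_sub_le (a b : ℝ) :
    ‖(Real.fourierChar a : ℂ) - Real.fourierChar b‖ ≤
      2 * (2 * Real.pi * |a - b|) ^ (1 / 4 : ℝ) := by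
  have h1 : ‖(Real.fourierChar a : ℂ) - Real.fourierChar b‖ ≤ 2 * Real.pi * |a - b| := by
    have : (Real.fourierChar a : ℂ) - Real.fourierChar b =
        Real.fourierChar b * (Complex.exp (Complex.I * (2 * Real.pi * (a - b) : ℝ)) - 1) := by
      rw [Real.fourierChar_apply, Real.fourierChar_apply, mul_sub, ← Complex.exp_add]
      congr 2
      · push_cast; ring
      · simp
    rw [this, norm_mul, Circle.norm_coe, one_mul]
    refine (Real.norm_exp_I_mul_ofReal_sub_one_le).trans ?_
    rw [norm_mul, Real.norm_eq_abs, Real.norm_eq_abs, abs_of_pos (by positivity)]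
  have h2 : ‖(Real.fourierChar a : ℂ) - Real.fourierChar b‖ ≤ 2 := by
    refine (norm_sub_le _ _).trans ?_
    rw [Circle.norm_coe, Circle.norm_coe]; norm_num
  set t := 2 * Real.pi * |a - b|
  have ht : 0 ≤ t := by positivity
  rcases le_total t 1 with h | h
  · have : t ≤ t ^ (1 / 4 : ℝ) := by
      conv_lhs => rw [← Real.rpow_one t]
      exact Real.rpow_le_rpow_of_exponent_ge_of_imp ht h (by norm_num) (by norm_num)
    linarith [Real.rpow_nonneg ht (1 / 4)]
  · have := Real.one_le_rpow h (by norm_num : (0 : ℝ) ≤ 1 / 4)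
    linarith

/-- Functions with `(c - Δ) u ∈ L²` are Hölder continuous. -/
theorem exists_holder_bound {c : ℝ} (hc : 0 < c) :
    ∃ C : ℝ, 0 ≤ C ∧ ∀ (u : 𝓢(R3, ℝ)) (x y : R3),
      |u x - u y| ≤ C * ‖x - y‖ ^ (1 / 4 : ℝ) * ‖toL2 (helm c u)‖ := by
  obtain ⟨C, hC, h⟩ := exists_weighted_fourier_bound hc
  refine ⟨2 * (2 * Real.pi) ^ (1 / 4 : ℝ) * C, by positivity, fun u x y => ?_⟩
  have e1 : |u x - u y| = ‖ofRealS u x - ofRealS u y‖ := by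
    simp [← Complex.ofReal_sub]
  have hi : ∀ x : R3, Integrable (fun ξ => Real.fourierChar (inner ℝ ξ x) • 𝓕 (ofRealS u) ξ) := by
    intro x
    have := (Real.fourierIntegral_convergent_iff (μ := (volume : Measure R3))
      (f := ⇑(𝓕 (ofRealS u) : 𝓢(R3, ℂ))) (-x)).2 (SchwartzMap.integrable _)
    simpa using this
  rw [e1, apply_eq_integral_fourier, apply_eq_integral_fourier, ← integral_sub (hi x) (hi y)]
  refine (norm_integral_le_integral_norm _).trans ?_
  calc ∫ ξ, ‖Real.fourierChar (inner ℝ ξ x) • 𝓕 (ofRealS u) ξ -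
          Real.fourierChar (inner ℝ ξ y) • 𝓕 (ofRealS u) ξ‖
      ≤ ∫ ξ, 2 * (2 * Real.pi) ^ (1 / 4 : ℝ) * ‖x - y‖ ^ (1 / 4 : ℝ) *
          ((1 + ‖ξ‖ ^ 2) ^ (1 / 8 : ℝ) * ‖𝓕 (ofRealS u) ξ‖) := by
        refine integral_mono_of_nonneg (Filter.Eventually.of_forall fun _ => norm_nonneg _)
          ((h u).1.const_mul _) (Filter.Eventually.of_forall fun ξ => ?_)
        have h0 : Real.fourierChar (inner ℝ ξ x) • 𝓕 (ofRealS u) ξ -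
            Real.fourierChar (inner ℝ ξ y) • 𝓕 (ofRealS u) ξ =
            ((Real.fourierChar (inner ℝ ξ x) : ℂ) - Real.fourierChar (inner ℝ ξ y)) *
              𝓕 (ofRealS u) ξ := by
          simp only [Circle.smul_def, smul_eq_mul, sub_mul]
        simp only [h0, norm_mul]
        have h1 := norm_fourierChar_sub_le (inner ℝ ξ x) (inner ℝ ξ y)
        have h2 : |inner ℝ ξ x - inner ℝ ξ y| ≤ ‖ξ‖ * ‖x - y‖ := by
          rw [← inner_sub_right]; exact abs_real_inner_le_norm _ _
        have h3 : ‖ξ‖ ^ (1 / 4 : ℝ) ≤ (1 + ‖ξ‖ ^ 2) ^ (1 / 8 : ℝ) := by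
          have : ‖ξ‖ ^ (1 / 4 : ℝ) = (‖ξ‖ ^ 2) ^ (1 / 8 : ℝ) := by
            rw [← Real.rpow_natCast, ← Real.rpow_mul (norm_nonneg _)]; norm_num
          rw [this]
          gcongr; linarith
        rw [← mul_assoc]
        gcongr
        refine h1.trans ?_
        have h4 : (2 * Real.pi * |inner ℝ ξ x - inner ℝ ξ y|) ^ (1 / 4 : ℝ) ≤
            (2 * Real.pi) ^ (1 / 4 : ℝ) * (‖x - y‖ ^ (1 / 4 : ℝ) * ‖ξ‖ ^ (1 / 4 : ℝ)) := by
          rw [← Real.mul_rpow (norm_nonneg _) (norm_nonneg _),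
            ← Real.mul_rpow (by positivity) (by positivity)]
          refine Real.rpow_le_rpow (by positivity) ?_ (by norm_num)
          rw [mul_comm ‖x - y‖]
          exact mul_le_mul_of_nonneg_left h2 (by positivity)
        calc 2 * (2 * Real.pi * |inner ℝ ξ x - inner ℝ ξ y|) ^ (1 / 4 : ℝ)
            ≤ 2 * ((2 * Real.pi) ^ (1 / 4 : ℝ) *
              (‖x - y‖ ^ (1 / 4 : ℝ) * ‖ξ‖ ^ (1 / 4 : ℝ))) := by gcongr
          _ ≤ 2 * ((2 * Real.pi) ^ (1 / 4 : ℝ) *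
              (‖x - y‖ ^ (1 / 4 : ℝ) * (1 + ‖ξ‖ ^ 2) ^ (1 / 8 : ℝ))) := by gcongr
          _ = _ := by ring
    _ ≤ _ := by
        rw [integral_const_mul]
        have := (h u).2
        calc _ ≤ 2 * (2 * Real.pi) ^ (1 / 4 : ℝ) * ‖x - y‖ ^ (1 / 4 : ℝ) *
              (C * ‖toL2 (helm c u)‖) := by gcongr
          _ = _ := by ring

theorem norm_lapl_le (f : 𝓢(R3, ℝ)) : ‖toL2 (lapl f)‖ ≤ 3 * N 2 f := by
  rw [lapl_eq_sum, map_sum]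
  refine (norm_sum_le _ _).trans ?_
  refine (Finset.sum_le_card_nsmul _ _ (N 2 f) fun i _ => ?_).trans (by simp)
  rw [← N_zero]
  exact (N_partialDeriv_le 0 i _).trans (N_partialDeriv_le 1 i f)

/-- The supremum of a Schwartz function is controlled by the norm of order two. -/
theorem exists_sup_le_N : ∃ C : ℝ, 0 < C ∧ ∀ (u : 𝓢(R3, ℝ)) (x : R3), |u x| ≤ C * N 2 u := by
  obtain ⟨C, hC, h⟩ := exists_sup_bound one_pos
  refine ⟨C * 4 + 1, by positivity, fun u x => (h u x).trans ?_⟩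
  have h1 : ‖toL2 (helm 1 u)‖ ≤ 4 * N 2 u := by
    rw [helm_apply, map_sub, one_smul]
    linarith [norm_sub_le (toL2 u) (toL2 (lapl u)), norm_lapl_le u, toL2_le_N 2 u]
  nlinarith [N_nonneg 2 u]

/-! ### The resolvent in the scale of norms -/

theorem N_mulCoord_res_le {c : ℝ} (hc : 0 < c) {k : ℕ} {C : ℝ} (hC : 0 ≤ C)
    (h1 : ∀ f, N k (res c f) ≤ C * N k f)
    (h2 : ∀ (j : Fin 3) (f), N k (partialDeriv ℝ j (res c f)) ≤ C * N k f)
    (j : Fin 3) (f : 𝓢(R3, ℝ)) :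
    N k (mulCoord j (res c f)) ≤ C * N k (mulCoord j f) + 2 * (C * (C * N k f)) := by
  rw [mulCoord_res hc]
  refine (N_sub_le _ _ _).trans (add_le_add (h1 _) ?_)
  rw [N_smul, abs_two]
  gcongr
  exact (h1 _).trans (by gcongr; exact h2 j f)

/-- The resolvent and its first derivatives preserve every norm of the scale. -/
theorem exists_res_bound {c : ℝ} (hc : 0 < c) (k : ℕ) :
    ∃ C : ℝ, 0 ≤ C ∧ (∀ f, N k (res c f) ≤ C * N k f) ∧
      ∀ (j : Fin 3) (f), N k (partialDeriv ℝ j (res c f)) ≤ C * N k f := by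
  induction k with
  | zero =>
    refine ⟨max c⁻¹ √c⁻¹, by positivity, fun f => ?_, fun j f => ?_⟩
    · have := norm_le_helm hc (res c f)
      rw [helm_res hc] at this
      rw [N_zero, N_zero]
      exact this.trans (by gcongr; exact le_max_left _ _)
    · have := norm_partialDeriv_le_helm hc j (res c f)
      rw [helm_res hc] at this
      rw [N_zero, N_zero]
      exact this.trans (by gcongr; exact le_max_right _ _)
  | succ k ih =>
    obtain ⟨C, hC, h1, h2⟩ := ih
    have hx := N_mulCoord_res_le hc hC h1 h2
    have hN : ∀ f, N k f ≤ N (k + 1) f := N_le_succ k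
    have hNX : ∀ j f, N k (mulCoord j f) ≤ N (k + 1) f := N_mulCoord_le k
    have hND : ∀ j f, N k (partialDeriv ℝ j f) ≤ N (k + 1) f := N_partialDeriv_le k
    have hCC : 0 ≤ C * C := by positivity
    refine ⟨2 * C + 2 * (C * C), by positivity, fun f => ?_, fun j f => ?_⟩
    · have hp := N_nonneg (k + 1) f
      refine N_succ_le ?_ (fun j => ?_) (fun j => ?_)
      · calc _ ≤ C * N (k + 1) f := (h1 f).trans (by gcongr; exact hN f)
          _ ≤ _ := by gcongr; linarith
      · calc _ ≤ C * N (k + 1) f + 2 * (C * (C * N (k + 1) f)) :=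
              (hx j f).trans (by gcongr; exacts [hNX j f, hN f])
          _ ≤ _ := by nlinarith
      · calc _ ≤ C * N (k + 1) f := (h2 j f).trans (by gcongr; exact hN f)
          _ ≤ _ := by gcongr; linarith
    · have hp := N_nonneg (k + 1) f
      refine N_succ_le ?_ (fun i => ?_) (fun i => ?_)
      · calc _ ≤ C * N (k + 1) f := (h2 j f).trans (by gcongr; exact hN f)
          _ ≤ _ := by gcongr; linarith
      · have e : mulCoord i (partialDeriv ℝ j (res c f)) =
            partialDeriv ℝ j (res c (mulCoord i f)) -
            (2 : ℝ) • partialDeriv ℝ j (res c (partialDeriv ℝ i (res c f))) -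
            (if j = i then res c f else 0) := by
          have := partialDeriv_mulCoord j i (res c f)
          rw [mulCoord_res hc, map_sub, map_smul] at this
          rw [this]; abel
        rw [e]
        have e1 : N k (if j = i then res c f else 0) ≤ C * N (k + 1) f := by
          split_ifs
          · exact (h1 f).trans (by gcongr; exact hN f)
          · rw [N_zero_right]; positivity
        have e2 : N k ((2 : ℝ) • partialDeriv ℝ j (res c (partialDeriv ℝ i (res c f)))) ≤
            2 * (C * (C * N (k + 1) f)) := by
          rw [N_smul, abs_two]
          gcongr
          refine (h2 j _).trans ?_
          gcongr
          exact (h2 i f).trans (by gcongr; exact hN f)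
        have e3 : N k (partialDeriv ℝ j (res c (mulCoord i f))) ≤ C * N (k + 1) f :=
          (h2 j _).trans (by gcongr; exact hNX i f)
        refine (N_sub_le _ _ _).trans ?_
        have := N_sub_le k (partialDeriv ℝ j (res c (mulCoord i f)))
          ((2 : ℝ) • partialDeriv ℝ j (res c (partialDeriv ℝ i (res c f))))
        nlinarith
      · rw [partialDeriv_comm, ← res_partialDeriv hc]
        calc _ ≤ C * N (k + 1) f := (h2 j _).trans (by gcongr; exact hND i f)
          _ ≤ _ := by gcongr; linarith

/-- The resolvent gains one order in the scale once `f` and all `x_j f` are controlled: it gains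
derivatives but no decay. -/
theorem exists_res_gain {c : ℝ} (hc : 0 < c) (k : ℕ) :
    ∃ C : ℝ, 0 ≤ C ∧ ∀ (f : 𝓢(R3, ℝ)) (M : ℝ), N k f ≤ M → (∀ j, N k (mulCoord j f) ≤ M) →
      N (k + 1) (res c f) ≤ C * M := by
  obtain ⟨C, hC, h1, h2⟩ := exists_res_bound hc k
  have hx := N_mulCoord_res_le hc hC h1 h2
  have hCC : 0 ≤ C * C := by positivity
  refine ⟨C + 2 * (C * C), by positivity, fun f M hM hMj => ?_⟩
  have hM0 : 0 ≤ M := (N_nonneg _ _).trans hM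
  refine N_succ_le ?_ (fun j => ?_) (fun j => ?_)
  · calc _ ≤ C * M := (h1 f).trans (by gcongr)
      _ ≤ _ := by gcongr; linarith
  · calc _ ≤ C * M + 2 * (C * (C * M)) := (hx j f).trans (by gcongr; exact hMj j)
      _ ≤ _ := by nlinarith
  · calc _ ≤ C * M := (h2 j f).trans (by gcongr)
      _ ≤ _ := by gcongr; linarith

/-! ### Products in the scale of norms -/

theorem exists_norm_mulS_le {a b : ℕ} (h : 2 ≤ a ∨ 2 ≤ b) :
    ∃ C : ℝ, 0 ≤ C ∧ ∀ f g, ‖toL2 (mulS f g)‖ ≤ C * (N a f * N b g) := by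
  obtain ⟨C, hC, hs⟩ := exists_sup_le_N
  refine ⟨C, hC.le, fun f g => ?_⟩
  have := N_nonneg a f
  have := N_nonneg b g
  rcases h with h | h
  · calc _ ≤ (C * N 2 f) * ‖toL2 g‖ := norm_toL2_mulS_le (hs f)
      _ ≤ (C * N a f) * N b g := by
        gcongr
        exacts [N_mono h f, toL2_le_N b g]
      _ = _ := by ring
  · rw [mulS_comm]
    calc _ ≤ (C * N 2 g) * ‖toL2 f‖ := norm_toL2_mulS_le (hs g)
      _ ≤ (C * N b g) * N a f := by
        gcongr
        exacts [N_mono h g, toL2_le_N a f]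
      _ = _ := by ring

/-- Product estimate: the `n` letters may be distributed over the two factors, and the factor
receiving fewer of them is estimated in the supremum norm at the expense of two derivatives. -/
theorem exists_N_mulS_le (n a b : ℕ) (ha : n ≤ a) (hb : n ≤ b) (hab : n + 3 ≤ a + b) :
    ∃ C : ℝ, 0 ≤ C ∧ ∀ f g, N n (mulS f g) ≤ C * (N a f * N b g) := by
  induction n generalizing a b with
  | zero =>
    simp only [N_zero]
    exact exists_norm_mulS_le (by omega)
  | succ n ih =>
    obtain ⟨a, rfl⟩ := Nat.exists_eq_add_of_lt (Nat.lt_of_lt_of_le (Nat.succ_pos n) ha)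
    obtain ⟨b, rfl⟩ := Nat.exists_eq_add_of_lt (Nat.lt_of_lt_of_le (Nat.succ_pos n) hb)
    simp only [zero_add] at *
    obtain ⟨C0, hC0, h0⟩ := ih (a + 1) (b + 1) (by omega) (by omega) (by omega)
    obtain ⟨C1, hC1, h1⟩ := ih a (b + 1) (by omega) (by omega) (by omega)
    obtain ⟨C2, hC2, h2⟩ := ih (a + 1) b (by omega) (by omega) (by omega)
    refine ⟨C0 + C1 + C2, by positivity, fun f g => ?_⟩
    have p1 := N_nonneg (a + 1) f
    have p2 := N_nonneg (b + 1) g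
    have p3 := mul_nonneg p1 p2
    have e1 : ∀ f', N a f' ≤ N (a + 1) f → N n (mulS f' g) ≤ C1 * (N (a + 1) f * N (b + 1) g) :=
      fun f' hf' => (h1 f' g).trans (by gcongr)
    have e2 : ∀ g', N b g' ≤ N (b + 1) g → N n (mulS f g') ≤ C2 * (N (a + 1) f * N (b + 1) g) :=
      fun g' hg' => (h2 f g').trans (by gcongr)
    refine N_succ_le ?_ (fun j => ?_) (fun j => ?_)
    · exact (h0 f g).trans (by gcongr; linarith)
    · rw [← mulS_mulCoord]
      exact (e1 _ (N_mulCoord_le a j f)).trans (by gcongr; linarith)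
    · rw [partialDeriv_mulS]
      refine (N_add_le _ _ _).trans ?_
      have := e1 _ (N_partialDeriv_le a j f)
      have := e2 _ (N_partialDeriv_le b j g)
      nlinarith

/-- Product estimate with an additional weight, which is absorbed by either factor. -/
theorem exists_N_mulCoord_mulS_le (l : Fin 3) (n a b : ℕ) (ha : n ≤ a) (hb : n ≤ b)
    (hab : n + 4 ≤ a + b) :
    ∃ C : ℝ, 0 ≤ C ∧ ∀ f g, N n (mulCoord l (mulS f g)) ≤ C * (N a f * N b g) := by
  induction n generalizing a b with
  | zero =>
    simp only [N_zero]
    have hcase : (1 ≤ a ∧ (2 ≤ a - 1 ∨ 2 ≤ b)) ∨ (1 ≤ b ∧ (2 ≤ a ∨ 2 ≤ b - 1)) := by omega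
    rcases hcase with ⟨h1, h2⟩ | ⟨h1, h2⟩
    · obtain ⟨C, hC, h⟩ := exists_norm_mulS_le h2
      refine ⟨C, hC, fun f g => ?_⟩
      rw [← mulS_mulCoord]
      refine (h _ g).trans ?_
      have := N_nonneg b g
      gcongr
      obtain ⟨a, rfl⟩ := Nat.exists_eq_add_of_le' h1
      exact N_mulCoord_le a l f
    · obtain ⟨C, hC, h⟩ := exists_norm_mulS_le h2
      refine ⟨C, hC, fun f g => ?_⟩
      rw [← mulS_mulCoord_right]
      refine (h f _).trans ?_
      have := N_nonneg a f
      gcongr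
      obtain ⟨b, rfl⟩ := Nat.exists_eq_add_of_le' h1
      exact N_mulCoord_le b l g
  | succ n ih =>
    obtain ⟨a, rfl⟩ := Nat.exists_eq_add_of_lt (Nat.lt_of_lt_of_le (Nat.succ_pos n) ha)
    obtain ⟨b, rfl⟩ := Nat.exists_eq_add_of_lt (Nat.lt_of_lt_of_le (Nat.succ_pos n) hb)
    simp only [zero_add] at *
    obtain ⟨C0, hC0, h0⟩ := ih (a + 1) (b + 1) (by omega) (by omega) (by omega)
    obtain ⟨C1, hC1, h1⟩ := ih a (b + 1) (by omega) (by omega) (by omega)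
    obtain ⟨C2, hC2, h2⟩ := ih (a + 1) b (by omega) (by omega) (by omega)
    obtain ⟨C3, hC3, h3⟩ := exists_N_mulS_le n (a + 1) (b + 1) (by omega) (by omega) (by omega)
    refine ⟨C0 + C1 + C2 + C3, by positivity, fun f g => ?_⟩
    have p1 := N_nonneg (a + 1) f
    have p2 := N_nonneg (b + 1) g
    have p3 := mul_nonneg p1 p2
    have e1 : ∀ f', N a f' ≤ N (a + 1) f →
        N n (mulCoord l (mulS f' g)) ≤ C1 * (N (a + 1) f * N (b + 1) g) :=
      fun f' hf' => (h1 f' g).trans (by gcongr)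
    have e2 : ∀ g', N b g' ≤ N (b + 1) g →
        N n (mulCoord l (mulS f g')) ≤ C2 * (N (a + 1) f * N (b + 1) g) :=
      fun g' hg' => (h2 f g').trans (by gcongr)
    refine N_succ_le ?_ (fun j => ?_) (fun j => ?_)
    · exact (h0 f g).trans (by gcongr; linarith)
    · rw [mulCoord_comm, ← mulS_mulCoord]
      exact (e1 _ (N_mulCoord_le a j f)).trans (by gcongr; linarith)
    · rw [partialDeriv_mulCoord, partialDeriv_mulS, map_add]
      have q1 := e1 _ (N_partialDeriv_le a j f)
      have q2 := e2 _ (N_partialDeriv_le b j g)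
      have q3 : N n (if j = l then mulS f g else 0) ≤ C3 * (N (a + 1) f * N (b + 1) g) := by
        split_ifs
        · exact h3 f g
        · rw [N_zero_right]; positivity
      have q4 := N_add_le n (if j = l then mulS f g else 0)
        (mulCoord l (mulS (partialDeriv ℝ j f) g) + mulCoord l (mulS f (partialDeriv ℝ j g)))
      have q5 := N_add_le n (mulCoord l (mulS (partialDeriv ℝ j f) g))
        (mulCoord l (mulS f (partialDeriv ℝ j g)))
      nlinarith

/-- Multiplication by a fixed Schwartz function preserves every norm of the scale. -/
theorem exists_N_mulS_left_le (v : 𝓢(R3, ℝ)) (k : ℕ) :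
    ∃ C : ℝ, 0 ≤ C ∧ ∀ f, N k (mulS v f) ≤ C * N k f := by
  obtain ⟨C, hC, h⟩ := exists_N_mulS_le k (k + 3) k (by omega) le_rfl (by omega)
  refine ⟨C * N (k + 3) v, mul_nonneg hC (N_nonneg _ _), fun f => (h v f).trans (by rw [mul_assoc])⟩

/-- Multiplication by a Schwartz function followed by the resolvent gains one order. -/
theorem exists_N_res_mulS_left_le {c : ℝ} (hc : 0 < c) (v : 𝓢(R3, ℝ)) (k : ℕ) :
    ∃ C : ℝ, 0 ≤ C ∧ ∀ f, N (k + 1) (res c (mulS v f)) ≤ C * N k f := by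
  obtain ⟨C, hC, h⟩ := exists_res_gain hc k
  obtain ⟨C0, hC0, h0⟩ := exists_N_mulS_left_le v k
  choose C1 hC1 h1 using fun j => exists_N_mulS_left_le (mulCoord j v) k
  have hs := Finset.sum_nonneg fun j (_ : j ∈ Finset.univ) => hC1 j
  refine ⟨C * (C0 + ∑ j, C1 j), by positivity, fun f => ?_⟩
  rw [mul_assoc]
  have hp := N_nonneg k f
  refine h _ _ ((h0 f).trans (by gcongr; linarith)) fun j => ?_
  rw [← mulS_mulCoord]
  refine (h1 j f).trans ?_
  gcongr
  have := Finset.single_le_sum (f := C1) (fun j _ => hC1 j) (Finset.mem_univ j)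
  linarith

/-- The resolvent of a product gains one order: for `k ≥ 4` the product of two functions also
decays better by one weight, which the resolvent does not provide. -/
theorem exists_N_res_mulS_le {c : ℝ} (hc : 0 < c) {k : ℕ} (hk : 4 ≤ k) :
    ∃ C : ℝ, 0 ≤ C ∧ ∀ f g, N (k + 1) (res c (mulS f g)) ≤ C * (N k f * N k g) := by
  obtain ⟨C, hC, h⟩ := exists_res_gain hc k
  obtain ⟨C0, hC0, h0⟩ := exists_N_mulS_le k k k le_rfl le_rfl (by omega)
  choose C1 hC1 h1 using fun j => exists_N_mulCoord_mulS_le j k k k le_rfl le_rfl (by omega)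
  have hs := Finset.sum_nonneg fun j (_ : j ∈ Finset.univ) => hC1 j
  refine ⟨C * (C0 + ∑ j, C1 j), by positivity, fun f g => ?_⟩
  rw [mul_assoc]
  have hp := mul_nonneg (N_nonneg k f) (N_nonneg k g)
  refine h _ _ ((h0 f g).trans (by gcongr; linarith)) fun j => ?_
  refine (h1 j f g).trans ?_
  gcongr
  have := Finset.single_le_sum (f := C1) (fun j _ => hC1 j) (Finset.mem_univ j)
  linarith

/-! ### Schwartz seminorms and completeness -/

theorem norm_le_sum_abs_coord (x : R3) : ‖x‖ ≤ ∑ j : Fin 3, |x j| := by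
  have h : x = ∑ j : Fin 3, x j • EuclideanSpace.single j (1 : ℝ) := by
    ext i; simp [Finset.sum_apply, Pi.single_apply]
  conv_lhs => rw [h]
  refine (norm_sum_le _ _).trans (Finset.sum_le_sum fun j _ => ?_)
  rw [norm_smul]; simp

theorem exists_pow_mul_sup_le (k : ℕ) :
    ∃ C : ℝ, 0 ≤ C ∧ ∀ (f : 𝓢(R3, ℝ)) (x : R3), ‖x‖ ^ k * |f x| ≤ C * N (k + 2) f := by
  induction k with
  | zero =>
    obtain ⟨C, hC, h⟩ := exists_sup_le_N
    exact ⟨C, hC.le, fun f x => by simpa using h f x⟩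
  | succ k ih =>
    obtain ⟨C, hC, h⟩ := ih
    refine ⟨3 * C, by positivity, fun f x => ?_⟩
    calc ‖x‖ ^ (k + 1) * |f x| = ‖x‖ ^ k * |f x| * ‖x‖ := by ring
      _ ≤ ‖x‖ ^ k * |f x| * ∑ j : Fin 3, |x j| := by gcongr; exact norm_le_sum_abs_coord x
      _ = ∑ j : Fin 3, ‖x‖ ^ k * |mulCoord j f x| := by
        rw [Finset.mul_sum]
        refine Finset.sum_congr rfl fun j _ => ?_
        rw [mulCoord_apply, abs_mul]; ring
      _ ≤ ∑ j : Fin 3, C * N (k + 2 + 1) f := by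
        refine Finset.sum_le_sum fun j _ => (h _ x).trans ?_
        gcongr
        exact N_mulCoord_le _ j f
      _ = _ := by simp; ring_nf

theorem fderiv_eq_sum_partialDeriv (f : 𝓢(R3, ℝ)) :
    fderiv ℝ f = fun x => ∑ j : Fin 3,
      (ContinuousLinearMap.toSpanSingleton ℝ (EuclideanSpace.proj j : R3 →L[ℝ] ℝ))
        (partialDeriv ℝ j f x) := by
  ext x v
  have h : v = ∑ j : Fin 3, v j • EuclideanSpace.single j (1 : ℝ) := by
    ext i; simp [Finset.sum_apply, Pi.single_apply]
  conv_lhs => rw [h]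
  simp [partialDeriv_apply, mul_comm]

theorem exists_pow_mul_iteratedFDeriv_le (k n : ℕ) :
    ∃ C : ℝ, 0 ≤ C ∧ ∀ (f : 𝓢(R3, ℝ)) (x : R3),
      ‖x‖ ^ k * ‖iteratedFDeriv ℝ n f x‖ ≤ C * N (k + 2 + n) f := by
  induction n with
  | zero =>
    obtain ⟨C, hC, h⟩ := exists_pow_mul_sup_le k
    exact ⟨C, hC, fun f x => by simpa using h f x⟩
  | succ n ih =>
    obtain ⟨C, hC, h⟩ := ih
    set L : Fin 3 → ℝ →L[ℝ] R3 →L[ℝ] ℝ := fun j =>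
      ContinuousLinearMap.toSpanSingleton ℝ (EuclideanSpace.proj j : R3 →L[ℝ] ℝ) with hL
    refine ⟨∑ j, ‖L j‖ * C, by positivity, fun f x => ?_⟩
    have hs : ∀ j, ContDiff ℝ n (fun x => L j (partialDeriv ℝ j f x)) := fun j =>
      (L j).contDiff.comp ((partialDeriv ℝ j f).smooth n)
    rw [← norm_iteratedFDeriv_fderiv, fderiv_eq_sum_partialDeriv,
      iteratedFDeriv_fun_sum_apply fun j _ => (hs j).contDiffAt, Finset.sum_mul]
    calc _ ≤ ‖x‖ ^ k * ∑ j, ‖L j‖ * ‖iteratedFDeriv ℝ n (partialDeriv ℝ j f) x‖ := by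
          gcongr
          refine norm_sum_le_of_le _ fun j _ => ?_
          exact (L j).norm_iteratedFDeriv_comp_left
            ((partialDeriv ℝ j f).smooth n).contDiffAt le_rfl
      _ = ∑ j, ‖L j‖ * (‖x‖ ^ k * ‖iteratedFDeriv ℝ n (partialDeriv ℝ j f) x‖) := by
          rw [Finset.mul_sum]; congr 1; ext j; ring
      _ ≤ ∑ j, ‖L j‖ * C * N (k + 2 + n + 1) f := by
          refine Finset.sum_le_sum fun j _ => ?_
          rw [mul_assoc]
          refine mul_le_mul_of_nonneg_left ((h _ x).trans ?_) (by positivity)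
          exact mul_le_mul_of_nonneg_left (N_partialDeriv_le _ j f) hC

theorem exists_seminorm_le_N (k n : ℕ) :
    ∃ C : ℝ, 0 ≤ C ∧ ∀ f : 𝓢(R3, ℝ), SchwartzMap.seminorm ℝ k n f ≤ C * N (k + 2 + n) f := by
  obtain ⟨C, hC, h⟩ := exists_pow_mul_iteratedFDeriv_le k n
  exact ⟨C, hC, fun f => SchwartzMap.seminorm_le_bound ℝ k n f
    (mul_nonneg hC (N_nonneg _ _)) (h f)⟩

/-- A series of Schwartz functions converging absolutely in every seminorm has a Schwartz sum. -/
theorem exists_tsum_schwartz (g : ℕ → 𝓢(R3, ℝ))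
    (hg : ∀ k n, Summable fun i => SchwartzMap.seminorm ℝ k n (g i)) :
    ∃ f : 𝓢(R3, ℝ), (∀ x, f x = ∑' i, g i x) ∧
      ∀ k n, SchwartzMap.seminorm ℝ k n f ≤ ∑' i, SchwartzMap.seminorm ℝ k n (g i) := by
  have hb : ∀ (n i : ℕ) (x : R3), (n : ℕ∞) ≤ ⊤ →
      ‖iteratedFDeriv ℝ n (g i) x‖ ≤ SchwartzMap.seminorm ℝ 0 n (g i) :=
    fun n i x _ => SchwartzMap.norm_iteratedFDeriv_le_seminorm ℝ (g i) n x
  have hdecay : ∀ (k n : ℕ) (x : R3), ‖x‖ ^ k * ‖iteratedFDeriv ℝ n (fun y => ∑' i, g i y) x‖ ≤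
      ∑' i, SchwartzMap.seminorm ℝ k n (g i) := by
    intro k n x
    rw [iteratedFDeriv_tsum_apply (N := ⊤) (fun i => (g i).smooth ⊤) (fun n _ => hg 0 n) hb le_top]
    have hsn : Summable fun i => ‖iteratedFDeriv ℝ n (g i) x‖ :=
      Summable.of_nonneg_of_le (fun _ => norm_nonneg _) (fun i => hb n i x le_top) (hg 0 n)
    calc _ ≤ ‖x‖ ^ k * ∑' i, ‖iteratedFDeriv ℝ n (g i) x‖ := by
          exact mul_le_mul_of_nonneg_left (norm_tsum_le_tsum_norm hsn) (by positivity)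
      _ = ∑' i, ‖x‖ ^ k * ‖iteratedFDeriv ℝ n (g i) x‖ := tsum_mul_left.symm
      _ ≤ _ := Summable.tsum_le_tsum (fun i => SchwartzMap.le_seminorm ℝ k n (g i) x)
          (hsn.mul_left _) (hg k n)
  refine ⟨⟨fun y => ∑' i, g i y, ?_, fun k n => ⟨_, hdecay k n⟩⟩, fun x => rfl, fun k n => ?_⟩
  · exact contDiff_tsum (N := ⊤) (fun i => (g i).smooth ⊤) (fun n _ => hg 0 n) hb
  · exact SchwartzMap.seminorm_le_bound ℝ k n _ (tsum_nonneg fun i => apply_nonneg _ _)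
      (hdecay k n)

/-! ### The Banach spaces attached to the scale of norms -/

/-- The closure of the real Schwartz space in the ambient space of the norm `N k`. -/
def XSub (k : ℕ) : Submodule ℝ ((Fin k → Option Gen) → L2R) :=
  (LinearMap.range (emb k)).topologicalClosure

/-- The completion `X k` of the real Schwartz space for the norm `N k`, realized as the closure of
its image in a complete space. -/
def X (k : ℕ) : Type := XSub k

instance (k : ℕ) : NormedAddCommGroup (X k) := inferInstanceAs (NormedAddCommGroup (XSub k))

instance (k : ℕ) : NormedSpace ℝ (X k) := inferInstanceAs (NormedSpace ℝ (XSub k))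

instance (k : ℕ) : CompleteSpace (X k) :=
  (Submodule.isClosed_topologicalClosure (LinearMap.range (emb k))).completeSpace_coe

/-- A Schwartz function as an element of `X k`. -/
def ι (k : ℕ) : 𝓢(R3, ℝ) →ₗ[ℝ] X k :=
  (emb k).codRestrict (XSub k) fun f =>
    Submodule.le_topologicalClosure _ (LinearMap.mem_range_self _ f)

theorem norm_ι (k : ℕ) (f : 𝓢(R3, ℝ)) : ‖ι k f‖ = N k f := rfl

theorem ι_injective (k : ℕ) : Function.Injective (ι k) := by
  intro f g h
  rw [← sub_eq_zero] at h ⊢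
  rw [← map_sub] at h
  have h1 : N k (f - g) = 0 := by rw [← norm_ι, h, norm_zero]
  have h2 := toL2_le_N k (f - g)
  rw [h1, norm_le_zero_iff] at h2
  exact toL2_injective (by rw [h2, map_zero])

theorem denseRange_ι (k : ℕ) : DenseRange (ι k) := by
  have h : ∀ x : XSub k, x ∈ closure (Set.range ((emb k).codRestrict (XSub k) fun f =>
      Submodule.le_topologicalClosure _ (LinearMap.mem_range_self _ f))) := by
    intro x
    rw [closure_subtype, ← Set.range_comp]
    exact x.2
  exact h

theorem ext_of_ι {k : ℕ} {Y : Type*} [TopologicalSpace Y] [T2Space Y] {S T : X k → Y}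
    (hS : Continuous S) (hT : Continuous T) (h : ∀ f, S (ι k f) = T (ι k f)) (u : X k) :
    S u = T u :=
  congrFun ((denseRange_ι k).equalizer hS hT (funext h)) u

/-- Extension by density of a bounded linear operator on Schwartz functions. -/
def lift (k l : ℕ) (T : 𝓢(R3, ℝ) →ₗ[ℝ] 𝓢(R3, ℝ)) : X k →L[ℝ] X l :=
  (ι l ∘ₗ T).extendOfNorm (ι k)

theorem lift_ι {k l : ℕ} {T : 𝓢(R3, ℝ) →ₗ[ℝ] 𝓢(R3, ℝ)} (h : ∃ C, ∀ f, N l (T f) ≤ C * N k f)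
    (f : 𝓢(R3, ℝ)) : lift k l T (ι k f) = ι l (T f) :=
  LinearMap.extendOfNorm_eq (denseRange_ι k) h f

/-- Extension by density of a bounded bilinear operator on Schwartz functions. -/
theorem exists_lift₂ {k l : ℕ} (B : 𝓢(R3, ℝ) →ₗ[ℝ] 𝓢(R3, ℝ) →ₗ[ℝ] 𝓢(R3, ℝ)) {C : ℝ}
    (hC : 0 ≤ C) (h : ∀ f g, N l (B f g) ≤ C * (N k f * N k g)) :
    ∃ T : X k →L[ℝ] X k →L[ℝ] X l, ∀ f g, T (ι k f) (ι k g) = ι l (B f g) := by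
  have hb : ∀ f g, ‖(ι l ∘ₗ B f) g‖ ≤ (C * N k f) * ‖ι k g‖ := fun f g => by
    rw [mul_assoc]; exact h f g
  have hval : ∀ f g, (ι l ∘ₗ B f).extendOfNorm (ι k) (ι k g) = ι l (B f g) := fun f g =>
    LinearMap.extendOfNorm_eq (denseRange_ι k) ⟨_, hb f⟩ g
  let T0 : 𝓢(R3, ℝ) →ₗ[ℝ] (X k →L[ℝ] X l) :=
    { toFun := fun f => (ι l ∘ₗ B f).extendOfNorm (ι k)
      map_add' := fun f f' => by
        ext1 u
        refine ext_of_ι (ContinuousLinearMap.continuous _) (ContinuousLinearMap.continuous _)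
          (fun g => ?_) u
        rw [add_apply, hval, hval, hval, map_add, LinearMap.add_apply, map_add]
      map_smul' := fun c f => by
        ext1 u
        refine ext_of_ι (ContinuousLinearMap.continuous _) (ContinuousLinearMap.continuous _)
          (fun g => ?_) u
        simp only [RingHom.id_apply]
        rw [smul_apply, hval, hval, map_smul, LinearMap.smul_apply, map_smul] }
  have hT0 : ∀ f, ‖T0 f‖ ≤ C * ‖ι k f‖ := fun f =>
    LinearMap.opNorm_extendOfNorm_le (denseRange_ι k) (mul_nonneg hC (N_nonneg k f)) (hb f)
  refine ⟨LinearMap.extendOfNorm (F := X k →L[ℝ] X l) T0 (ι k), fun f g => ?_⟩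
  rw [LinearMap.extendOfNorm_eq (denseRange_ι k) ⟨C, hT0⟩ f]
  exact hval f g

/-- The natural map `X (k + 1) → X k`. -/
def incl (k : ℕ) : X (k + 1) →L[ℝ] X k := lift (k + 1) k LinearMap.id

theorem incl_ι (k : ℕ) (f : 𝓢(R3, ℝ)) : incl k (ι (k + 1) f) = ι k f :=
  lift_ι ⟨1, fun f => by simpa using N_le_succ k f⟩ f

theorem norm_incl_le (k : ℕ) (u : X (k + 1)) : ‖incl k u‖ ≤ ‖u‖ := by
  refine (denseRange_ι (k + 1)).induction_on u (isClosed_le (by fun_prop) (by fun_prop)) fun f => ?_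
  rw [incl_ι]
  exact N_le_succ k f

theorem continuous_emb (k : ℕ) : Continuous (emb k) := by
  have h : ∀ (k : ℕ) (w : Fin k → Option Gen), Continuous (wordOp k w) := by
    intro k
    induction k with
    | zero => intro w; exact continuous_id
    | succ k ih =>
      intro w
      refine (ih (Fin.tail w)).comp ?_
      rcases w 0 with _ | j | j
      · exact continuous_id
      · exact (mulCoord j).continuous
      · exact (partialDeriv ℝ j).continuous
  exact continuous_pi fun w =>
    (SchwartzMap.toLpCLM ℝ ℝ 2 (volume : Measure R3)).continuous.comp (h k w)

/-- A compatible family of elements of all the spaces `X k` comes from a Schwartz function. -/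
theorem exists_schwartz_of_compatible (u : ∀ k, X k) (hu : ∀ k, incl k (u (k + 1)) = u k) :
    ∃ f : 𝓢(R3, ℝ), ∀ k, ι k f = u k := by
  -- Approximate `u n` up to `2⁻ⁿ` in the `n`-th norm; the diagonal sequence converges in all norms.
  have happrox : ∀ n, ∃ f, ‖ι n f - u n‖ < (1 / 2 : ℝ) ^ n := fun n => by
    obtain ⟨f, hf⟩ := (denseRange_ι n).exists_dist_lt (u n) (pow_pos one_half_pos n)
    exact ⟨f, by rwa [dist_comm, dist_eq_norm] at hf⟩
  obtain ⟨f, hf⟩ := Classical.skolem.1 happrox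
  have hle : ∀ k n, k ≤ n → ‖ι k (f n) - u k‖ ≤ (1 / 2 : ℝ) ^ n := by
    intro k n hkn
    have : ∀ m, ‖ι k (f n) - u k‖ ≤ ‖ι (k + m) (f n) - u (k + m)‖ := by
      intro m
      induction m with
      | zero => exact le_rfl
      | succ m ih =>
        refine ih.trans ?_
        rw [← incl_ι, ← hu, ← map_sub]
        exact norm_incl_le _ _
    obtain ⟨m, rfl⟩ := Nat.exists_eq_add_of_le hkn
    exact (this m).trans (hf _).le
  set g : ℕ → 𝓢(R3, ℝ) := fun n => f (n + 1) - f n with hg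
  have hgN : ∀ k n, k ≤ n → N k (g n) ≤ 2 * (1 / 2 : ℝ) ^ n := by
    intro k n hkn
    have e : ι k (g n) = (ι k (f (n + 1)) - u k) - (ι k (f n) - u k) := by
      rw [hg]; simp only [map_sub]; abel
    rw [← norm_ι, e]
    have h1 := hle k (n + 1) (by omega)
    have h2 := hle k n hkn
    have h3 : (1 / 2 : ℝ) ^ (n + 1) ≤ (1 / 2 : ℝ) ^ n :=
      pow_le_pow_of_le_one (by norm_num) (by norm_num) (Nat.le_succ n)
    linarith [norm_sub_le (ι k (f (n + 1)) - u k) (ι k (f n) - u k)]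
  have hsum : ∀ k n, Summable fun i => SchwartzMap.seminorm ℝ k n (g i) := by
    intro k n
    obtain ⟨C, hC, h⟩ := exists_seminorm_le_N k n
    rw [← summable_nat_add_iff (k + 2 + n)]
    refine Summable.of_nonneg_of_le (fun i => apply_nonneg _ _) (fun i => (h _).trans
      (mul_le_mul_of_nonneg_left (hgN (k + 2 + n) (i + (k + 2 + n)) (by omega)) hC)) ?_
    exact ((((summable_geometric_two).comp_injective
      (add_left_injective (k + 2 + n))).mul_left 2).mul_left C)
  have hex : ∀ m, ∃ r : 𝓢(R3, ℝ), (∀ x, r x = ∑' i, g (i + m) x) ∧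
      ∀ k n, SchwartzMap.seminorm ℝ k n r ≤ ∑' i, SchwartzMap.seminorm ℝ k n (g (i + m)) := by
    intro m
    refine exists_tsum_schwartz (fun i => g (i + m)) fun k n => ?_
    exact (summable_nat_add_iff (f := fun i => SchwartzMap.seminorm ℝ k n (g i)) m).2 (hsum k n)
  obtain ⟨r, hr⟩ := Classical.skolem.1 hex
  have hr1 := fun m => (hr m).1
  have hr2 := fun m => (hr m).2
  have hsx : ∀ x, Summable fun i => g i x := fun x =>
    Summable.of_norm_bounded (hsum 0 0) fun i => SchwartzMap.norm_le_seminorm ℝ (g i) x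
  have hfr : ∀ m, f 0 + r 0 - f m = r m := by
    intro m
    ext x
    have h1 := (hsx x).sum_add_tsum_nat_add m
    have h2 : ∑ i ∈ Finset.range m, g i x = f m x - f 0 x := by
      have := Finset.sum_range_sub (fun i => f i x) m
      simpa [hg] using this
    have h3 := hr1 0 x
    have h4 := hr1 m x
    simp only [add_zero] at h3
    simp only [sub_apply, add_apply]
    rw [h3, h4, ← h1, h2]
    ring
  have htend : Filter.Tendsto f Filter.atTop (nhds (f 0 + r 0)) := by
    rw [(schwartz_withSeminorms ℝ R3 ℝ).tendsto_nhds]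
    rintro ⟨k, n⟩ ε hε
    have h0 := tendsto_sum_nat_add fun i => SchwartzMap.seminorm ℝ k n (g i)
    filter_upwards [h0.eventually_lt_const hε] with m hm
    rw [← neg_sub, hfr, map_neg_eq_map]
    exact (hr2 m k n).trans_lt hm
  refine ⟨f 0 + r 0, fun k => ?_⟩
  have hι : Continuous (ι k) := (continuous_emb k).subtype_mk (p := fun x => x ∈ XSub k) _
  refine tendsto_nhds_unique ((hι.tendsto _).comp htend) ?_
  rw [tendsto_iff_norm_sub_tendsto_zero]
  refine squeeze_zero_norm' ?_ (tendsto_pow_atTop_nhds_zero_of_lt_one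
    (by norm_num : (0 : ℝ) ≤ 1 / 2) (by norm_num))
  filter_upwards [Filter.eventually_ge_atTop k] with n hn
  rw [norm_norm]
  exact hle k n hn

/-! ### Compactness of a potential times the resolvent -/

/-- Rank-one operators are compact. -/
theorem isCompactOperator_smulRight {E F : Type*} [NormedAddCommGroup E] [NormedSpace ℝ E]
    [NormedAddCommGroup F] [NormedSpace ℝ F] (l : E →L[ℝ] ℝ) (y : F) :
    IsCompactOperator (l.smulRight y) := by
  have h1 : IsCompactOperator l := isCompactOperator_of_locallyCompactSpace_dom l
  have h2 := h1.clm_comp (ContinuousLinearMap.toSpanSingleton ℝ y)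
  exact h2

/-- The operator on `L²` whose kernel is a square integrable family of bounded functionals. -/
def kernelOp : Lp (L2R →L[ℝ] ℝ) 2 (volume : Measure R3) →L[ℝ] L2R →L[ℝ] L2R :=
  (ContinuousLinearMap.compLpL₂ (p := 2) (μ := (volume : Measure R3))
    (ContinuousLinearMap.apply ℝ ℝ : L2R →L[ℝ] (L2R →L[ℝ] ℝ) →L[ℝ] ℝ)).flip

theorem coeFn_kernelOp (Φ : Lp (L2R →L[ℝ] ℝ) 2 (volume : Measure R3)) (u : L2R) :
    kernelOp Φ u =ᵐ[volume] fun x => Φ x u :=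
  ContinuousLinearMap.coeFn_compLp' (ContinuousLinearMap.apply ℝ ℝ u) Φ

/-- Operators with square integrable kernels are compact: simple functions give operators of
finite rank, and they are dense. -/
theorem isCompactOperator_kernelOp (Φ : Lp (L2R →L[ℝ] ℝ) 2 (volume : Measure R3)) :
    IsCompactOperator (kernelOp Φ) := by
  refine Lp.induction (p := 2) ENNReal.ofNat_ne_top (fun Φ => IsCompactOperator (kernelOp Φ))
    (fun c s hs hμs => ?_) (fun f g hf hg _ h1 h2 => ?_) ?_ Φ
  · have h : kernelOp (Lp.simpleFunc.indicatorConst 2 hs hμs.ne c) =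
        c.smulRight (indicatorConstLp 2 hs hμs.ne (1 : ℝ)) := by
      ext1 u
      refine Lp.ext ?_
      have e1 := coeFn_kernelOp (Lp.simpleFunc.indicatorConst 2 hs hμs.ne c) u
      have e2 : ⇑(Lp.simpleFunc.indicatorConst 2 hs hμs.ne c :
          Lp (L2R →L[ℝ] ℝ) 2 (volume : Measure R3)) =ᵐ[volume] s.indicator fun _ => c := by
        rw [Lp.simpleFunc.coe_indicatorConst]
        exact indicatorConstLp_coeFn
      have e3 : indicatorConstLp 2 hs hμs.ne (1 : ℝ) =ᵐ[volume] s.indicator fun _ => (1 : ℝ) :=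
        indicatorConstLp_coeFn
      have e4 := Lp.coeFn_smul (c u) (indicatorConstLp 2 hs hμs.ne (1 : ℝ))
      filter_upwards [e1, e2, e3, e4] with x h1 h2 h3 h4
      rw [h1, h2, ContinuousLinearMap.smulRight_apply, h4, Pi.smul_apply, h3]
      by_cases hx : x ∈ s <;> simp [hx]
    change IsCompactOperator (kernelOp (Lp.simpleFunc.indicatorConst 2 hs hμs.ne c))
    rw [h]
    exact isCompactOperator_smulRight _ _
  · simp only [map_add]
    exact h1.add h2
  · exact (isClosed_setOfPred_isCompactOperator (𝕜₁ := ℝ) (𝕜₂ := ℝ) (σ₁₂ := RingHom.id ℝ)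
      (M₁ := L2R) (M₂ := L2R)).preimage kernelOp.continuous

/-- Evaluation of `(c - Δ)⁻¹ f` at a point, as a linear functional of `f`. -/
def evalRes (c : ℝ) (x : R3) : 𝓢(R3, ℝ) →ₗ[ℝ] ℝ where
  toFun f := res c f x
  map_add' f g := by simp
  map_smul' a f := by simp

theorem exists_evalRes_extend {c : ℝ} (hc : 0 < c) :
    ∃ (r : R3 → L2R →L[ℝ] ℝ) (C : ℝ), 0 ≤ C ∧ (∀ x f, r x (toL2 f) = res c f x) ∧
      (∀ x, ‖r x‖ ≤ C) ∧ Continuous r := by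
  obtain ⟨C, hC, h1⟩ := exists_sup_bound hc
  obtain ⟨C', hC', h2⟩ := exists_holder_bound hc
  have hb : ∀ x f, ‖evalRes c x f‖ ≤ C * ‖toL2 f‖ := fun x f => by
    have := h1 (res c f) x
    rwa [helm_res hc] at this
  have hval : ∀ x f, (evalRes c x).extendOfNorm toL2 (toL2 f) = res c f x := fun x f =>
    LinearMap.extendOfNorm_eq denseRange_toL2 ⟨C, hb x⟩ f
  refine ⟨fun x => (evalRes c x).extendOfNorm toL2, C, hC, hval,
    fun x => LinearMap.opNorm_extendOfNorm_le denseRange_toL2 hC (hb x), ?_⟩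
  have hH : ∀ x y, ‖(evalRes c x).extendOfNorm toL2 - (evalRes c y).extendOfNorm toL2‖ ≤
      C' * ‖x - y‖ ^ (1 / 4 : ℝ) := by
    intro x y
    refine ContinuousLinearMap.opNorm_le_bound _ (by positivity) fun u => ?_
    refine denseRange_toL2.induction_on u (isClosed_le (by fun_prop) (by fun_prop)) fun f => ?_
    rw [sub_apply, hval, hval]
    have := h2 (res c f) x y
    rwa [helm_res hc] at this
  rw [continuous_iff_continuousAt]
  intro y
  rw [ContinuousAt, tendsto_iff_norm_sub_tendsto_zero]
  refine squeeze_zero (fun _ => norm_nonneg _) (fun x => hH x y) ?_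
  have hcont : Continuous fun x : R3 => C' * ‖x - y‖ ^ (1 / 4 : ℝ) :=
    continuous_const.mul ((continuous_id.sub continuous_const).norm.rpow_const
      fun _ => Or.inr (by norm_num))
  simpa using hcont.tendsto y

/-- The operator `v (c - Δ)⁻¹` extends to a compact operator on `L²`. -/
theorem exists_compact_mulS_res {c : ℝ} (hc : 0 < c) (v : 𝓢(R3, ℝ)) :
    ∃ K : L2R →L[ℝ] L2R, IsCompactOperator K ∧ ∀ f, K (toL2 f) = toL2 (mulS v (res c f)) := by
  obtain ⟨r, C, hC, h1, h2, h3⟩ := exists_evalRes_extend hc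
  have hm : MemLp (fun x => v x • r x) 2 (volume : Measure R3) := by
    refine MemLp.of_le_mul (v.memLp 2 volume) (c := C)
      (v.continuous.smul h3).aestronglyMeasurable (Filter.Eventually.of_forall fun x => ?_)
    rw [norm_smul, mul_comm]
    exact mul_le_mul_of_nonneg_right (h2 x) (norm_nonneg _)
  refine ⟨kernelOp (hm.toLp _), isCompactOperator_kernelOp _, fun f => Lp.ext ?_⟩
  filter_upwards [coeFn_kernelOp (hm.toLp _) (toL2 f), hm.coeFn_toLp,
    coeFn_toL2 (mulS v (res c f))] with x e1 e2 e3
  rw [e1, e2, e3, mulS_apply, smul_apply, h1, smul_eq_mul]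

/-! ### Regularity bootstrap and the Fredholm alternative -/

/-- A square integrable solution of `u = f - S u`, where `S` gains one order in the scale of norms
and `f` is a Schwartz function, is a Schwartz function. -/
theorem exists_schwartz_of_fixed_point (S : 𝓢(R3, ℝ) →ₗ[ℝ] 𝓢(R3, ℝ))
    (hS : ∀ k, ∃ C, ∀ f, N (k + 1) (S f) ≤ C * N k f) (T : L2R →L[ℝ] L2R)
    (hT : ∀ f, T (toL2 f) = toL2 (S f)) (f : 𝓢(R3, ℝ)) (u : L2R) (hu : u = toL2 f - T u) :
    ∃ g, toL2 g = u := by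
  let Lk : (k : ℕ) → X k →L[ℝ] X (k + 1) := fun k => lift k (k + 1) S
  have hLk : ∀ k g, Lk k (ι k g) = ι (k + 1) (S g) := fun k g => lift_ι (hS k) g
  let E : L2R →L[ℝ] X 0 := (ι 0).extendOfNorm toL2
  have hE : ∀ g, E (toL2 g) = ι 0 g := fun g =>
    LinearMap.extendOfNorm_eq denseRange_toL2 ⟨1, fun g => by rw [norm_ι, N_zero, one_mul]⟩ g
  let J : X 0 →L[ℝ] L2R := toL2.extendOfNorm (ι 0)
  have hJ : ∀ g, J (ι 0 g) = toL2 g := fun g =>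
    LinearMap.extendOfNorm_eq (denseRange_ι 0) ⟨1, fun g => by rw [norm_ι, N_zero, one_mul]⟩ g
  have hJE : ∀ w, J (E w) = w := fun w =>
    congrFun (denseRange_toL2.equalizer (J.continuous.comp E.continuous) continuous_id
      (funext fun g => by simp [hE, hJ])) w
  have hET : ∀ w, E (T w) = incl 0 (Lk 0 (E w)) := fun w =>
    congrFun (denseRange_toL2.equalizer (E.continuous.comp T.continuous)
      ((incl 0).continuous.comp ((Lk 0).continuous.comp E.continuous))
      (funext fun g => by simp [hE, hT, hLk, incl_ι])) w
  have hcomm : ∀ k (w : X (k + 1)), incl (k + 1) (Lk (k + 1) w) = Lk k (incl k w) := fun k w =>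
    ext_of_ι ((incl (k + 1)).continuous.comp (Lk (k + 1)).continuous)
      ((Lk k).continuous.comp (incl k).continuous) (fun g => by simp [hLk, incl_ι]) w
  let U : ∀ k, X k := fun k => Nat.rec (motive := X) (E u) (fun k w => ι (k + 1) f - Lk k w) k
  have hU : ∀ k, U (k + 1) = ι (k + 1) f - Lk k (U k) := fun k => rfl
  have hcompat : ∀ k, incl k (U (k + 1)) = U k := by
    intro k
    induction k with
    | zero =>
      have h0 : U 0 = E u := rfl
      rw [hU, map_sub, incl_ι, h0, ← hET, ← hE, ← map_sub, ← hu]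
    | succ k ih => rw [hU, map_sub, incl_ι, hcomm, ih, ← hU]
  obtain ⟨g, hg⟩ := exists_schwartz_of_compatible U hcompat
  refine ⟨g, ?_⟩
  rw [← hJ, hg 0]
  exact hJE u

/-- Multiplication by a Schwartz function after the resolvent gains one order. -/
theorem exists_N_mulS_left_res_le {c : ℝ} (hc : 0 < c) (v : 𝓢(R3, ℝ)) (k : ℕ) :
    ∃ C : ℝ, 0 ≤ C ∧ ∀ f, N (k + 1) (mulS v (res c f)) ≤ C * N k f := by
  obtain ⟨C, hC, h1, h2⟩ := exists_res_bound hc k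
  obtain ⟨C0, hC0, h0⟩ := exists_N_mulS_left_le v k
  choose C1 hC1 hx using fun j => exists_N_mulS_left_le (mulCoord j v) k
  choose C2 hC2 hd using fun j => exists_N_mulS_left_le (partialDeriv ℝ j v) k
  have s1 := Finset.sum_nonneg fun j (_ : j ∈ Finset.univ) => hC1 j
  have s2 := Finset.sum_nonneg fun j (_ : j ∈ Finset.univ) => hC2 j
  refine ⟨(C0 + ∑ j, C1 j + ∑ j, C2 j) * C, by positivity, fun f => ?_⟩
  have p := mul_nonneg hC (N_nonneg k f)
  have hA : ∀ (a : ℝ) (g), 0 ≤ a → a ≤ C0 + ∑ j, C1 j + ∑ j, C2 j → N k g ≤ C * N k f →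
      a * N k g ≤ (C0 + ∑ j, C1 j + ∑ j, C2 j) * C * N k f := by
    intro a g ha ha' hg
    rw [mul_assoc]
    exact mul_le_mul ha' hg (N_nonneg _ _) (by positivity)
  have b1 : ∀ j, C1 j ≤ ∑ j, C1 j := fun j =>
    Finset.single_le_sum (f := C1) (fun j _ => hC1 j) (Finset.mem_univ j)
  have b2 : ∀ j, C2 j ≤ ∑ j, C2 j := fun j =>
    Finset.single_le_sum (f := C2) (fun j _ => hC2 j) (Finset.mem_univ j)
  refine N_succ_le ?_ (fun j => ?_) (fun j => ?_)
  · exact (h0 _).trans (hA _ _ hC0 (by linarith) (h1 f))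
  · rw [← mulS_mulCoord]
    exact (hx j _).trans (hA _ _ (hC1 j) (by linarith [b1 j]) (h1 f))
  · rw [partialDeriv_mulS]
    refine (N_add_le _ _ _).trans ?_
    have e1 := (hd j (res c f)).trans (mul_le_mul_of_nonneg_left (h1 f) (hC2 j))
    have e2 := (h0 (partialDeriv ℝ j (res c f))).trans (mul_le_mul_of_nonneg_left (h2 j f) hC0)
    have := b2 j
    rw [mul_assoc]
    nlinarith

/-- The functional `f ↦ ⟨φ, f⟩` on Schwartz functions. -/
def pair (φ : 𝓢(R3, ℝ)) : 𝓢(R3, ℝ) →ₗ[ℝ] ℝ := (innerₛₗ ℝ (toL2 φ)) ∘ₗ toL2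

theorem pair_apply (φ f : 𝓢(R3, ℝ)) : pair φ f = inner ℝ (toL2 φ) (toL2 f) := rfl

theorem abs_pair_le (φ f : 𝓢(R3, ℝ)) : |pair φ f| ≤ ‖toL2 φ‖ * ‖toL2 f‖ := by
  rw [pair_apply]; exact abs_real_inner_le_norm _ _

/-- The perturbation `v + ⟨φ, ·⟩ φ`. -/
def pert (v φ : 𝓢(R3, ℝ)) : 𝓢(R3, ℝ) →ₗ[ℝ] 𝓢(R3, ℝ) :=
  mulS v + (pair φ).smulRight φ

theorem pert_apply (v φ f : 𝓢(R3, ℝ)) : pert v φ f = mulS v f + pair φ f • φ := rfl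

theorem exists_N_pert_res_le {c : ℝ} (hc : 0 < c) (v φ : 𝓢(R3, ℝ)) (k : ℕ) :
    ∃ C : ℝ, 0 ≤ C ∧ ∀ f, N (k + 1) (pert v φ (res c f)) ≤ C * N k f := by
  obtain ⟨C, hC, h⟩ := exists_N_mulS_left_res_le hc v k
  obtain ⟨C', hC', h', -⟩ := exists_res_bound hc 0
  have hp := N_nonneg (k + 1) φ
  refine ⟨C + ‖toL2 φ‖ * C' * N (k + 1) φ, by positivity, fun f => ?_⟩
  rw [pert_apply]
  refine (N_add_le _ _ _).trans ?_
  rw [N_smul, add_mul]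
  refine add_le_add (h f) ?_
  have h1 := abs_pair_le φ (res c f)
  have h2 := h' f
  rw [N_zero, N_zero] at h2
  calc _ ≤ (‖toL2 φ‖ * (C' * N k f)) * N (k + 1) φ := by
        gcongr
        refine h1.trans ?_
        gcongr
        exact h2.trans (by gcongr; exact toL2_le_N k f)
    _ = _ := by ring

/-- If `c - Δ + v + ⟨φ, ·⟩ φ` is injective on Schwartz functions, it has an inverse there which is
bounded for every norm of the scale. -/
theorem exists_green {c : ℝ} (hc : 0 < c) (v φ : 𝓢(R3, ℝ))
    (hinj : ∀ u, helm c u + pert v φ u = 0 → u = 0) :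
    ∃ G : 𝓢(R3, ℝ) →ₗ[ℝ] 𝓢(R3, ℝ), (∀ f, helm c (G f) + pert v φ (G f) = f) ∧
      ∀ k, ∃ C : ℝ, 0 ≤ C ∧ ∀ f, N k (G f) ≤ C * N k f := by
  obtain ⟨K, hK, hKv⟩ := exists_compact_mulS_res hc v
  obtain ⟨C', hC', h', -⟩ := exists_res_bound hc 0
  simp only [N_zero] at h'
  let l : L2R →L[ℝ] ℝ := (pair φ ∘ₗ res c).extendOfNorm toL2
  have hl : ∀ f, l (toL2 f) = pair φ (res c f) := fun f =>
    LinearMap.extendOfNorm_eq denseRange_toL2 ⟨‖toL2 φ‖ * C', fun f => by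
      rw [mul_assoc]
      exact (abs_pair_le φ (res c f)).trans (by gcongr; exact h' f)⟩ f
  let A : L2R →L[ℝ] L2R := K + l.smulRight (toL2 φ)
  have hA : ∀ f, A (toL2 f) = toL2 ((pert v φ ∘ₗ res c) f) := fun f => by
    simp [A, hKv, hl, pert_apply]
  have hAc : IsCompactOperator A := hK.add (isCompactOperator_smulRight _ _)
  have hgain : ∀ k, ∃ C, ∀ f, N (k + 1) ((pert v φ ∘ₗ res c) f) ≤ C * N k f := fun k => by
    obtain ⟨C, -, h⟩ := exists_N_pert_res_le hc v φ k
    exact ⟨C, h⟩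
  -- `A` extends `(v + ⟨φ, ·⟩ φ)(c - Δ)⁻¹`, so `1 + A` is injective by regularity and `hinj`.
  have hker : ∀ u, A u = -u → u = 0 := by
    intro u hu
    obtain ⟨g, rfl⟩ := exists_schwartz_of_fixed_point (pert v φ ∘ₗ res c) hgain A hA 0 u
      (by rw [hu]; simp)
    have h1 : g + pert v φ (res c g) = 0 := by
      apply toL2_injective
      rw [map_add, map_zero]
      have := hA g
      rw [hu] at this
      rw [LinearMap.comp_apply] at this
      rw [← this]; simp
    have h2 := hinj (res c g) (by rw [helm_res hc]; exact h1)
    have h3 : g = 0 := by rw [← helm_res hc g, h2, map_zero]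
    rw [h3, map_zero]
  have hres : (-1 : ℝ) ∈ resolventSet ℝ A := by
    rcases hAc.hasEigenvalue_or_mem_resolventSet (μ := -1) (by norm_num) with h | h
    · obtain ⟨u, hu⟩ := h.exists_hasEigenvector
      exact absurd (hker u (by simpa using hu.apply_eq_smul)) hu.2
    · exact h
  rw [spectrum.mem_resolventSet_iff] at hres
  obtain ⟨b, hb⟩ := hres
  have hbv : ∀ u, (b : L2R →L[ℝ] L2R) u = -(u + A u) := fun u => by
    rw [hb]; simp; abel
  let B : L2R →L[ℝ] L2R := -(↑b⁻¹ : L2R →L[ℝ] L2R)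
  have hB : ∀ w, B w = w - A (B w) := by
    intro w
    have h1 : (b : L2R →L[ℝ] L2R) ((↑b⁻¹ : L2R →L[ℝ] L2R) w) = w := by
      rw [← mul_apply_eq_comp, Units.mul_inv]; rfl
    have h2 := hbv (B w)
    have h3 : (b : L2R →L[ℝ] L2R) (B w) = -w := by simp [B, h1]
    rw [h3, neg_inj] at h2
    exact eq_sub_of_add_eq h2.symm
  have hex : ∀ f, ∃ g, toL2 g = B (toL2 f) := fun f =>
    exists_schwartz_of_fixed_point (pert v φ ∘ₗ res c) hgain A hA f _ (hB _)
  obtain ⟨g, hg⟩ := Classical.skolem.1 hex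
  let gl : 𝓢(R3, ℝ) →ₗ[ℝ] 𝓢(R3, ℝ) :=
    { toFun := g
      map_add' := fun f f' => toL2_injective (by simp only [hg, map_add])
      map_smul' := fun a f => toL2_injective (by simp only [hg, map_smul, RingHom.id_apply]) }
  have hgl : ∀ f, gl f = f - pert v φ (res c (gl f)) := by
    intro f
    apply toL2_injective
    have h1 := hB (toL2 f)
    have h2 : toL2 (gl f) = B (toL2 f) := hg f
    rw [← h2, hA] at h1
    rw [map_sub]
    exact h1
  have hglN : ∀ k, ∃ C : ℝ, 0 ≤ C ∧ ∀ f, N k (gl f) ≤ C * N k f := by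
    intro k
    induction k with
    | zero =>
      refine ⟨‖B‖, norm_nonneg _, fun f => ?_⟩
      rw [N_zero, N_zero]
      have h2 : toL2 (gl f) = B (toL2 f) := hg f
      rw [h2]
      exact B.le_opNorm _
    | succ k ih =>
      obtain ⟨C, hC, h⟩ := ih
      obtain ⟨C1, hC1, h1⟩ := exists_N_pert_res_le hc v φ k
      refine ⟨1 + C1 * C, by positivity, fun f => ?_⟩
      rw [hgl]
      refine (N_sub_le _ _ _).trans ?_
      rw [add_mul, one_mul, mul_assoc]
      gcongr
      refine (h1 _).trans ?_
      gcongr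
      refine (h f).trans ?_
      gcongr
      exact N_le_succ k f
  refine ⟨res c ∘ₗ gl, fun f => ?_, fun k => ?_⟩
  · rw [LinearMap.comp_apply, helm_res hc]
    conv_lhs => rw [hgl f]
    rw [← hgl f]
    have := hgl f
    exact add_eq_of_eq_sub this
  · obtain ⟨C, hC, h⟩ := hglN k
    obtain ⟨C1, hC1, h1, -⟩ := exists_res_bound hc k
    refine ⟨C1 * C, by positivity, fun f => ?_⟩
    rw [mul_assoc]
    exact (h1 _).trans (by gcongr; exact h f)

/-! ### The eigenfunction -/

theorem norm_toLp_ofRealS (f : 𝓢(R3, ℝ)) :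
    ‖(ofRealS f).toLp 2 (volume : Measure R3)‖ = ‖toL2 f‖ := by
  have h : ∀ᵐ x : R3, ‖(ofRealS f).toLp 2 (volume : Measure R3) x‖ = ‖toL2 f x‖ := by
    filter_upwards [(ofRealS f).coeFn_toLp 2 volume, coeFn_toL2 f] with x h1 h2
    rw [h1, h2]; simp
  exact le_antisymm (Lp.norm_le_norm_of_ae_le (h.mono fun x hx => hx.le))
    (Lp.norm_le_norm_of_ae_le (h.mono fun x hx => hx.ge))

theorem neg_laplacian_ofRealS (c : ℝ) (f : 𝓢(R3, ℝ)) (x : R3) :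
    -(Δ (ofRealS f)) x = (helm c f x : ℂ) - (c : ℂ) * (f x : ℂ) := by
  rw [laplacian_ofRealS, helm_apply]
  simp

/-- A real `L²` eigenfunction with negative eigenvalue is a Schwartz function, by regularity for the
equation `u = -(c - Δ)⁻¹ V u` with `c = -e`. -/
theorem exists_schwartz_eigenfunction (V : 𝓢(R3, ℝ)) {e : ℝ} (he : e < 0) (φ : L2)
    (hφ : φ ∈ eigenspace V e) (hreal : ∀ᵐ x : R3, (φ x).im = 0) :
    ∃ φ₀ : 𝓢(R3, ℝ), (ofRealS φ₀).toLp 2 (volume : Measure R3) = φ ∧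
      helm (-e) φ₀ + mulS V φ₀ = 0 := by
  have hc : 0 < -e := by linarith
  set c := -e with hce
  let u : L2R := Complex.reCLM.compLp φ
  have hu : ∀ᵐ x : R3, ((u x : ℝ) : ℂ) = φ x := by
    filter_upwards [Complex.reCLM.coeFn_compLp φ, hreal] with x h1 h2
    apply Complex.ext
    · rw [Complex.ofReal_re]; exact h1
    · rw [Complex.ofReal_im, h2]
  -- The distributional equation, tested against `(c - Δ)⁻¹ η`.
  have hdist : ∀ η, inner ℝ (toL2 (η + mulS V (res c η))) u = 0 := by
    intro η
    have h1 := congrArg (fun T => T (ofRealS (res c η))) hφ.2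
    simp only [schrodinger_apply] at h1
    have h2 : ((e : ℂ) • (φ : 𝓢'(R3, ℂ))) (ofRealS (res c η)) =
        ∫ x, (e : ℂ) * (ofRealS (res c η) x * φ x) := by
      change (e : ℂ) • ((φ : 𝓢'(R3, ℂ)) (ofRealS (res c η))) = _
      rw [Lp.toTemperedDistribution_apply, integral_const_mul]
      rfl
    rw [h2] at h1
    have i2 : Integrable fun x => (e : ℂ) * (ofRealS (res c η) x * φ x) :=
      (((ofRealS (res c η)).memLp 2 volume).integrable_mul (Lp.memLp φ)).const_mul _
    have hq : (fun x => (-(Δ (ofRealS (res c η))) x + ((V x : ℝ) : ℂ) * ofRealS (res c η) x) * φ x)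
        =ᵐ[volume] fun x => (((η + mulS V (res c η)) x * u x : ℝ) : ℂ) +
          (e : ℂ) * (ofRealS (res c η) x * φ x) := by
      filter_upwards [hu] with x hx
      rw [neg_laplacian_ofRealS c, helm_res hc, hce]
      simp only [add_apply, mulS_apply, ofRealS_apply]
      push_cast
      rw [hx]
      ring
    rw [integral_congr_ae hq, integral_add ?_ i2, add_eq_right, integral_complex_ofReal] at h1
    · rw [L2.inner_def]
      rw [← Complex.ofReal_eq_zero, ← h1]
      congr 1
      refine integral_congr_ae ?_
      filter_upwards [coeFn_toL2 (η + mulS V (res c η))] with x hx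
      rw [hx]
      simp [mul_comm]
    · exact (((η + mulS V (res c η)).memLp 2 volume).integrable_mul (Lp.memLp u)).ofReal
  let S : 𝓢(R3, ℝ) →ₗ[ℝ] 𝓢(R3, ℝ) := res c ∘ₗ mulS V
  have hS : ∀ k, ∃ C, ∀ f, N (k + 1) (S f) ≤ C * N k f := fun k => by
    obtain ⟨C, -, h⟩ := exists_N_res_mulS_left_le hc V k
    exact ⟨C, h⟩
  let T : L2R →L[ℝ] L2R := (toL2 ∘ₗ S).extendOfNorm toL2
  have hT : ∀ f, T (toL2 f) = toL2 (S f) := fun f => by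
    refine LinearMap.extendOfNorm_eq denseRange_toL2 ?_ f
    obtain ⟨C, h⟩ := hS 0
    refine ⟨C, fun g => ?_⟩
    have := h g
    rw [N_zero] at this
    exact (toL2_le_N 1 _).trans this
  have hsymm : ∀ η w, inner ℝ (toL2 η) (T w) = inner ℝ (toL2 (mulS V (res c η))) w := by
    intro η w
    refine denseRange_toL2.induction_on w (isClosed_eq (by fun_prop) (by fun_prop)) fun f => ?_
    rw [hT, LinearMap.comp_apply, inner_res hc, inner_mulS]
  have hfix : u = toL2 0 - T u := by
    rw [map_zero, zero_sub, eq_neg_iff_add_eq_zero]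
    have h0 : ∀ w : L2R, inner ℝ w (u + T u) = 0 := by
      intro w
      refine denseRange_toL2.induction_on w (isClosed_eq (by fun_prop) (by fun_prop)) fun η => ?_
      rw [inner_add_right, hsymm, ← inner_add_left, ← map_add, hdist]
    exact inner_self_eq_zero.1 (h0 (u + T u))
  obtain ⟨φ₀, h₀⟩ := exists_schwartz_of_fixed_point S hS T hT 0 u hfix
  refine ⟨φ₀, Lp.ext ?_, ?_⟩
  · filter_upwards [(ofRealS φ₀).coeFn_toLp 2 volume, hu, coeFn_toL2 φ₀] with x h1 h2 h3
    rw [h1, ← h2, ← h₀, h3]; rfl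
  · have h1 : φ₀ = -S φ₀ := by
      apply toL2_injective
      rw [map_neg, ← hT, h₀]
      conv_lhs => rw [hfix]
      simp
    have h2 := congrArg (helm c) h1
    rw [map_neg, LinearMap.comp_apply, helm_res hc] at h2
    rw [h2]; simp

/-- Schwartz solutions of the eigenvalue equation lie in the eigenspace. -/
theorem toLp_mem_eigenspace (V : 𝓢(R3, ℝ)) (e : ℝ) (u : 𝓢(R3, ℝ))
    (hu : helm (-e) u + mulS V u = 0) :
    (ofRealS u).toLp 2 (volume : Measure R3) ∈ eigenspace V e := by
  have hcoe : (((ofRealS u).toLp 2 (volume : Measure R3) : L2) : 𝓢'(R3, ℂ)) =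
      ((ofRealS u : 𝓢(R3, ℂ)) : 𝓢'(R3, ℂ)) := by
    ext ψ
    rw [Lp.toTemperedDistribution_apply]
    refine integral_congr_ae ?_
    filter_upwards [(ofRealS u).coeFn_toLp 2 volume] with x hx
    rw [hx]
    rfl
  refine ⟨by rw [hcoe]; exact SchwartzMap.memSobolev _, ?_⟩
  ext ψ
  rw [schrodinger_apply]
  change _ = (e : ℂ) • ((((ofRealS u).toLp 2 (volume : Measure R3) : L2) : 𝓢'(R3, ℂ)) ψ)
  rw [Lp.toTemperedDistribution_apply]
  have hpt : ∀ x, (Δ (ofRealS u)) x = ((V x : ℝ) : ℂ) * ofRealS u x - (e : ℂ) * ofRealS u x := by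
    intro x
    have h1 := neg_laplacian_ofRealS (-e) u x
    have h2 : helm (-e) u x + V x * u x = 0 := by
      have := DFunLike.congr_fun hu x
      simpa using this
    have h3 : helm (-e) u x = -(V x * u x) := by linarith
    rw [h3] at h1
    push_cast at h1
    rw [ofRealS_apply]
    linear_combination -h1
  have e1 : (fun x => (-(Δ ψ) x + ((V x : ℝ) : ℂ) * ψ x) *
      (ofRealS u).toLp 2 (volume : Measure R3) x) =ᵐ[volume]
      fun x => -(ofRealS u x * Δ ψ x) + (((V x : ℝ) : ℂ) * ofRealS u x) * ψ x := by
    filter_upwards [(ofRealS u).coeFn_toLp 2 volume] with x hx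
    rw [hx]; ring
  have e2 : (fun x => ψ x • (ofRealS u).toLp 2 (volume : Measure R3) x) =ᵐ[volume]
      fun x => ofRealS u x * ψ x := by
    filter_upwards [(ofRealS u).coeFn_toLp 2 volume] with x hx
    rw [hx, smul_eq_mul, mul_comm]
  let mulC : 𝓢(R3, ℂ) → 𝓢(R3, ℂ) → 𝓢(R3, ℂ) :=
    fun f g => SchwartzMap.pairing (ContinuousLinearMap.mul ℝ ℂ) f g
  have i1 : Integrable fun x => ofRealS u x * Δ ψ x := (mulC (ofRealS u) (Δ ψ)).integrable
  have i2 : Integrable fun x => Δ (ofRealS u) x * ψ x := (mulC (Δ (ofRealS u)) ψ).integrable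
  have i1' : Integrable fun x => -(ofRealS u x * Δ ψ x) := i1.neg
  have i2' : Integrable fun x => -(Δ (ofRealS u) x * ψ x) := i2.neg
  have i3 : Integrable fun x => (((V x : ℝ) : ℂ) * ofRealS u x) * ψ x :=
    (mulC (mulC (ofRealS V) (ofRealS u)) ψ).integrable
  rw [integral_congr_ae e1, integral_congr_ae e2, integral_add i1' i3, integral_neg,
    SchwartzMap.integral_mul_laplacian_right_eq_left, ← integral_neg, ← integral_add i2' i3,
    smul_eq_mul, ← integral_const_mul]
  congr 1
  ext x
  rw [hpt]; ring

/-- Simplicity of the eigenvalue on the level of real Schwartz functions. -/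
theorem exists_smul_of_simple (V : 𝓢(R3, ℝ)) (e : ℝ)
    (hsimple : Module.finrank ℂ (eigenspace V e) = 1) (φ₀ : 𝓢(R3, ℝ))
    (hφ₀ : helm (-e) φ₀ + mulS V φ₀ = 0) (hne : φ₀ ≠ 0) (u : 𝓢(R3, ℝ))
    (hu : helm (-e) u + mulS V u = 0) : ∃ a : ℝ, u = a • φ₀ := by
  have hne' : (⟨_, toLp_mem_eigenspace V e φ₀ hφ₀⟩ : eigenspace V e) ≠ 0 := by
    intro h
    have h1 := congrArg Subtype.val h
    have h2 := congrArg norm h1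
    simp only [norm_toLp_ofRealS, ZeroMemClass.coe_zero, norm_zero, norm_eq_zero] at h2
    exact hne (toL2_injective (by rw [h2, map_zero]))
  obtain ⟨a, ha⟩ := (finrank_eq_one_iff_of_nonzero' _ hne').1 hsimple
    ⟨_, toLp_mem_eigenspace V e u hu⟩
  have h1 : a • (ofRealS φ₀).toLp 2 (volume : Measure R3) =
      (ofRealS u).toLp 2 (volume : Measure R3) := congrArg Subtype.val ha
  have h2 : (a • ofRealS φ₀).toLp 2 (volume : Measure R3) =
      (ofRealS u).toLp 2 (volume : Measure R3) := by
    rw [← h1]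
    exact map_smul (SchwartzMap.toLpCLM ℂ ℂ 2 (volume : Measure R3)) a (ofRealS φ₀)
  have h3 := SchwartzMap.injective_toLp 2 volume h2
  refine ⟨a.re, ?_⟩
  ext x
  have := congrArg Complex.re (DFunLike.congr_fun h3 x)
  simpa using this.symm

/-- Adding the projection onto the kernel makes `c - Δ + V` injective. -/
theorem bordered_injective {c : ℝ} (V φ₀ : 𝓢(R3, ℝ)) (hφ₀ : helm c φ₀ + mulS V φ₀ = 0)
    (h1 : ‖toL2 φ₀‖ = 1)
    (hs : ∀ u, helm c u + mulS V u = 0 → ∃ a : ℝ, u = a • φ₀) (u : 𝓢(R3, ℝ))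
    (hu : helm c u + pert V φ₀ u = 0) : u = 0 := by
  have hself : pair φ₀ φ₀ = 1 := by rw [pair_apply, real_inner_self_eq_norm_sq, h1]; norm_num
  have h2 : pair φ₀ (helm c u + mulS V u) = 0 := by
    rw [pair_apply, map_add, inner_add_right, inner_helm, inner_mulS, ← inner_add_left, ← map_add,
      hφ₀, map_zero, inner_zero_left]
  rw [pert_apply, ← add_assoc] at hu
  have h3 : pair φ₀ u = 0 := by
    have := congrArg (pair φ₀) hu
    rwa [map_add, h2, map_smul, hself, map_zero, zero_add, smul_eq_mul, mul_one] at this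
  rw [h3, zero_smul, add_zero] at hu
  obtain ⟨a, rfl⟩ := hs u hu
  rw [map_smul, hself, smul_eq_mul, mul_one] at h3
  rw [h3, zero_smul]

/-! ### The cubic nonlinearity on the scale of Banach spaces -/

/-- The cube of a real Schwartz function. -/
def cube (f : 𝓢(R3, ℝ)) : 𝓢(R3, ℝ) := mulS f (mulS f f)

theorem cube_apply (f : 𝓢(R3, ℝ)) (x : R3) : cube f x = f x ^ 3 := by
  rw [cube, mulS_apply, mulS_apply]; ring

/-- Multiplication of Schwartz functions extends to `X k` for `k ≥ 4`. -/
theorem exists_mul_extend {k : ℕ} (hk : 4 ≤ k) :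
    ∃ M : X k →L[ℝ] X k →L[ℝ] X k, ∀ f g, M (ι k f) (ι k g) = ι k (mulS f g) := by
  obtain ⟨C, hC, h⟩ := exists_N_mulS_le k k k le_rfl le_rfl (by omega)
  exact exists_lift₂ mulS hC h

theorem exists_cube_extend {k : ℕ} (hk : 4 ≤ k) :
    ∃ M : X k → X k, ContDiff ℝ ω M ∧ ∀ f, M (ι k f) = ι k (cube f) := by
  obtain ⟨M, hM⟩ := exists_mul_extend hk
  refine ⟨fun u => M u (M u u), ?_, fun f => by simp only [hM, cube]⟩
  exact M.contDiff.clm_apply (M.contDiff.clm_apply contDiff_id)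

/-- The resolvent of the cube gains one order. -/
theorem exists_resCube_extend {c : ℝ} (hc : 0 < c) {k : ℕ} (hk : 4 ≤ k) :
    ∃ M : X k → X (k + 1), ContDiff ℝ ω M ∧ ∀ f, M (ι k f) = ι (k + 1) (res c (cube f)) := by
  obtain ⟨M, hM⟩ := exists_mul_extend hk
  obtain ⟨C, hC, h⟩ := exists_N_res_mulS_le hc hk
  obtain ⟨B, hB⟩ := exists_lift₂ (k := k) (l := k + 1) (mulS.compr₂ (res c)) hC h
  refine ⟨fun u => B u (M u u), ?_, fun f => by simp only [hM, hB]; rfl⟩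
  exact B.contDiff.clm_apply (M.contDiff.clm_apply contDiff_id)

theorem exists_pair_extend (φ : 𝓢(R3, ℝ)) (k : ℕ) :
    ∃ l : X k →L[ℝ] ℝ, ∀ f, l (ι k f) = pair φ f := by
  refine ⟨(pair φ).extendOfNorm (ι k), fun f => LinearMap.extendOfNorm_eq (denseRange_ι k)
    ⟨‖toL2 φ‖, fun f => (abs_pair_le φ f).trans ?_⟩ f⟩
  exact mul_le_mul_of_nonneg_left (toL2_le_N k f) (norm_nonneg _)

theorem lift_res_ι {c : ℝ} (hc : 0 < c) (k : ℕ) (f : 𝓢(R3, ℝ)) :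
    lift k k (res c) (ι k f) = ι k (res c f) := by
  obtain ⟨C, -, h, -⟩ := exists_res_bound hc k
  exact lift_ι ⟨C, h⟩ f

theorem lift_res_mulS_ι {c : ℝ} (hc : 0 < c) (v : 𝓢(R3, ℝ)) (k : ℕ) (f : 𝓢(R3, ℝ)) :
    lift k (k + 1) (res c ∘ₗ mulS v) (ι k f) = ι (k + 1) (res c (mulS v f)) := by
  obtain ⟨C, -, h⟩ := exists_N_res_mulS_left_le hc v k
  exact lift_ι (T := res c ∘ₗ mulS v) ⟨C, h⟩ f

theorem lift_id_ι {k l : ℕ} (h : l ≤ k) (f : 𝓢(R3, ℝ)) :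
    lift k l LinearMap.id (ι k f) = ι l f :=
  lift_ι ⟨1, fun f => by simpa using N_mono h f⟩ f

theorem helm_sub (c μ : ℝ) (f : 𝓢(R3, ℝ)) : helm c f = helm (c - μ) f + μ • f := by
  rw [helm_apply, helm_apply, sub_smul]
  abel

/-- `1 - μ (c - Δ)⁻¹` is invertible on `X k` for `μ < c`, with inverse `1 + μ (c - μ - Δ)⁻¹`. -/
theorem isUnit_one_sub_smul_res {c μ : ℝ} (hc : 0 < c) (hμ : μ < c) (k : ℕ) :
    IsUnit (1 - μ • lift k k (res c) : X k →L[ℝ] X k) := by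
  have hc' : 0 < c - μ := by linarith
  refine ⟨⟨1 - μ • lift k k (res c), 1 + μ • lift k k (res (c - μ)), ?_, ?_⟩, rfl⟩
  · ext1 u
    refine ext_of_ι (ContinuousLinearMap.continuous _) (ContinuousLinearMap.continuous _)
      (fun f => ?_) u
    have key : f + μ • res (c - μ) f = helm c (res (c - μ) f) := by
      rw [helm_sub c μ, helm_res hc']
    have h1 : f + μ • res (c - μ) f - μ • res c (f + μ • res (c - μ) f) = f := by
      rw [key, res_helm hc, ← key, add_sub_cancel_right]
    have h2 := congrArg (ι k) h1
    simp only [map_sub, map_add, map_smul] at h2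
    refine Eq.trans ?_ h2
    simp only [mul_apply_eq_comp, add_apply, sub_apply, smul_apply, one_apply_eq_self,
      lift_res_ι hc', lift_res_ι hc, map_add, map_smul]
    module
  · ext1 u
    refine ext_of_ι (ContinuousLinearMap.continuous _) (ContinuousLinearMap.continuous _)
      (fun f => ?_) u
    have key : f - μ • res c f = helm (c - μ) (res c f) := by
      have := helm_sub c μ (res c f)
      rw [helm_res hc] at this
      exact sub_eq_of_eq_add this
    have h1 : f - μ • res c f + μ • res (c - μ) (f - μ • res c f) = f := by
      rw [key, res_helm hc', ← key, sub_add_cancel]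
    have h2 := congrArg (ι k) h1
    simp only [map_sub, map_add, map_smul] at h2
    refine Eq.trans ?_ h2
    simp only [mul_apply_eq_comp, add_apply, sub_apply, smul_apply, one_apply_eq_self,
      lift_res_ι hc', lift_res_ι hc, map_sub, map_smul]
    module

/-! ### Regularity of branches of solutions -/

/-- A smooth branch in `X 4` of solutions of `(c - μ(s) - Δ + V) Q + s Q³ = 0`, written with the
resolvent `(c - Δ)⁻¹`, consists of Schwartz functions and is smooth for every norm of the scale. -/
theorem exists_smooth_schwartz_branch {c : ℝ} (hc : 0 < c) (V : 𝓢(R3, ℝ)) {I : Set ℝ}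
    (μ : ℝ → ℝ) (hμ : ContDiffOn ℝ ∞ μ I) (hμc : ∀ s ∈ I, μ s < c)
    (C : ∀ k, X k → X (k + 1)) (hC : ∀ k, 4 ≤ k → ContDiff ℝ ω (C k) ∧
      ∀ f, C k (ι k f) = ι (k + 1) (res c (cube f)))
    (P : ℝ → X 4) (hP : ContDiffOn ℝ ∞ P I)
    (heq : ∀ s ∈ I, P s - μ s • lift 4 4 (res c) (P s) =
      incl 4 (-(lift 4 5 (res c ∘ₗ mulS V) (P s) + s • C 4 (P s)))) :
    ∃ Q : ℝ → 𝓢(R3, ℝ), (∀ s ∈ I, ι 4 (Q s) = P s) ∧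
      ∀ k, ContDiffOn ℝ ∞ (fun s => ι k (Q s)) I := by
  let T : ∀ k, ℝ → X k → X (k + 1) := fun k s u =>
    -(lift k (k + 1) (res c ∘ₗ mulS V) u + s • C k u)
  let good : ∀ k, (ℝ → X k) → Prop := fun k Q => ContDiffOn ℝ ∞ Q I ∧
    ∀ s ∈ I, Q s - μ s • lift k k (res c) (Q s) = incl k (T k s (Q s))
  have hT : ∀ k, 4 ≤ k → ∀ s u, incl (k + 1) (T (k + 1) s u) = T k s (incl k u) := by
    intro k hk s u
    have c1 := (hC k hk).1.continuous
    have c2 := (hC (k + 1) (by omega)).1.continuous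
    refine ext_of_ι (S := fun u => incl (k + 1) (T (k + 1) s u)) (T := fun u => T k s (incl k u))
      (by fun_prop) (by fun_prop) (fun f => ?_) u
    simp only [T, incl_ι, (hC k hk).2, (hC (k + 1) (by omega)).2, lift_res_mulS_ι hc, map_neg,
      map_add, map_smul]
  have hR : ∀ k (u : X (k + 1)), incl k (lift (k + 1) (k + 1) (res c) u) =
      lift k k (res c) (incl k u) := fun k u => by
    refine ext_of_ι (S := fun u => incl k (lift (k + 1) (k + 1) (res c) u))
      (T := fun u => lift k k (res c) (incl k u)) (by fun_prop) (by fun_prop) (fun f => ?_) u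
    rw [lift_res_ι hc, incl_ι, incl_ι, lift_res_ι hc]
  -- Solve for the linear part in `X (k + 1)`; by uniqueness in `X k` this only improves `Q`.
  have step : ∀ k, 4 ≤ k → ∀ Q, good k Q →
      ∃ Q', good (k + 1) Q' ∧ ∀ s ∈ I, incl k (Q' s) = Q s := by
    rintro k hk Q ⟨hQ1, hQ2⟩
    let A : ℝ → X (k + 1) →L[ℝ] X (k + 1) := fun s => 1 - μ s • lift (k + 1) (k + 1) (res c)
    have hA : ∀ s ∈ I, IsUnit (A s) := fun s hs => isUnit_one_sub_smul_res hc (hμc s hs) _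
    have hinv : ∀ s ∈ I, ∀ w, A s (Ring.inverse (A s) w) = w := fun s hs w => by
      rw [← mul_apply_eq_comp, Ring.mul_inverse_cancel _ (hA s hs)]; rfl
    have hcompat : ∀ s ∈ I, incl k (Ring.inverse (A s) (T k s (Q s))) = Q s := by
      intro s hs
      have h1 := congrArg (incl k) (hinv s hs (T k s (Q s)))
      simp only [A, sub_apply, smul_apply, one_apply_eq_self, map_sub, map_smul, hR] at h1
      rw [← hQ2 s hs] at h1
      obtain ⟨b, hb⟩ := isUnit_one_sub_smul_res hc (hμc s hs) k
      have h2 : ∀ w, w - μ s • lift k k (res c) w = (b : X k →L[ℝ] X k) w := fun w => by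
        rw [hb]; rfl
      rw [h2, h2] at h1
      have h3 : ∀ w, (↑b⁻¹ : X k →L[ℝ] X k) ((b : X k →L[ℝ] X k) w) = w := fun w => by
        rw [← mul_apply_eq_comp, Units.inv_mul]; rfl
      have h4 := congrArg (↑b⁻¹ : X k →L[ℝ] X k) h1
      rwa [h3, h3] at h4
    refine ⟨fun s => Ring.inverse (A s) (T k s (Q s)), ⟨?_, fun s hs => ?_⟩, hcompat⟩
    · refine ContDiffOn.clm_apply ?_ ?_
      · have h1 : ContDiffOn ℝ ∞ A I := contDiffOn_const.sub (hμ.smul contDiffOn_const)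
        intro s hs
        obtain ⟨b, hb⟩ := hA s hs
        have h2 : ContDiffAt ℝ ∞ Ring.inverse (A s) := by
          rw [← hb]; exact contDiffAt_ringInverse ℝ b
        exact h2.comp_contDiffWithinAt s (h1 s hs)
      · have h1 : ContDiff ℝ ∞ (C k) := (hC k hk).1.of_le le_top
        exact (((lift k (k + 1) (res c ∘ₗ mulS V)).contDiff.comp_contDiffOn hQ1).add
          (contDiffOn_id.smul (h1.comp_contDiffOn hQ1))).neg
    · rw [hT k hk, hcompat s hs]
      exact hinv s hs _
  let U : ∀ m, {Q : ℝ → X (4 + m) // good (4 + m) Q} := fun m =>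
    Nat.rec (motive := fun m => {Q : ℝ → X (4 + m) // good (4 + m) Q}) ⟨P, hP, heq⟩
      (fun m q => ⟨(step (4 + m) (by omega) q.1 q.2).choose,
        (step (4 + m) (by omega) q.1 q.2).choose_spec.1⟩) m
  have hU0 : (U 0).1 = P := rfl
  have hU : ∀ m, ∀ s ∈ I, incl (4 + m) ((U (m + 1)).1 s) = (U m).1 s := fun m =>
    (step (4 + m) (by omega) (U m).1 (U m).2).choose_spec.2
  -- The branch lives in `X (4 + m)` for all `m`; move it down to obtain a compatible family.
  let down : ∀ m, X (4 + m) →L[ℝ] X m := fun m => lift (4 + m) m LinearMap.id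
  have hdown : ∀ m f, down m (ι (4 + m) f) = ι m f := fun m f => lift_id_ι (by omega) f
  have hex : ∀ s, ∃ f : 𝓢(R3, ℝ), s ∈ I → ∀ k, ι k f = down k ((U k).1 s) := by
    intro s
    by_cases hs : s ∈ I
    · obtain ⟨f, hf⟩ := exists_schwartz_of_compatible (fun k => down k ((U k).1 s)) (fun k => by
        rw [← hU k s hs]
        refine ext_of_ι (k := 4 + k + 1) (S := fun u => incl k (down (k + 1) u))
          (T := fun u => down k (incl (4 + k) u)) (by fun_prop) (by fun_prop) (fun f => ?_) _
        rw [incl_ι, hdown]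
        exact (congrArg (incl k) (hdown (k + 1) f)).trans (incl_ι k f))
      exact ⟨f, fun _ => hf⟩
    · exact ⟨0, fun h => absurd h hs⟩
  obtain ⟨Q, hQ⟩ := Classical.skolem.1 hex
  refine ⟨Q, fun s hs => ?_, fun k => ?_⟩
  · rw [hQ s hs 4]
    have h : ∀ j, lift (4 + j) 4 LinearMap.id ((U j).1 s) = P s := by
      intro j
      induction j with
      | zero =>
        rw [hU0]
        refine ext_of_ι (k := 4) (S := lift 4 4 LinearMap.id) (T := fun u => u) (by fun_prop)
          continuous_id (fun f => ?_) _
        exact lift_id_ι le_rfl f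
      | succ j ih =>
        rw [← ih, ← hU j s hs]
        refine ext_of_ι (k := 4 + j + 1) (S := fun u => lift (4 + j + 1) 4 LinearMap.id u)
          (T := fun u => lift (4 + j) 4 LinearMap.id (incl (4 + j) u)) (by fun_prop) (by fun_prop)
          (fun f => ?_) _
        rw [incl_ι, lift_id_ι (by omega), lift_id_ι (by omega)]
    exact h 4
  · exact ((down k).contDiff.comp_contDiffOn (U k).2.1).congr fun s hs => hQ s hs k

/-! ### The branch of bound states -/

/-- `G` inverts the operator `c - Δ + V + ⟨φ, ·⟩ φ` on Schwartz functions, boundedly for all norms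
of the scale, where `φ` is a normalized solution of `(c - Δ + V) φ = 0`. -/
structure IsBorderedGreen (c : ℝ) (V φ : 𝓢(R3, ℝ)) (G : 𝓢(R3, ℝ) →ₗ[ℝ] 𝓢(R3, ℝ)) : Prop where
  pos : 0 < c
  eigen : helm c φ + mulS V φ = 0
  norm_one : ‖toL2 φ‖ = 1
  right_inv : ∀ f, helm c (G f) + pert V φ (G f) = f
  injective : ∀ u, helm c u + pert V φ u = 0 → u = 0
  bound : ∀ k, ∃ C : ℝ, 0 ≤ C ∧ ∀ f, N k (G f) ≤ C * N k f

/-- The cube of `f`, corrected by the multiple of `f` which makes it orthogonal to `φ` when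
`⟨φ, f⟩ = 1`. -/
def nonlin (φ f : 𝓢(R3, ℝ)) : 𝓢(R3, ℝ) := cube f - pair φ (cube f) • f

namespace IsBorderedGreen

variable {c : ℝ} {V φ : 𝓢(R3, ℝ)} {G : 𝓢(R3, ℝ) →ₗ[ℝ] 𝓢(R3, ℝ)}

theorem pair_self (h : IsBorderedGreen c V φ G) : pair φ φ = 1 := by
  rw [pair_apply, real_inner_self_eq_norm_sq, h.norm_one]; norm_num

theorem pair_helm_add_mulS (h : IsBorderedGreen c V φ G) (u : 𝓢(R3, ℝ)) :
    pair φ (helm c u + mulS V u) = 0 := by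
  rw [pair_apply, map_add, inner_add_right, inner_helm, inner_mulS, ← inner_add_left, ← map_add,
    h.eigen, map_zero, inner_zero_left]

theorem pair_green (h : IsBorderedGreen c V φ G) (f : 𝓢(R3, ℝ)) : pair φ (G f) = pair φ f := by
  have h1 := congrArg (pair φ) (h.right_inv f)
  rw [pert_apply, ← add_assoc, map_add, h.pair_helm_add_mulS, map_smul, h.pair_self] at h1
  simpa using h1

theorem left_inv (h : IsBorderedGreen c V φ G) (u : 𝓢(R3, ℝ)) :
    G (helm c u + pert V φ u) = u := by
  rw [← sub_eq_zero]
  apply h.injective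
  rw [map_sub, map_sub]
  have h1 := h.right_inv (helm c u + pert V φ u)
  rw [← sub_eq_zero] at h1
  rw [← h1]
  abel

theorem lift_ι (h : IsBorderedGreen c V φ G) (k : ℕ) (f : 𝓢(R3, ℝ)) :
    lift k k G (ι k f) = ι k (G f) := by
  obtain ⟨C, -, hC⟩ := h.bound k
  exact NLSBoundState.lift_ι ⟨C, hC⟩ f

theorem exists_nonlin_extend (h : IsBorderedGreen c V φ G) {k : ℕ} (hk : 4 ≤ k) :
    ∃ F : X k → X k, ContDiff ℝ ω F ∧ ∀ f, F (ι k f) = ι k (G (nonlin φ f)) := by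
  obtain ⟨M, hM, hMι⟩ := exists_cube_extend hk
  obtain ⟨l, hl⟩ := exists_pair_extend φ k
  refine ⟨fun u => lift k k G (M u - l (M u) • u), ?_, fun f => ?_⟩
  · exact (lift k k G).contDiff.comp (hM.sub ((l.contDiff.comp hM).smul contDiff_id))
  · simp only [hMι, hl, ← map_smul, ← map_sub, h.lift_ι, nonlin]

theorem green_add_res (h : IsBorderedGreen c V φ G) (f : 𝓢(R3, ℝ)) :
    G f + res c (mulS V (G f)) + pair φ (G f) • res c φ = res c f := by
  have h1 := congrArg (res c) (h.right_inv f)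
  rw [pert_apply, map_add, res_helm h.pos, map_add, map_smul, ← add_assoc] at h1
  exact h1

/-- The implicit function theorem gives a branch of real solutions of
`Q = φ - s G(Q³ - ⟨φ, Q³⟩ Q)`, normalized by `⟨φ, Q⟩ = 1`, smooth for every norm of the scale. -/
theorem exists_branch (h : IsBorderedGreen c V φ G) :
    ∃ b : ℝ, 0 < b ∧ ∃ Q : ℝ → 𝓢(R3, ℝ),
      (∀ s ∈ Set.Ioo (-b) b, Q s = φ - s • G (nonlin φ (Q s)) ∧ pair φ (Q s) = 1) ∧
      ∀ k, ContDiffOn ℝ ∞ (fun s => ι k (Q s)) (Set.Ioo (-b) b) := by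
  have hex : ∀ k, ∃ M : X k → X (k + 1), 4 ≤ k → ContDiff ℝ ω M ∧
      ∀ f, M (ι k f) = ι (k + 1) (res c (cube f)) := fun k => by
    by_cases hk : 4 ≤ k
    · obtain ⟨M, hM⟩ := exists_resCube_extend h.pos hk
      exact ⟨M, fun _ => hM⟩
    · exact ⟨fun _ => 0, fun h => absurd h hk⟩
  obtain ⟨C, hC⟩ := Classical.skolem.1 hex
  obtain ⟨M, hM, hMι⟩ := exists_cube_extend (le_refl 4)
  obtain ⟨l, hl⟩ := exists_pair_extend φ 4
  obtain ⟨F, hF, hFι⟩ := h.exists_nonlin_extend (le_refl 4)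
  have hC4 := (hC 4 le_rfl).1.continuous
  have hFc := hF.continuous
  have hMc := hM.continuous
  -- Identities for Schwartz functions pass to `X 4` by density.
  have hlF : ∀ u, l (F u) = l (M u) - l (M u) * l u := fun u => by
    refine ext_of_ι (S := fun u => l (F u)) (T := fun u => l (M u) - l (M u) * l u)
      (by fun_prop) (by fun_prop) (fun f => ?_) u
    simp only [hFι, hl, hMι, h.pair_green, nonlin, map_sub, map_smul, smul_eq_mul]
  have hRF : ∀ u, F u + incl 4 (lift 4 5 (res c ∘ₗ mulS V) (F u)) + l (F u) • ι 4 (res c φ) =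
      incl 4 (C 4 u) - l (M u) • lift 4 4 (res c) u := fun u => by
    refine ext_of_ι
      (S := fun u => F u + incl 4 (lift 4 5 (res c ∘ₗ mulS V) (F u)) + l (F u) • ι 4 (res c φ))
      (T := fun u => incl 4 (C 4 u) - l (M u) • lift 4 4 (res c) u)
      (by fun_prop) (by fun_prop) (fun f => ?_) u
    simp only [hFι, hl, hMι, lift_res_mulS_ι h.pos, lift_res_ι h.pos, (hC 4 le_rfl).2, incl_ι]
    have h1 := congrArg (ι 4) (h.green_add_res (nonlin φ f))
    simp only [map_add, map_smul] at h1
    rw [h1, nonlin, map_sub, map_smul, map_sub, map_smul]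
  have hRφ : ι 4 φ + incl 4 (lift 4 5 (res c ∘ₗ mulS V) (ι 4 φ)) = 0 := by
    have h1 := congrArg (res c) h.eigen
    rw [map_add, res_helm h.pos, map_zero] at h1
    rw [lift_res_mulS_ι h.pos, incl_ι, ← map_add, h1, map_zero]
  -- At `s = 0` the derivative of `Q ↦ Q + s F(Q)` is the identity.
  let Φ : ℝ × X 4 → X 4 := fun p => p.2 + p.1 • F p.2
  have hΦ : ContDiff ℝ ω Φ := contDiff_snd.add (contDiff_fst.smul (hF.comp contDiff_snd))
  have hΦ0 : ContDiffAt ℝ ω Φ (0, ι 4 φ) := hΦ.contDiffAt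
  have hinv : (fderiv ℝ Φ (0, ι 4 φ) ∘L .inr ℝ ℝ (X 4)).IsInvertible := by
    have h1 : HasFDerivAt (fun v : X 4 => Φ (0, v))
        (fderiv ℝ Φ (0, ι 4 φ) ∘L .inr ℝ ℝ (X 4)) (ι 4 φ) :=
      ((hΦ.differentiable (by simp)) (0, ι 4 φ)).hasFDerivAt.comp (ι 4 φ)
        (hasFDerivAt_prodMk_right 0 (ι 4 φ))
    have h2 : HasFDerivAt (fun v : X 4 => Φ (0, v)) (ContinuousLinearMap.id ℝ (X 4)) (ι 4 φ) := by
      have : (fun v : X 4 => Φ (0, v)) = id := by ext1 v; simp [Φ]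
      rw [this]; exact hasFDerivAt_id _
    rw [h1.unique h2]
    exact ⟨ContinuousLinearEquiv.refl ℝ (X 4), rfl⟩
  let ψ : ℝ → X 4 := hΦ0.implicitFunction (by simp) hinv
  have hψ0 : ψ 0 = ι 4 φ := hΦ0.implicitFunction_apply_self (by simp) hinv
  have hψ1 : ∀ᶠ s in nhds (0 : ℝ), Φ (s, ψ s) = Φ (0, ι 4 φ) :=
    hΦ0.eventually_apply_implicitFunction (by simp) hinv
  have hψ : ContDiffAt ℝ ω ψ 0 := hΦ0.contDiffAt_implicitFunction (by simp) hinv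
  have hψ2 := hψ.eventually (by simp)
  -- `μ < c` keeps the energy negative, and `μ < 1` is needed for `⟨φ, Q⟩ = 1`.
  let μ : ℝ → ℝ := fun s => s * l (M (ψ s))
  have hμ : ContinuousAt μ 0 := by
    have := hψ.continuousAt
    have : ContinuousAt (fun s => l (M (ψ s))) 0 :=
      (l.continuous.comp hMc).continuousAt.comp this
    exact continuousAt_id.mul this
  have hμ0 : μ 0 = 0 := zero_mul _
  have hμ1 : ∀ᶠ s in nhds (0 : ℝ), μ s < min c 1 :=
    hμ.eventually_lt continuousAt_const (by rw [hμ0]; exact lt_min h.pos one_pos)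
  obtain ⟨b, hb, hball⟩ := Metric.eventually_nhds_iff_ball.1 (hψ1.and (hψ2.and hμ1))
  rw [Real.ball_eq_Ioo, zero_sub, zero_add] at hball
  have hψs : ContDiffOn ℝ ∞ ψ (Set.Ioo (-b) b) := fun s hs =>
    ((hball s hs).2.1.of_le le_top).contDiffWithinAt
  have hsol : ∀ s ∈ Set.Ioo (-b) b, ψ s + s • F (ψ s) = ι 4 φ := fun s hs => by
    have h1 := (hball s hs).1
    simpa [Φ] using h1
  -- Pairing the equation with `φ` gives `(⟨φ, Q⟩ - 1) (1 - μ) = 0`.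
  have hlψ : ∀ s ∈ Set.Ioo (-b) b, l (ψ s) = 1 := fun s hs => by
    have h1 := congrArg l (hsol s hs)
    rw [map_add, map_smul, hlF, hl, h.pair_self, smul_eq_mul] at h1
    have h2 : μ s < 1 := (hball s hs).2.2.trans_le (min_le_right _ _)
    have h3 : (l (ψ s) - 1) * (1 - μ s) = 0 := by
      simp only [μ]; linear_combination h1
    rcases mul_eq_zero.1 h3 with h4 | h4 <;> linarith
  obtain ⟨Q, hQ, hQs⟩ := exists_smooth_schwartz_branch h.pos V (I := Set.Ioo (-b) b) μ
    (contDiffOn_id.mul ((l.contDiff.comp (hM.of_le le_top)).comp_contDiffOn hψs))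
    (fun s hs => (hball s hs).2.2.trans_le (min_le_left _ _)) C hC ψ hψs (fun s hs => by
      have h1 := hRF (ψ s)
      rw [hlF, hlψ s hs, mul_one, sub_self, zero_smul, add_zero] at h1
      have h2 : ψ s = ι 4 φ - s • F (ψ s) := eq_sub_of_add_eq (hsol s hs)
      have h3 : ψ s + incl 4 (lift 4 5 (res c ∘ₗ mulS V) (ψ s)) =
          -(s • (incl 4 (C 4 (ψ s)) - l (M (ψ s)) • lift 4 4 (res c) (ψ s))) := by
        rw [← h1]
        conv_lhs => rw [h2]
        rw [map_sub, map_sub, map_smul, map_smul]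
        linear_combination (norm := module) (1 : ℝ) • hRφ
      rw [map_neg, map_add, map_smul]
      simp only [μ]
      rw [mul_smul]
      linear_combination (norm := module) (1 : ℝ) • h3)
  refine ⟨b, hb, Q, fun s hs => ⟨?_, ?_⟩, hQs⟩
  · apply ι_injective 4
    rw [map_sub, map_smul, ← hFι, hQ s hs]
    exact eq_sub_of_add_eq (hsol s hs)
  · rw [← hl, hQ s hs, hlψ s hs]

end IsBorderedGreen

/-! ### Comparison with the weighted Sobolev spaces -/

section SigmaSpace

variable {𝕜 𝕜' : Type} [RCLike 𝕜] [RCLike 𝕜']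

instance (r : ℕ) : CompleteSpace (SigmaSpace 𝕜 r) :=
  (Submodule.isClosed_topologicalClosure (LinearMap.range (sigmaEmbed 𝕜 r))).completeSpace_coe

theorem toSigma_add (r : ℕ) (u v : 𝓢(R3, 𝕜)) :
    toSigma 𝕜 r (u + v) = toSigma 𝕜 r u + toSigma 𝕜 r v :=
  Subtype.ext (map_add (sigmaEmbed 𝕜 r) u v)

theorem toSigma_smul (r : ℕ) (a : 𝕜) (u : 𝓢(R3, 𝕜)) :
    toSigma 𝕜 r (a • u) = a • toSigma 𝕜 r u :=
  Subtype.ext (map_smul (sigmaEmbed 𝕜 r) a u)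

theorem norm_multiDeriv_le_norm_toSigma {r : ℕ} (α : MultiIndex r) (u : 𝓢(R3, 𝕜)) :
    ‖(multiDeriv 𝕜 (fun k => (α.1 k : ℕ)) u).toLp 2 (volume : Measure R3)‖ ≤ ‖toSigma 𝕜 r u‖ :=
  PiLp.norm_apply_le (sigmaEmbed 𝕜 r u) (Sum.inr α)

theorem norm_toLp_le_norm_toSigma (r : ℕ) (u : 𝓢(R3, 𝕜)) :
    ‖u.toLp 2 (volume : Measure R3)‖ ≤ ‖toSigma 𝕜 r u‖ := by
  have h := norm_multiDeriv_le_norm_toSigma (⟨fun _ => 0, by simp⟩ : MultiIndex r) u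
  simpa [multiDeriv] using h

theorem norm_toSigma_smul (r : ℕ) (a : 𝕜) (u : 𝓢(R3, 𝕜)) :
    ‖toSigma 𝕜 r (a • u)‖ = ‖a‖ * ‖toSigma 𝕜 r u‖ := by
  rw [toSigma_smul, norm_smul]

theorem mulMonomial_postcomp (L : 𝕜 →L[ℝ] 𝕜') (α : Fin 3 → ℕ) (f : 𝓢(R3, 𝕜)) :
    mulMonomial 𝕜' α (SchwartzMap.postcompCLM L f) =
      SchwartzMap.postcompCLM L (mulMonomial 𝕜 α f) := by
  ext x
  rw [mulMonomial_apply]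
  change _ = L (mulMonomial 𝕜 α f x)
  rw [mulMonomial_apply, ← RCLike.real_smul_eq_coe_mul, ← RCLike.real_smul_eq_coe_mul, map_smul]
  rfl

theorem pow_partialDeriv_postcomp (L : 𝕜 →L[ℝ] 𝕜') (j : Fin 3) (n : ℕ) (f : 𝓢(R3, 𝕜)) :
    (partialDeriv 𝕜' j ^ n) (SchwartzMap.postcompCLM L f) =
      SchwartzMap.postcompCLM L ((partialDeriv 𝕜 j ^ n) f) := by
  induction n with
  | zero => rfl
  | succ n ih => rw [pow_succ', pow_succ', mul_apply_eq_comp, mul_apply_eq_comp, ih,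
      postcomp_partialDeriv]

theorem multiDeriv_postcomp (L : 𝕜 →L[ℝ] 𝕜') (α : Fin 3 → ℕ) (f : 𝓢(R3, 𝕜)) :
    multiDeriv 𝕜' α (SchwartzMap.postcompCLM L f) =
      SchwartzMap.postcompCLM L (multiDeriv 𝕜 α f) := by
  simp only [multiDeriv, mul_apply_eq_comp, pow_partialDeriv_postcomp]

theorem norm_toLp_postcomp_le (L : 𝕜 →L[ℝ] 𝕜') (hL : ∀ y, ‖L y‖ ≤ ‖y‖) (f : 𝓢(R3, 𝕜)) :
    ‖(SchwartzMap.postcompCLM L f).toLp 2 (volume : Measure R3)‖ ≤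
      ‖f.toLp 2 (volume : Measure R3)‖ := by
  refine Lp.norm_le_norm_of_ae_le ?_
  filter_upwards [f.coeFn_toLp 2 volume, (SchwartzMap.postcompCLM L f).coeFn_toLp 2 volume]
    with x h1 h2
  rw [h1, h2]
  exact hL _

/-- Composition with a contractive real-linear map of the scalars is a contraction of `Σ_r`. -/
theorem norm_toSigma_postcomp_le (L : 𝕜 →L[ℝ] 𝕜') (hL : ∀ y, ‖L y‖ ≤ ‖y‖) (r : ℕ)
    (f : 𝓢(R3, 𝕜)) : ‖toSigma 𝕜' r (SchwartzMap.postcompCLM L f)‖ ≤ ‖toSigma 𝕜 r f‖ := by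
  rw [← pow_le_pow_iff_left₀ (norm_nonneg _) (norm_nonneg _) two_ne_zero, norm_toSigma_sq,
    norm_toSigma_sq]
  refine Finset.sum_le_sum fun α _ => ?_
  rw [mulMonomial_postcomp, multiDeriv_postcomp]
  exact add_le_add (pow_le_pow_left₀ (norm_nonneg _) (norm_toLp_postcomp_le L hL _) 2)
    (pow_le_pow_left₀ (norm_nonneg _) (norm_toLp_postcomp_le L hL _) 2)

end SigmaSpace

theorem norm_toSigma_reS_le (r : ℕ) (f : 𝓢(R3, ℂ)) : ‖toSigma ℝ r (reS f)‖ ≤ ‖toSigma ℂ r f‖ :=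
  norm_toSigma_postcomp_le Complex.reCLM (fun y => Complex.abs_re_le_norm y) r f

theorem norm_toSigma_imS_le (r : ℕ) (f : 𝓢(R3, ℂ)) : ‖toSigma ℝ r (imS f)‖ ≤ ‖toSigma ℂ r f‖ :=
  norm_toSigma_postcomp_le Complex.imCLM (fun y => Complex.abs_im_le_norm y) r f

theorem norm_toSigma_ofRealS_le (r : ℕ) (f : 𝓢(R3, ℝ)) :
    ‖toSigma ℂ r (ofRealS f)‖ ≤ ‖toSigma ℝ r f‖ :=
  norm_toSigma_postcomp_le Complex.ofRealCLM (fun y => by simp) r f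

theorem N_pow_le {T : 𝓢(R3, ℝ) →L[ℝ] 𝓢(R3, ℝ)} (hT : ∀ k f, N k (T f) ≤ N (k + 1) f)
    (n k : ℕ) (f : 𝓢(R3, ℝ)) : N k ((T ^ n) f) ≤ N (k + n) f := by
  induction n generalizing k with
  | zero => rfl
  | succ n ih =>
    rw [pow_succ', mul_apply_eq_comp]
    exact (hT _ _).trans ((ih (k + 1)).trans_eq (by ring_nf))

theorem norm_toL2_multi_le {T : Fin 3 → 𝓢(R3, ℝ) →L[ℝ] 𝓢(R3, ℝ)}
    (hT : ∀ j k f, N k (T j f) ≤ N (k + 1) f) {α : Fin 3 → ℕ} {r : ℕ} (hα : ∑ i, α i ≤ r)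
    (f : 𝓢(R3, ℝ)) : ‖toL2 ((T 0 ^ α 0 * T 1 ^ α 1 * T 2 ^ α 2) f)‖ ≤ N r f := by
  rw [mul_apply_eq_comp, mul_apply_eq_comp, ← N_zero]
  refine (N_pow_le (hT 0) _ _ _).trans ((N_pow_le (hT 1) _ _ _).trans
    ((N_pow_le (hT 2) _ _ _).trans (N_mono ?_ f)))
  rw [Fin.sum_univ_three] at hα
  omega

theorem pow_mulCoord_apply (j : Fin 3) (n : ℕ) (f : 𝓢(R3, ℝ)) (x : R3) :
    (mulCoord j ^ n) f x = x j ^ n * f x := by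
  induction n with
  | zero => simp
  | succ n ih => rw [pow_succ', mul_apply_eq_comp, mulCoord_apply, ih]; ring

theorem mulMonomial_eq (α : Fin 3 → ℕ) :
    mulMonomial ℝ α = mulCoord 0 ^ α 0 * mulCoord 1 ^ α 1 * mulCoord 2 ^ α 2 := by
  ext f x
  rw [mulMonomial_apply, mul_apply_eq_comp, mul_apply_eq_comp, pow_mulCoord_apply,
    pow_mulCoord_apply, pow_mulCoord_apply, Fin.prod_univ_three]
  simp only [RCLike.ofReal_real_eq_id, id]
  ring

theorem exists_norm_toSigma_le (r : ℕ) :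
    ∃ C : ℝ, ∀ f : 𝓢(R3, ℝ), ‖toSigma ℝ r f‖ ≤ C * N r f := by
  refine ⟨√(Fintype.card (MultiIndex r) * 2), fun f => ?_⟩
  have hN := N_nonneg r f
  rw [← pow_le_pow_iff_left₀ (norm_nonneg _) (by positivity) two_ne_zero, norm_toSigma_sq,
    mul_pow, Real.sq_sqrt (by positivity), mul_assoc, ← nsmul_eq_mul]
  refine Finset.sum_le_card_nsmul _ _ _ fun α _ => ?_
  rw [two_mul]
  refine add_le_add (pow_le_pow_left₀ (norm_nonneg _) ?_ 2) (pow_le_pow_left₀ (norm_nonneg _) ?_ 2)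
  · rw [mulMonomial_eq]
    exact norm_toL2_multi_le (fun j k f => N_mulCoord_le k j f) α.2 f
  · exact norm_toL2_multi_le (fun j k f => N_partialDeriv_le k j f) α.2 f

theorem exists_sigma_real_extend (r : ℕ) :
    ∃ T : X r →L[ℝ] SigmaSpace ℝ r, ∀ f, T (ι r f) = toSigma ℝ r f := by
  obtain ⟨C, hC⟩ := exists_norm_toSigma_le r
  let T0 : 𝓢(R3, ℝ) →ₗ[ℝ] SigmaSpace ℝ r :=
    { toFun := toSigma ℝ r, map_add' := toSigma_add r, map_smul' := toSigma_smul r }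
  exact ⟨T0.extendOfNorm (ι r), fun f => LinearMap.extendOfNorm_eq (denseRange_ι r) ⟨C, hC⟩ f⟩

theorem exists_sigma_complex_extend (r : ℕ) :
    ∃ T : X r →L[ℝ] SigmaSpace ℂ r, ∀ f, T (ι r f) = toSigma ℂ r (ofRealS f) := by
  obtain ⟨C, hC⟩ := exists_norm_toSigma_le r
  let T0 : 𝓢(R3, ℝ) →ₗ[ℝ] SigmaSpace ℂ r :=
    { toFun := fun f => toSigma ℂ r (ofRealS f)
      map_add' := fun f g => by rw [map_add, toSigma_add]
      map_smul' := fun a f => by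
        have h : ofRealS (a • f) = (a : ℂ) • ofRealS f := by ext x; simp
        rw [h, toSigma_smul]; rfl }
  exact ⟨T0.extendOfNorm (ι r), fun f => LinearMap.extendOfNorm_eq (denseRange_ι r)
    ⟨C, fun f => (norm_toSigma_ofRealS_le r f).trans (hC f)⟩ f⟩

/-- The norm of `Σ_2` controls the supremum norm in dimension three. -/
theorem exists_sup_le_toSigma :
    ∃ C : ℝ, 0 ≤ C ∧ ∀ (u : 𝓢(R3, ℝ)) (x : R3), |u x| ≤ C * ‖toSigma ℝ 2 u‖ := by
  obtain ⟨C, hC, h⟩ := exists_sup_bound one_pos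
  refine ⟨C * 4, by positivity, fun u x => (h u x).trans ?_⟩
  rw [mul_assoc]
  refine mul_le_mul_of_nonneg_left ?_ hC
  rw [helm_apply, map_sub, one_smul]
  refine (norm_sub_le _ _).trans ?_
  have h0 : ‖toL2 u‖ ≤ ‖toSigma ℝ 2 u‖ := norm_toLp_le_norm_toSigma 2 u
  have h1 : ∀ i : Fin 3, ‖toL2 (partialDeriv ℝ i (partialDeriv ℝ i u))‖ ≤ ‖toSigma ℝ 2 u‖ := by
    intro i
    have hα : ∀ k : Fin 3, (if k = i then 2 else 0) < 2 + 1 := fun k => by split_ifs <;> omega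
    have h2 := norm_multiDeriv_le_norm_toSigma
      (⟨fun k => ⟨if k = i then 2 else 0, hα k⟩, by simp⟩ : MultiIndex 2) u
    refine le_of_eq_of_le ?_ h2
    fin_cases i <;> simp [multiDeriv, toL2_eq, pow_two, mul_apply_eq_comp]
  have h3 : ‖toL2 (lapl u)‖ ≤ 3 * ‖toSigma ℝ 2 u‖ := by
    rw [lapl_eq_sum, map_sum]
    refine (norm_sum_le _ _).trans ?_
    exact (Finset.sum_le_card_nsmul _ _ _ fun i _ => h1 i).trans (by simp)
  linarith

/-! ### Local uniqueness of bound states -/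

/-- The real part `(a² + b²) a` of the cubic nonlinearity at `a + i b`; its imaginary part is
obtained by exchanging `a` and `b`. -/
def cubicRe (a b : 𝓢(R3, ℝ)) : 𝓢(R3, ℝ) := mulS (mulS a a + mulS b b) a

theorem cubicRe_apply (a b : 𝓢(R3, ℝ)) (x : R3) :
    cubicRe a b x = (a x ^ 2 + b x ^ 2) * a x := by
  simp [cubicRe]; ring

theorem norm_cubicRe_le {a b : 𝓢(R3, ℝ)} {K : ℝ} (ha : ∀ x, |a x| ≤ K) (hb : ∀ x, |b x| ≤ K) :
    ‖toL2 (cubicRe a b)‖ ≤ 2 * K ^ 2 * ‖toL2 a‖ := by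
  refine norm_toL2_mulS_le fun x => ?_
  have h1 := sq_le_sq' (neg_le_of_abs_le (ha x)) (le_of_abs_le (ha x))
  have h2 := sq_le_sq' (neg_le_of_abs_le (hb x)) (le_of_abs_le (hb x))
  simp only [add_apply, mulS_apply]
  rw [abs_le]
  constructor <;> nlinarith [sq_nonneg (a x), sq_nonneg (b x)]

theorem norm_cubicRe_sub_le {a b a' b' : 𝓢(R3, ℝ)} {K : ℝ} (ha : ∀ x, |a x| ≤ K)
    (hb : ∀ x, |b x| ≤ K) (ha' : ∀ x, |a' x| ≤ K) (hb' : ∀ x, |b' x| ≤ K) :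
    ‖toL2 (cubicRe a b - cubicRe a' b')‖ ≤
      4 * K ^ 2 * ‖toL2 (a - a')‖ + 2 * K ^ 2 * ‖toL2 (b - b')‖ := by
  have e : cubicRe a b - cubicRe a' b' =
      mulS (mulS a a + mulS a a' + mulS a' a' + mulS b b) (a - a') +
        mulS (mulS a' (b + b')) (b - b') := by
    ext x
    simp only [cubicRe_apply, add_apply, sub_apply, mulS_apply]
    ring
  have hm : ∀ {f g : 𝓢(R3, ℝ)}, (∀ x, |f x| ≤ K) → (∀ x, |g x| ≤ K) →
      ∀ x, |f x * g x| ≤ K ^ 2 := fun hf hg x => by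
    rw [abs_mul, sq]
    exact mul_le_mul (hf x) (hg x) (abs_nonneg _) ((abs_nonneg _).trans (hf x))
  rw [e, map_add]
  refine (norm_add_le _ _).trans (add_le_add ?_ ?_)
  · refine norm_toL2_mulS_le fun x => ?_
    simp only [add_apply, mulS_apply]
    have h1 := abs_le.1 (hm ha ha x)
    have h2 := abs_le.1 (hm ha ha' x)
    have h3 := abs_le.1 (hm ha' ha' x)
    have h4 := abs_le.1 (hm hb hb x)
    rw [abs_le]
    constructor <;> linarith [h1.1, h1.2, h2.1, h2.2, h3.1, h3.2, h4.1, h4.2]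
  · refine norm_toL2_mulS_le fun x => ?_
    simp only [add_apply, mulS_apply, mul_add]
    have h1 := abs_le.1 (hm ha' hb x)
    have h2 := abs_le.1 (hm ha' hb' x)
    rw [abs_le]
    constructor <;> linarith [h1.1, h1.2, h2.1, h2.2]

/-- The real and imaginary parts `a`, `b` of a rescaled bound state `Q / z`, where `s = |z|²` and
`ν` is the shift of the energy, together with bounds on their size. -/
structure IsRescaledBoundState (c : ℝ) (V φ : 𝓢(R3, ℝ)) (K A s : ℝ) (a b : 𝓢(R3, ℝ)) (ν : ℝ) :
    Prop where
  equation_re : helm c a + mulS V a + s • cubicRe a b = ν • a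
  equation_im : helm c b + mulS V b + s • cubicRe b a = ν • b
  pair_re : pair φ a = 1
  pair_im : pair φ b = 0
  sup_re : ∀ x, |a x| ≤ K
  sup_im : ∀ x, |b x| ≤ K
  norm_re : ‖toL2 a‖ ≤ A
  norm_im : ‖toL2 b‖ ≤ A

namespace IsBorderedGreen

variable {c : ℝ} {V φ : 𝓢(R3, ℝ)} {G : 𝓢(R3, ℝ) →ₗ[ℝ] 𝓢(R3, ℝ)}

/-- The `L²` bound on `G` applied to the difference of two solutions. -/
theorem norm_sub_le_of_equation (h : IsBorderedGreen c V φ G) {C : ℝ} (hC : 0 ≤ C)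
    (hG : ∀ f, N 0 (G f) ≤ C * N 0 f) {w w' n n' : 𝓢(R3, ℝ)} {s ν ν' : ℝ} (hs : 0 ≤ s)
    (hw : helm c w + mulS V w + s • n = ν • w) (hw' : helm c w' + mulS V w' + s • n' = ν' • w')
    (hp : pair φ w = pair φ w') :
    ‖toL2 (w - w')‖ ≤
      C * (|ν| * ‖toL2 (w - w')‖ + |ν - ν'| * ‖toL2 w'‖ + s * ‖toL2 (n - n')‖) := by
  have e : helm c (w - w') + pert V φ (w - w') =
      ν • (w - w') + (ν - ν') • w' - s • (n - n') := by
    rw [pert_apply, map_sub (pair φ), hp, sub_self, zero_smul, add_zero, map_sub, map_sub]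
    linear_combination (norm := module) (1 : ℝ) • hw - (1 : ℝ) • hw'
  have h1 := hG (helm c (w - w') + pert V φ (w - w'))
  rw [h.left_inv, N_zero, N_zero, e] at h1
  refine h1.trans (mul_le_mul_of_nonneg_left ?_ hC)
  rw [map_sub toL2 _ (s • (n - n')), map_add, map_smul, map_smul, map_smul]
  refine (norm_sub_le _ _).trans (add_le_add ((norm_add_le _ _).trans (add_le_add ?_ ?_)) ?_)
  · rw [norm_smul, Real.norm_eq_abs]
  · rw [norm_smul, Real.norm_eq_abs]
  · rw [norm_smul, Real.norm_eq_abs, abs_of_nonneg hs]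

theorem energy_eq (h : IsBorderedGreen c V φ G) {K A s ν : ℝ} {a b : 𝓢(R3, ℝ)}
    (hab : IsRescaledBoundState c V φ K A s a b ν) : ν = s * pair φ (cubicRe a b) := by
  have h1 := congrArg (pair φ) hab.equation_re
  rw [map_add, h.pair_helm_add_mulS, map_smul, map_smul, hab.pair_re] at h1
  simpa using h1.symm

/-- For small `s` the rescaled equation is a contraction in `L²` on sets bounded in the supremum
norm and in `L²`, hence has at most one solution there. -/
theorem exists_unique_rescaled (h : IsBorderedGreen c V φ G) {K A : ℝ} (hA : 0 ≤ A) :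
    ∃ s₀ : ℝ, 0 < s₀ ∧ ∀ s, 0 ≤ s → s < s₀ → ∀ a b ν a' b' ν',
      IsRescaledBoundState c V φ K A s a b ν → IsRescaledBoundState c V φ K A s a' b' ν' →
      a = a' ∧ b = b' ∧ ν = ν' := by
  obtain ⟨C, hC, hG⟩ := h.bound 0
  set M : ℝ := 6 * K ^ 2 * A + 4 * K ^ 2 with hM
  have hM0 : 0 ≤ M := by positivity
  refine ⟨1 / (2 * C * M + 1), by positivity, fun s hs hs₀ a b ν a' b' ν' hab hab' => ?_⟩
  set D := ‖toL2 (a - a')‖ + ‖toL2 (b - b')‖ with hD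
  have hda := norm_nonneg (toL2 (a - a'))
  have hdb := norm_nonneg (toL2 (b - b'))
  have hK2 : 0 ≤ K ^ 2 := sq_nonneg K
  have hpair : ∀ f, |pair φ f| ≤ ‖toL2 f‖ := fun f => by
    simpa [h.norm_one] using abs_pair_le φ f
  have hn1 := norm_cubicRe_sub_le hab.sup_re hab.sup_im hab'.sup_re hab'.sup_im
  have hn2 := norm_cubicRe_sub_le hab.sup_im hab.sup_re hab'.sup_im hab'.sup_re
  have hn1' : ‖toL2 (cubicRe a b - cubicRe a' b')‖ ≤ 4 * K ^ 2 * D := by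
    refine hn1.trans ?_; rw [hD]; nlinarith [mul_nonneg hK2 hdb]
  have hn2' : ‖toL2 (cubicRe b a - cubicRe b' a')‖ ≤ 4 * K ^ 2 * D := by
    refine hn2.trans ?_; rw [hD]; nlinarith [mul_nonneg hK2 hda]
  have hν : |ν| ≤ s * (2 * K ^ 2 * A) := by
    rw [h.energy_eq hab, abs_mul, abs_of_nonneg hs]
    refine mul_le_mul_of_nonneg_left ((hpair _).trans
      ((norm_cubicRe_le hab.sup_re hab.sup_im).trans ?_)) hs
    exact mul_le_mul_of_nonneg_left hab.norm_re (by positivity)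
  have hνν : |ν - ν'| ≤ s * (4 * K ^ 2 * D) := by
    rw [h.energy_eq hab, h.energy_eq hab', ← mul_sub, ← map_sub, abs_mul, abs_of_nonneg hs]
    exact mul_le_mul_of_nonneg_left ((hpair _).trans hn1') hs
  have hDn : 0 ≤ D := by positivity
  have main : ∀ w w' n n', ‖toL2 w'‖ ≤ A → ‖toL2 (w - w')‖ ≤ D →
      ‖toL2 (n - n')‖ ≤ 4 * K ^ 2 * D → helm c w + mulS V w + s • n = ν • w →
      helm c w' + mulS V w' + s • n' = ν' • w' → pair φ w = pair φ w' →
      ‖toL2 (w - w')‖ ≤ C * (s * M * D) := by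
    intro w w' n n' h1 h2 h3 h4 h5 h6
    refine (h.norm_sub_le_of_equation hC hG hs h4 h5 h6).trans (mul_le_mul_of_nonneg_left ?_ hC)
    have e1 : |ν| * ‖toL2 (w - w')‖ ≤ s * (2 * K ^ 2 * A) * D :=
      mul_le_mul hν h2 (norm_nonneg _) (by positivity)
    have e2 : |ν - ν'| * ‖toL2 w'‖ ≤ s * (4 * K ^ 2 * D) * A :=
      mul_le_mul hνν h1 (norm_nonneg _) (by positivity)
    have e3 : s * ‖toL2 (n - n')‖ ≤ s * (4 * K ^ 2 * D) := mul_le_mul_of_nonneg_left h3 hs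
    calc _ ≤ s * (2 * K ^ 2 * A) * D + s * (4 * K ^ 2 * D) * A + s * (4 * K ^ 2 * D) :=
          add_le_add (add_le_add e1 e2) e3
      _ = s * M * D := by rw [hM]; ring
  have m1 := main a a' _ _ hab'.norm_re (by linarith) hn1' hab.equation_re hab'.equation_re
    (by rw [hab.pair_re, hab'.pair_re])
  have m2 := main b b' _ _ hab'.norm_im (by linarith) hn2' hab.equation_im hab'.equation_im
    (by rw [hab.pair_im, hab'.pair_im])
  have hlt : s * (2 * C * M + 1) < 1 := by rwa [lt_div_iff₀ (by positivity)] at hs₀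
  have hD0 : D = 0 := by
    by_contra hne
    have hpos : 0 < D := lt_of_le_of_ne hDn (Ne.symm hne)
    have h1 : D ≤ (s * (2 * C * M)) * D := by
      calc D ≤ C * (s * M * D) + C * (s * M * D) := add_le_add m1 m2
        _ = _ := by ring
    have h2 : s * (2 * C * M) < 1 := by nlinarith
    nlinarith
  have ea : a = a' := toL2_injective (sub_eq_zero.1 (by
    rw [← map_sub]; exact norm_eq_zero.1 (by linarith)))
  have eb : b = b' := toL2_injective (sub_eq_zero.1 (by
    rw [← map_sub]; exact norm_eq_zero.1 (by linarith)))
  refine ⟨ea, eb, ?_⟩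
  rw [h.energy_eq hab, h.energy_eq hab', ea, eb]

end IsBorderedGreen

theorem IsBoundState.eq_add {V : 𝓢(R3, ℝ)} {φ : L2} {φ₀ : 𝓢(R3, ℝ)}
    (hφ₀ : (ofRealS φ₀).toLp 2 (volume : Measure R3) = φ) {z : ℂ} {Q q : 𝓢(R3, ℂ)} {E : ℝ}
    (hQ : IsBoundState V φ z Q q E) : Q = z • ofRealS φ₀ + q := by
  apply SchwartzMap.injective_toLp (F := ℂ) 2 (volume : Measure R3)
  have h := hQ.decomposition
  rw [← hφ₀] at h
  refine h.trans ?_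
  have h1 := map_add (SchwartzMap.toLpCLM ℂ ℂ 2 (volume : Measure R3)) (z • ofRealS φ₀) q
  have h2 := map_smul (SchwartzMap.toLpCLM ℂ ℂ 2 (volume : Measure R3)) z (ofRealS φ₀)
  rw [h2] at h1
  exact h1.symm

theorem laplacian_smul_complex (z : ℂ) (Q : 𝓢(R3, ℂ)) : Δ (z • Q) = z • Δ Q := by
  simp only [laplacian_eq_sum_partialDeriv, map_smul, Finset.smul_sum]

theorem pair_reS_imS {φ : L2} {φ₀ : 𝓢(R3, ℝ)}
    (hφ₀ : (ofRealS φ₀).toLp 2 (volume : Measure R3) = φ) (q : 𝓢(R3, ℂ)) :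
    ∫ x : R3, q x * (starRingEnd ℂ) (φ x) =
      (pair φ₀ (reS q) : ℂ) + pair φ₀ (imS q) * Complex.I := by
  have h1 : ∀ f : 𝓢(R3, ℝ), Integrable (fun x => ((φ₀ x * f x : ℝ) : ℂ)) := fun f =>
    (integrable_mul φ₀ f).ofReal
  rw [pair_apply, pair_apply, inner_toL2, inner_toL2, ← integral_complex_ofReal,
    ← integral_complex_ofReal, ← integral_mul_const, ← integral_add (h1 _) ((h1 _).mul_const _)]
  refine integral_congr_ae ?_
  have h2 := (ofRealS φ₀).coeFn_toLp 2 (volume : Measure R3)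
  rw [hφ₀] at h2
  filter_upwards [h2] with x hx
  rw [hx, ofRealS_apply, Complex.conj_ofReal]
  conv_lhs => rw [← Complex.re_add_im (q x)]
  push_cast [reS_apply, imS_apply]
  ring

/-- A bound state with `‖q‖_{Σ_2} ≤ |z|` gives, after division by `z`, a rescaled bound state with
uniform bounds. -/
theorem exists_rescaled_of_boundState {V : 𝓢(R3, ℝ)} {e : ℝ} {φ : L2} {φ₀ : 𝓢(R3, ℝ)}
    (hφ₀ : (ofRealS φ₀).toLp 2 (volume : Measure R3) = φ) (h1 : ‖toL2 φ₀‖ = 1) :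
    ∃ K : ℝ, ∀ (z : ℂ) (Q q : 𝓢(R3, ℂ)) (E : ℝ), z ≠ 0 → IsBoundState V φ z Q q E →
      ‖toSigma ℂ 2 q‖ ≤ ‖z‖ →
      IsRescaledBoundState (-e) V φ₀ K 2 (‖z‖ ^ 2) (reS (z⁻¹ • Q)) (imS (z⁻¹ • Q)) (E - e) := by
  obtain ⟨C, hC, hsup⟩ := exists_sup_le_toSigma
  refine ⟨C * ‖toSigma ℝ 2 φ₀‖ + C, fun z Q q E hz hQ hq => ?_⟩
  have hself : pair φ₀ φ₀ = 1 := by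
    rw [pair_apply, real_inner_self_eq_norm_sq, h1]; norm_num
  set u := z⁻¹ • q with hu
  have hW : z⁻¹ • Q = ofRealS φ₀ + u := by
    rw [hQ.eq_add hφ₀, smul_add, smul_smul, inv_mul_cancel₀ hz, one_smul]
  have hu1 : ‖toSigma ℂ 2 u‖ ≤ 1 := by
    rw [hu, norm_toSigma_smul, norm_inv, inv_mul_le_iff₀ (norm_pos_iff.2 hz), mul_one]
    exact hq
  have hre : reS (z⁻¹ • Q) = φ₀ + reS u := by rw [hW, map_add, reS_ofRealS]
  have him : imS (z⁻¹ • Q) = imS u := by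
    rw [hW]; ext x; simp
  have hre1 := (norm_toSigma_reS_le 2 u).trans hu1
  have him1 := (norm_toSigma_imS_le 2 u).trans hu1
  have horth : pair φ₀ (reS u) = 0 ∧ pair φ₀ (imS u) = 0 := by
    have h2 := pair_reS_imS hφ₀ u
    have h3 : ∫ x : R3, u x * (starRingEnd ℂ) (φ x) = 0 := by
      have : ∀ x, u x * (starRingEnd ℂ) (φ x) = z⁻¹ * (q x * (starRingEnd ℂ) (φ x)) := fun x => by
        rw [hu, smul_apply, smul_eq_mul, mul_assoc]
      simp only [this]
      rw [integral_const_mul, hQ.orthogonal, mul_zero]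
    rw [h3] at h2
    exact ⟨by simpa using (congrArg Complex.re h2).symm,
      by simpa using (congrArg Complex.im h2).symm⟩
  have heq : ∀ x, -(Δ (z⁻¹ • Q)) x + (V x : ℂ) * (z⁻¹ • Q) x +
      ((‖z‖ ^ 2 * (((z⁻¹ • Q) x).re ^ 2 + ((z⁻¹ • Q) x).im ^ 2) : ℝ) : ℂ) * (z⁻¹ • Q) x =
        (E : ℂ) * (z⁻¹ • Q) x := by
    intro x
    have h2 := congrArg (fun y => z⁻¹ * y) (hQ.equation x)
    have h3 : ‖Q x‖ ^ 2 = ‖z‖ ^ 2 * (((z⁻¹ • Q) x).re ^ 2 + ((z⁻¹ • Q) x).im ^ 2) := by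
      have h4 : Q x = z * (z⁻¹ • Q) x := by
        rw [smul_apply, smul_eq_mul, mul_inv_cancel_left₀ hz]
      conv_lhs => rw [h4]
      rw [norm_mul, mul_pow, Complex.sq_norm ((z⁻¹ • Q) x), Complex.normSq_apply]
      ring
    rw [← h3, laplacian_smul_complex]
    simp only [smul_apply, smul_eq_mul] at h2 ⊢
    linear_combination h2
  refine ⟨?_, ?_, ?_, ?_, ?_, ?_, ?_, ?_⟩
  · ext x
    have h2 := congrArg Complex.re (heq x)
    simp only [add_apply, smul_apply, smul_eq_mul, helm_apply, sub_apply, lapl_reS, mulS_apply,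
      cubicRe_apply, reS_apply, imS_apply] at h2 ⊢
    simp only [Complex.add_re, Complex.neg_re, Complex.re_ofReal_mul] at h2
    linear_combination h2
  · ext x
    have h2 := congrArg Complex.im (heq x)
    simp only [add_apply, smul_apply, smul_eq_mul, helm_apply, sub_apply, lapl_imS, mulS_apply,
      cubicRe_apply, reS_apply, imS_apply] at h2 ⊢
    simp only [Complex.add_im, Complex.neg_im, Complex.im_ofReal_mul] at h2
    linear_combination h2
  · rw [hre, map_add, horth.1, hself, add_zero]
  · rw [him, horth.2]
  · intro x
    rw [hre, add_apply]
    refine (abs_add_le _ _).trans (add_le_add (hsup _ x) ((hsup _ x).trans ?_))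
    exact (mul_le_mul_of_nonneg_left hre1 hC).trans_eq (mul_one C)
  · intro x
    rw [him]
    refine (hsup _ x).trans ((mul_le_mul_of_nonneg_left him1 hC).trans ?_)
    have := mul_nonneg hC (norm_nonneg (toSigma ℝ 2 φ₀))
    linarith
  · rw [hre, map_add]
    refine (norm_add_le _ _).trans ?_
    have h2 : ‖toL2 (reS u)‖ ≤ 1 := (norm_toLp_le_norm_toSigma 2 (reS u)).trans hre1
    rw [h1]; linarith
  · rw [him]
    have h2 : ‖toL2 (imS u)‖ ≤ 1 := (norm_toLp_le_norm_toSigma 2 (imS u)).trans him1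
    linarith

/-- Two bound states with the same small parameter and `‖q‖_{Σ_2} ≤ |z|` agree. -/
theorem IsBorderedGreen.exists_unique_boundState {V : 𝓢(R3, ℝ)} {e : ℝ} {φ : L2}
    {φ₀ : 𝓢(R3, ℝ)} {G : 𝓢(R3, ℝ) →ₗ[ℝ] 𝓢(R3, ℝ)} (h : IsBorderedGreen (-e) V φ₀ G)
    (hφ₀ : (ofRealS φ₀).toLp 2 (volume : Measure R3) = φ) :
    ∃ s₀ : ℝ, 0 < s₀ ∧ ∀ (z : ℂ) (Q q Q' q' : 𝓢(R3, ℂ)) (E E' : ℝ), ‖z‖ ^ 2 < s₀ →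
      IsBoundState V φ z Q q E → ‖toSigma ℂ 2 q‖ ≤ ‖z‖ →
      IsBoundState V φ z Q' q' E' → ‖toSigma ℂ 2 q'‖ ≤ ‖z‖ →
      Q' = Q ∧ q' = q ∧ (z ≠ 0 → E' = E) := by
  obtain ⟨K, hK⟩ := exists_rescaled_of_boundState (V := V) (e := e) hφ₀ h.norm_one
  obtain ⟨s₀, hs₀, huniq⟩ := h.exists_unique_rescaled (K := K) (A := 2) (by norm_num)
  refine ⟨s₀, hs₀, fun z Q q Q' q' E E' hz hQ hq hQ' hq' => ?_⟩
  have key : Q' = Q → q' = q := fun hQQ => by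
    have h1 := hQ.eq_add hφ₀
    rw [← hQQ, hQ'.eq_add hφ₀] at h1
    exact add_left_cancel h1
  by_cases hz0 : z = 0
  · have hzero : ∀ p : 𝓢(R3, ℂ), ‖toSigma ℂ 2 p‖ ≤ ‖z‖ → p = 0 := fun p hp => by
      rw [hz0, norm_zero] at hp
      have h1 := (norm_toLp_le_norm_toSigma 2 p).trans hp
      rw [norm_le_zero_iff] at h1
      apply SchwartzMap.injective_toLp (F := ℂ) 2 (volume : Measure R3)
      exact h1.trans (map_zero (SchwartzMap.toLpCLM ℂ ℂ 2 (volume : Measure R3))).symm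
    have hQQ : Q' = Q := by
      rw [hQ.eq_add hφ₀, hQ'.eq_add hφ₀, hzero q hq, hzero q' hq']
    exact ⟨hQQ, key hQQ, fun h => absurd hz0 h⟩
  · obtain ⟨e1, e2, e3⟩ := huniq (‖z‖ ^ 2) (sq_nonneg _) hz _ _ _ _ _ _
      (hK z Q' q' E' hz0 hQ' hq') (hK z Q q E hz0 hQ hq)
    have hW : z⁻¹ • Q' = z⁻¹ • Q := by
      ext x
      exact Complex.ext (DFunLike.congr_fun e1 x) (DFunLike.congr_fun e2 x)
    have hQQ : Q' = Q := by
      have h1 := congrArg (fun P => z • P) hW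
      simpa [smul_smul, hz0] using h1
    exact ⟨hQQ, key hQQ, fun _ => by linarith⟩

/-! ### The family of bound states -/

/-- The real profile `Q(s) = φ + p(s)`, `p(s) = s q̃(s)`, of the bound states, where `s = |z|²`. -/
theorem IsBorderedGreen.exists_profile {c : ℝ} {V φ : 𝓢(R3, ℝ)}
    {G : 𝓢(R3, ℝ) →ₗ[ℝ] 𝓢(R3, ℝ)} (h : IsBorderedGreen c V φ G) :
    ∃ b : ℝ, 0 < b ∧ ∃ (qt : ℝ → 𝓢(R3, ℝ)) (lam : ℝ → ℝ),
      (∀ s ∈ Set.Ioo (-b) b, pair φ (s • qt s) = 0 ∧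
        helm c (φ + s • qt s) + mulS V (φ + s • qt s) + s • cube (φ + s • qt s) =
          (s * lam s) • (φ + s • qt s)) ∧
      (∀ k, ContDiffOn ℝ ∞ (fun s => ι k (qt s)) (Set.Ioo (-b) b)) ∧
      ContDiffOn ℝ ∞ lam (Set.Ioo (-b) b) := by
  obtain ⟨b, hb, Q, hQ, hQs⟩ := h.exists_branch
  have hQe : ∀ s ∈ Set.Ioo (-b) b, φ + s • -G (nonlin φ (Q s)) = Q s := fun s hs => by
    rw [smul_neg, ← sub_eq_add_neg]; exact (hQ s hs).1.symm
  refine ⟨b, hb, fun s => -G (nonlin φ (Q s)), fun s => pair φ (cube (Q s)),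
    fun s hs => ⟨?_, ?_⟩, fun k => ?_, ?_⟩
  · have h1 := congrArg (pair φ) (hQe s hs)
    rw [map_add, h.pair_self, (hQ s hs).2] at h1
    linarith
  · simp only [hQe s hs]
    have h1 := h.right_inv (nonlin φ (Q s))
    have h2 : pair φ (G (nonlin φ (Q s))) = 0 := by
      rw [h.pair_green, nonlin, map_sub, map_smul, (hQ s hs).2]; simp
    rw [pert_apply, h2, zero_smul, add_zero] at h1
    have h3 : helm c (Q s) + mulS V (Q s) = -(s • nonlin φ (Q s)) := by
      rw [← h1]
      conv_lhs => rw [(hQ s hs).1]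
      rw [map_sub, map_sub, map_smul, map_smul]
      linear_combination (norm := module) (1 : ℝ) • h.eigen
    rw [h3, nonlin]
    module
  · obtain ⟨F, hF, hFι⟩ := h.exists_nonlin_extend (k := k + 4) (by omega)
    have h1 := ((lift (k + 4) k LinearMap.id).contDiff (n := ∞)).comp_contDiffOn
      ((hF.of_le le_top).comp_contDiffOn (hQs (k + 4)))
    refine h1.neg.congr fun s hs => ?_
    simp only [Function.comp_apply, hFι, lift_id_ι (Nat.le_add_right k 4), map_neg]
  · obtain ⟨M, hM, hMι⟩ := exists_cube_extend (le_refl 4)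
    obtain ⟨l, hl⟩ := exists_pair_extend φ 4
    have h1 := (l.contDiff (n := ∞)).comp_contDiffOn
      ((hM.of_le le_top).comp_contDiffOn (hQs 4))
    refine h1.congr fun s hs => ?_
    simp only [Function.comp_apply, hMι, hl]

/-- A real profile gives bound states `z Q(|z|²)` for all complex parameters. -/
theorem isBoundState_of_profile {V : 𝓢(R3, ℝ)} {e : ℝ} {φ : L2} {φ₀ : 𝓢(R3, ℝ)}
    (hφ₀ : (ofRealS φ₀).toLp 2 (volume : Measure R3) = φ) {p : 𝓢(R3, ℝ)} {ν : ℝ} (z : ℂ)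
    (hp : pair φ₀ p = 0)
    (heq : helm (-e) (φ₀ + p) + mulS V (φ₀ + p) + (‖z‖ ^ 2) • cube (φ₀ + p) = ν • (φ₀ + p)) :
    IsBoundState V φ z (z • ofRealS (φ₀ + p)) (z • ofRealS p) (e + ν) where
  equation x := by
    have h1 := congrArg (fun f : 𝓢(R3, ℝ) => ((f x : ℝ) : ℂ)) heq
    have h2 := neg_laplacian_ofRealS (-e) (φ₀ + p) x
    simp only [smul_apply, smul_eq_mul] at h1
    rw [laplacian_smul_complex]
    set R := φ₀ + p
    have h3 : ‖(z • ofRealS R) x‖ ^ 2 = ‖z‖ ^ 2 * R x ^ 2 := by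
      rw [smul_apply, ofRealS_apply, smul_eq_mul, norm_mul, mul_pow, Complex.norm_real,
        Real.norm_eq_abs, sq_abs]
    rw [h3]
    simp only [add_apply, smul_apply, smul_eq_mul, ofRealS_apply, mulS_apply, cube_apply] at h1 ⊢
    push_cast at h1 h2 ⊢
    linear_combination z * h2 + z * h1
  decomposition := by
    have h1 := map_add (SchwartzMap.toLpCLM ℂ ℂ 2 (volume : Measure R3)) (z • ofRealS φ₀)
      (z • ofRealS p)
    have h2 := map_smul (SchwartzMap.toLpCLM ℂ ℂ 2 (volume : Measure R3)) z (ofRealS φ₀)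
    rw [h2, ← smul_add, ← map_add] at h1
    rw [← hφ₀]
    exact h1
  orthogonal := by
    have h1 := pair_reS_imS hφ₀ (ofRealS p)
    have h2 : imS (ofRealS p) = 0 := by ext x; simp
    rw [reS_ofRealS, h2, map_zero, hp] at h1
    have h3 : ∀ x, (z • ofRealS p) x * (starRingEnd ℂ) (φ x) =
        z * (ofRealS p x * (starRingEnd ℂ) (φ x)) := fun x => by
      rw [smul_apply, smul_eq_mul, mul_assoc]
    simp only [h3]
    rw [integral_const_mul, h1]
    simp

/-- In any family of bound states the remainder satisfies `‖q_z‖_{Σ_2} ≤ |z|`, provided that this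
bound implies the stronger one `‖q_z‖_{Σ_2} ≤ |z| / 2`: along a ray the quotient `‖q_z‖ / |z|`
starts at zero and cannot cross the gap. -/
theorem IsBoundStateFamily.norm_le {V : 𝓢(R3, ℝ)} {e : ℝ} {φ : L2} {a : ℝ}
    {Q q : ℂ → 𝓢(R3, ℂ)} {E : ℂ → ℝ} (hF : IsBoundStateFamily V e φ a Q q E)
    (hgap : ∀ z ∈ Metric.ball (0 : ℂ) a, ‖toSigma ℂ 2 (q z)‖ ≤ ‖z‖ →
      ‖toSigma ℂ 2 (q z)‖ ≤ 1 / 2 * ‖z‖) :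
    ∀ z ∈ Metric.ball (0 : ℂ) a, ‖toSigma ℂ 2 (q z)‖ ≤ ‖z‖ := by
  intro z hz
  obtain ⟨C, hC, hb⟩ := hF.bounds 2
  by_contra! hlt
  have hz0 : 0 < ‖z‖ := by
    by_contra! h0
    have h1 : ‖z‖ = 0 := le_antisymm h0 (norm_nonneg z)
    have h2 := (hb z hz).1
    rw [h1] at h2 hlt
    norm_num at h2 hlt
    exact hlt h2
  have hza : ‖z‖ < a := by simpa using hz
  have hball : ∀ t : ℝ, 0 ≤ t → t ≤ 1 → (t : ℂ) * z ∈ Metric.ball (0 : ℂ) a := fun t h0 h1 => by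
    rw [mem_ball_zero_iff, norm_mul, Complex.norm_real, Real.norm_eq_abs, abs_of_nonneg h0]
    nlinarith
  have hnorm : ∀ t : ℝ, 0 ≤ t → ‖(t : ℂ) * z‖ = t * ‖z‖ := fun t h0 => by
    rw [norm_mul, Complex.norm_real, Real.norm_eq_abs, abs_of_nonneg h0]
  -- `t₀` is so small that `C (t₀|z|)³ < (3/4) t₀|z|`; cross the level `3/4` between `t₀` and `1`.
  set t₀ : ℝ := 1 / (2 * (1 + C * ‖z‖ ^ 2)) with ht₀
  have hD : 0 < 1 + C * ‖z‖ ^ 2 := by positivity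
  have ht₀0 : 0 < t₀ := by positivity
  have ht₀1 : t₀ ≤ 1 / 2 := by
    rw [ht₀, div_le_div_iff₀ (by positivity) (by norm_num)]
    nlinarith [mul_pos hC (pow_pos hz0 2)]
  have ht₀e : t₀ * (1 + C * ‖z‖ ^ 2) = 1 / 2 := by rw [ht₀]; field_simp
  let f : ℝ → ℝ := fun t => ‖toSigma ℂ 2 (q ((t : ℂ) * z))‖ - 3 / 4 * (t * ‖z‖)
  have hcont : ContinuousOn f (Set.Icc t₀ 1) := by
    have h1 : ContinuousOn (fun z => toSigma ℂ 2 (q z)) (Metric.ball (0 : ℂ) a) :=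
      continuous_fst.comp_continuousOn (hF.smooth 2).continuousOn
    have h2 : ContinuousOn (fun t : ℝ => (t : ℂ) * z) (Set.Icc t₀ 1) := by fun_prop
    refine ((h1.comp h2 fun t ht => hball t (ht₀0.le.trans ht.1) ht.2).norm).sub ?_
    fun_prop
  have hf0 : f t₀ ≤ 0 := by
    have h1 := (hb _ (hball t₀ ht₀0.le (by linarith))).1
    rw [hnorm t₀ ht₀0.le] at h1
    have h2 : C * (t₀ * ‖z‖) ^ 3 ≤ 1 / 2 * (t₀ * ‖z‖) := by
      have h3 : C * (t₀ * ‖z‖) ^ 3 = (t₀ * (C * ‖z‖ ^ 2)) * t₀ * (t₀ * ‖z‖) := by ring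
      rw [h3]
      refine mul_le_mul_of_nonneg_right ?_ (by positivity)
      have h4 : t₀ * (C * ‖z‖ ^ 2) ≤ 1 / 2 := by linarith
      have h5 : 0 ≤ t₀ * (C * ‖z‖ ^ 2) := by positivity
      nlinarith
    have h3 : 0 < t₀ * ‖z‖ := by positivity
    simp only [f]
    linarith
  have hf1 : 0 ≤ f 1 := by
    simp only [f, Complex.ofReal_one, one_mul]
    linarith
  obtain ⟨t, ht, hft⟩ := intermediate_value_Icc (by linarith) hcont ⟨hf0, hf1⟩
  have ht0 : 0 < t := ht₀0.trans_le ht.1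
  have h1 : ‖toSigma ℂ 2 (q ((t : ℂ) * z))‖ = 3 / 4 * (t * ‖z‖) := by
    simp only [f] at hft
    linarith
  have h2 := hgap _ (hball t ht0.le ht.2)
  rw [hnorm t ht0.le, h1] at h2
  have h3 : 0 < t * ‖z‖ := by positivity
  linarith [h2 (by linarith)]

theorem ofRealS_smul (a : ℝ) (f : 𝓢(R3, ℝ)) : ofRealS (a • f) = (a : ℂ) • ofRealS f := by
  ext x; simp

/-- The bifurcating family: one choice of `(Q, q, E)` works on all discs of sufficiently small
radius. The extra bound `|z| / 2` leaves the gap used for uniqueness. -/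
theorem IsBorderedGreen.exists_family {V : 𝓢(R3, ℝ)} {e : ℝ} {φ : L2} {φ₀ : 𝓢(R3, ℝ)}
    {G : 𝓢(R3, ℝ) →ₗ[ℝ] 𝓢(R3, ℝ)} (h : IsBorderedGreen (-e) V φ₀ G)
    (hφ₀ : (ofRealS φ₀).toLp 2 (volume : Measure R3) = φ) :
    ∃ m₀ : ℝ, 0 < m₀ ∧ ∃ (Q q : ℂ → 𝓢(R3, ℂ)) (E : ℂ → ℝ), ∀ a : ℝ, 0 < a → a ^ 2 ≤ m₀ →
      IsBoundStateFamily V e φ a Q q E ∧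
      ∀ z ∈ Metric.ball (0 : ℂ) a, ‖toSigma ℂ 2 (q z)‖ ≤ 1 / 2 * ‖z‖ := by
  obtain ⟨b, hb, qt, lam, hsol, hqt, hlam⟩ := h.exists_profile
  have hsub : Set.Icc 0 (b / 2) ⊆ Set.Ioo (-b) b := fun s hs =>
    ⟨by linarith [hs.1], by linarith [hs.2]⟩
  have hbound : ∀ r, ∃ C : ℝ, 0 < C ∧ ∀ s ∈ Set.Icc 0 (b / 2),
      ‖toSigma ℂ r (ofRealS (qt s))‖ ≤ C ∧ |lam s| ≤ C := by
    intro r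
    obtain ⟨T, hT⟩ := exists_sigma_complex_extend r
    have h1 : ContinuousOn (fun s => toSigma ℂ r (ofRealS (qt s))) (Set.Icc 0 (b / 2)) := by
      simp only [← hT]
      exact T.continuous.comp_continuousOn ((hqt r).continuousOn.mono hsub)
    obtain ⟨C1, hC1⟩ := isCompact_Icc.exists_bound_of_continuousOn h1
    obtain ⟨C2, hC2⟩ := isCompact_Icc.exists_bound_of_continuousOn (hlam.continuousOn.mono hsub)
    refine ⟨|C1| + |C2| + 1, by positivity, fun s hs => ⟨(hC1 s hs).trans ?_,
      (hC2 s hs).trans ?_⟩⟩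
    · linarith [le_abs_self C1, abs_nonneg C2]
    · linarith [le_abs_self C2, abs_nonneg C1]
  obtain ⟨C₂, hC₂, hb₂⟩ := hbound 2
  have hqnorm : ∀ (r : ℕ) (z : ℂ), ‖toSigma ℂ r (z • ofRealS (‖z‖ ^ 2 • qt (‖z‖ ^ 2)))‖ =
      ‖toSigma ℂ r (ofRealS (qt (‖z‖ ^ 2)))‖ * ‖z‖ ^ 3 := fun r z => by
    rw [norm_toSigma_smul, ofRealS_smul, norm_toSigma_smul, Complex.norm_real, Real.norm_eq_abs,
      abs_of_nonneg (sq_nonneg _)]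
    ring
  refine ⟨min (b / 2) (1 / (2 * C₂)), lt_min (by linarith) (by positivity),
    fun z => z • ofRealS (φ₀ + ‖z‖ ^ 2 • qt (‖z‖ ^ 2)),
    fun z => z • ofRealS (‖z‖ ^ 2 • qt (‖z‖ ^ 2)),
    fun z => e + ‖z‖ ^ 2 * lam (‖z‖ ^ 2), fun a ha ham => ⟨?_, fun z hz => ?_⟩⟩
  · have hab : a ^ 2 ≤ b / 2 := ham.trans (min_le_left _ _)
    have hz : ∀ z ∈ Metric.ball (0 : ℂ) a, ‖z‖ ^ 2 ∈ Set.Ico 0 (a ^ 2) := fun z hz =>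
      ⟨sq_nonneg _, by
        have : ‖z‖ < a := by simpa using hz
        exact pow_lt_pow_left₀ this (norm_nonneg z) two_ne_zero⟩
    have hIcc : ∀ z ∈ Metric.ball (0 : ℂ) a, ‖z‖ ^ 2 ∈ Set.Icc 0 (b / 2) := fun z h =>
      ⟨(hz z h).1, (hz z h).2.le.trans hab⟩
    have hI : Set.Ioo (-a ^ 2) (a ^ 2) ⊆ Set.Ioo (-b) b := fun s hs =>
      ⟨by linarith [hs.1], by linarith [hs.2]⟩
    have hsq : ContDiffOn ℝ ∞ (fun z : ℂ => ‖z‖ ^ 2) (Metric.ball (0 : ℂ) a) :=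
      (contDiff_norm_sq ℝ).contDiffOn
    have hmaps : Set.MapsTo (fun z : ℂ => ‖z‖ ^ 2) (Metric.ball (0 : ℂ) a) (Set.Ioo (-b) b) :=
      fun z h => hsub (hIcc z h)
    refine ⟨fun z h => ?_, fun r => ?_, ?_, ?_, fun r => ?_⟩
    · exact isBoundState_of_profile hφ₀ z (hsol _ (hmaps h)).1 (hsol _ (hmaps h)).2
    · obtain ⟨T, hT⟩ := exists_sigma_complex_extend r
      refine ContDiffOn.prodMk ?_ ?_
      · have h1 : ContDiffOn ℝ ∞ (fun z : ℂ => ‖z‖ ^ 2 • ι r (qt (‖z‖ ^ 2)))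
            (Metric.ball (0 : ℂ) a) := hsq.smul ((hqt r).comp hsq hmaps)
        have h2 : ContDiffOn ℝ ∞ (fun z : ℂ => z • T (‖z‖ ^ 2 • ι r (qt (‖z‖ ^ 2))))
            (Metric.ball (0 : ℂ) a) := contDiffOn_id.smul (T.contDiff.comp_contDiffOn h1)
        refine h2.congr fun z hz => ?_
        rw [toSigma_smul, ← hT, map_smul (ι r)]
      · exact contDiffOn_const.add (hsq.mul (hlam.comp hsq hmaps))
    · refine ⟨fun s => s • qt s, qt, fun z h x => ?_, fun t ht => rfl, fun r => ?_⟩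
      · rw [smul_apply, ofRealS_apply, smul_eq_mul]
      · obtain ⟨T, hT⟩ := exists_sigma_real_extend r
        simp only [← hT]
        exact T.contDiff.comp_contDiffOn ((hqt r).mono hI)
    · exact ⟨fun s => e + s * lam s, fun z h => rfl,
        contDiffOn_const.add (contDiffOn_id.mul (hlam.mono hI))⟩
    · obtain ⟨C, hC, hbr⟩ := hbound r
      refine ⟨C, hC, fun z h => ⟨?_, ?_⟩⟩
      · rw [hqnorm]
        exact mul_le_mul_of_nonneg_right (hbr _ (hIcc z h)).1 (by positivity)
      · rw [add_sub_cancel_left, abs_mul, abs_of_nonneg (sq_nonneg _), mul_comm]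
        exact mul_le_mul_of_nonneg_right (hbr _ (hIcc z h)).2 (by positivity)
  · have hza : ‖z‖ < a := by simpa using hz
    have h1 : ‖z‖ ^ 2 ≤ min (b / 2) (1 / (2 * C₂)) :=
      (pow_le_pow_left₀ (norm_nonneg z) hza.le 2).trans ham
    have h2 := (hb₂ (‖z‖ ^ 2) ⟨sq_nonneg _, h1.trans (min_le_left _ _)⟩).1
    have h3 : C₂ * ‖z‖ ^ 2 ≤ 1 / 2 := by
      have h4 := mul_le_mul_of_nonneg_left (h1.trans (min_le_right _ _)) hC₂.le
      refine h4.trans_eq ?_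
      field_simp
    rw [hqnorm]
    calc _ ≤ C₂ * ‖z‖ ^ 3 := mul_le_mul_of_nonneg_right h2 (by positivity)
      _ = (C₂ * ‖z‖ ^ 2) * ‖z‖ := by ring
      _ ≤ _ := mul_le_mul_of_nonneg_right h3 (norm_nonneg z)

/-- Existence of the inverse of the bordered operator at a simple eigenvalue. -/
theorem exists_isBorderedGreen (V : 𝓢(R3, ℝ)) {e : ℝ} (he : e < 0)
    (hsimple : Module.finrank ℂ (eigenspace V e) = 1) (φ : L2) (hφ : φ ∈ eigenspace V e)
    (hnorm : ‖φ‖ = 1) (hreal : ∀ᵐ x : R3, (φ x).im = 0) :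
    ∃ (φ₀ : 𝓢(R3, ℝ)) (G : 𝓢(R3, ℝ) →ₗ[ℝ] 𝓢(R3, ℝ)),
      (ofRealS φ₀).toLp 2 (volume : Measure R3) = φ ∧ IsBorderedGreen (-e) V φ₀ G := by
  have hc : 0 < -e := by linarith
  obtain ⟨φ₀, hφ₀, heq⟩ := exists_schwartz_eigenfunction V he φ hφ hreal
  have h1 : ‖toL2 φ₀‖ = 1 := by rw [← norm_toLp_ofRealS, hφ₀, hnorm]
  have hne : φ₀ ≠ 0 := by
    rintro rfl
    rw [map_zero, norm_zero] at h1
    exact zero_ne_one h1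
  have hinj : ∀ u, helm (-e) u + pert V φ₀ u = 0 → u = 0 :=
    bordered_injective V φ₀ heq h1 (exists_smul_of_simple V e hsimple φ₀ heq hne)
  obtain ⟨G, hG, hGb⟩ := exists_green hc V φ₀ hinj
  exact ⟨φ₀, G, hφ₀, hc, heq, h1, hG, hinj, hGb⟩

end NLSBoundState

end

theorem proposition1p1
    (V : 𝓢(NLSBoundState.R3, ℝ)) (e : ℝ) (he : e < 0)
    (hsimple : Module.finrank ℂ (NLSBoundState.eigenspace V e) = 1)
    (φ : NLSBoundState.L2) (hφ : φ ∈ NLSBoundState.eigenspace V e) (hnorm : ‖φ‖ = 1)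
    (hreal : ∀ᵐ x : NLSBoundState.R3, (φ x).im = 0) :
    ∃ a : ℝ, 0 < a ∧
      ∃ (Q q : ℂ → 𝓢(NLSBoundState.R3, ℂ)) (E : ℂ → ℝ),
        NLSBoundState.IsBoundStateFamily V e φ a Q q E ∧
        (∀ (Q' q' : ℂ → 𝓢(NLSBoundState.R3, ℂ)) (E' : ℂ → ℝ),
          NLSBoundState.IsBoundStateFamily V e φ a Q' q' E' →
          ∀ z ∈ Metric.ball (0 : ℂ) a, Q' z = Q z ∧ q' z = q z ∧ E' z = E z) ∧
        ∃ δ : ℝ, 0 < δ ∧ ∀ z ∈ Metric.ball (0 : ℂ) a,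
          ‖NLSBoundState.toSigma ℂ 2 (q z)‖ ≤ δ * ‖z‖ ∧
          ∀ (Q' q' : 𝓢(NLSBoundState.R3, ℂ)) (E' : ℝ),
            NLSBoundState.IsBoundState V φ z Q' q' E' →
            ‖NLSBoundState.toSigma ℂ 2 q'‖ ≤ δ * ‖z‖ →
            Q' = Q z ∧ q' = q z ∧ (z ≠ 0 → E' = E z) := by
  obtain ⟨φ₀, G, hφ₀, hG⟩ :=
    NLSBoundState.exists_isBorderedGreen V he hsimple φ hφ hnorm hreal
  obtain ⟨m₀, hm₀, Q, q, E, hfam⟩ := hG.exists_family hφ₀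
  obtain ⟨s₀, hs₀, huniq⟩ := hG.exists_unique_boundState hφ₀
  have hm : 0 < min m₀ s₀ := lt_min hm₀ hs₀
  have ha2 : √(min m₀ s₀) ^ 2 = min m₀ s₀ := Real.sq_sqrt hm.le
  obtain ⟨hF, hhalf⟩ := hfam √(min m₀ s₀) (Real.sqrt_pos.2 hm) (ha2.trans_le (min_le_left _ _))
  have hle : ∀ z ∈ Metric.ball (0 : ℂ) √(min m₀ s₀),
      ‖NLSBoundState.toSigma ℂ 2 (q z)‖ ≤ ‖z‖ := fun z hz =>
    (hhalf z hz).trans (by linarith [norm_nonneg z])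
  have hlt : ∀ z ∈ Metric.ball (0 : ℂ) √(min m₀ s₀), ‖z‖ ^ 2 < s₀ := fun z hz => by
    have h1 : ‖z‖ < √(min m₀ s₀) := by simpa using hz
    exact (pow_lt_pow_left₀ h1 (norm_nonneg z) two_ne_zero).trans_le
      (ha2.trans_le (min_le_right _ _))
  refine ⟨√(min m₀ s₀), Real.sqrt_pos.2 hm, Q, q, E, hF, fun Q' q' E' hF' z hz => ?_,
    1, one_pos, fun z hz => ⟨by rw [one_mul]; exact hle z hz, fun Q' q' E' hQ' hq' => ?_⟩⟩
  · have hle' := hF'.norm_le (fun w hw h => by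
      rw [(huniq w _ _ _ _ _ _ (hlt w hw) (hF.boundState w hw) (hle w hw)
        (hF'.boundState w hw) h).2.1]
      exact hhalf w hw) z hz
    obtain ⟨e1, e2, e3⟩ := huniq z _ _ _ _ _ _ (hlt z hz) (hF.boundState z hz) (hle z hz)
      (hF'.boundState z hz) hle'
    refine ⟨e1, e2, ?_⟩
    by_cases hz0 : z = 0
    · -- At `z = 0` the energy is not determined by the equation but by the bound `|E - e| ≤ C|z|²`.
      obtain ⟨C, -, hC⟩ := hF.bounds 0
      obtain ⟨C', -, hC'⟩ := hF'.bounds 0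
      have h1 := (hC z hz).2
      have h2 := (hC' z hz).2
      rw [hz0, norm_zero, zero_pow two_ne_zero, mul_zero, abs_nonpos_iff, sub_eq_zero] at h1 h2
      rw [hz0, h1, h2]
    · exact e3 hz0
  · rw [one_mul] at hq'
    exact huniq z _ _ _ _ _ _ (hlt z hz) (hF.boundState z hz) (hle z hz) hQ' hq'
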